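/- **Theorem (Fundamental solutions of $\mathcal{D}_3$).** Let $m\ge 3$ and $k\ge 0$ be integers, with $k=0$ if $m=4$. Let $\mathcal{C}l_m(\mathbb{C})$ be the complex Clifford algebra generated by $\mathbb{R}^m$ with $x^2=-\|x\|^2$ for $x\in\mathbb{R}^m$, with orthonormal basis $e_1,\dots,e_m$ of $\mathbb{R}^m$ and Clifford conjugation $a\mapsto\bar a$ (the conjugate-linear anti-automorphism with $\bar e_i=-e_i$). Put $D_x=\sum_i e_i\partial_{x_i}$, $D_u=\sum_i e_i\partial_{u_i}$, $\langle u,D_x\rangle=\sum_i u_i\partial_{x_i}$ and $\langle D_u,D_x\rangle=\sum_i\partial_{u_i}\partial_{x_i}$. Let $\mathcal{M}_k$ be the space of $\mathcal{C}l_m(\mathbb{C})$-valued polynomials $p(u)$ on $\mathbb{R}^m$, homogeneous of degree $k$, with $D_up=0$. Let $\mathcal{D}_3$ be the operator on $\mathcal{M}_k$-valued functions (or distributions) of $x\in\mathbb{R}^m$ given by $$\begin{aligned}\mathcal{D}_{3}={}&D_x^3+\frac{4}{m+2k}\langle u, D_x\rangle\langle D_u, D_x\rangle D_x-\frac{4\|u\|^2\langle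 D_u, D_x\rangle^2D_x}{(m+2k)(m+2k-2)}-\frac{2u\langle D_u, D_x\rangle D_x^2}{m+2k}\\&-\frac{8u\langle u, D_x\rangle\langle D_u,D_x\rangle^2}{(m+2k)(m+2k-2)}-\frac{8u^3\langle D_u,D_x\rangle^3}{(m+2k)(m+2k-2)(m+2k-4)}\end{aligned}$$ (the last term vanishes for $k\le 2$ and is omitted then). There is a unique reproducing kernel $Z_k(u,v)$ of $\mathcal{M}_k$, that is, a unique function $Z_k:\mathbb{R}^m\times\mathbb{R}^m\to\mathcal{C}l_m(\mathbb{C})$ such that $Z_k(\cdot,v)\in\mathcal{M}_k$ for every $v$ and $\int_{\mathbb{S}^{m-1}}\overline{Z_k(u,v)}f(u)\,dS(u)=f(v)$ for all $f\in\mathcal{M}_k$ and $v\in\mathbb{R}^m$. Moreover, there is a real constant $c_1\neq 0$, depending only on $m$ and $k$, such that $$E(x,u,v)=c_1\,\frac{x}{\|x\|^{m-2}}\,Z_k\!\left(\frac{xux}{\|x\|^2},v\right)$$ is a fundamental solution of $\mathcal{D}_3$: for every $v\in\mathbb{R}^m$, the function $x\mapsto E(x,u,v)$ is locally integrable on $\mathbb{R}^m$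 for every $u$, $E(x,\cdot,v)\in\mathcal{M}_k$ for every $x\ne0$, and $$\mathcal{D}_3E(x,u,v)=\delta(x)\,Z_k(u,v)$$ in the sense of distributions in $x$, where $\delta$ is the Dirac distribution at the origin. -/

import Mathlib

open MeasureTheory
open scoped TensorProduct Distributions LineDeriv

noncomputable section

namespace HigherSpin

/-- Euclidean space `ℝᵐ`. -/
abbrev Vec (m : ℕ) : Type := EuclideanSpace ℝ (Fin m)

/-- The standard orthonormal basis vector `eᵢ` of `ℝᵐ`. -/
def stdVec {m : ℕ} (i : Fin m) : Vec m := EuclideanSpace.single i (1 : ℝ)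

/-- The quadratic form `x ↦ -‖x‖²` on `ℝᵐ`. -/
def negNormSq (m : ℕ) : QuadraticForm ℝ (Vec m) :=
  -(LinearMap.BilinMap.toQuadraticMap (innerₗ (Vec m)))

lemma negNormSq_apply {m : ℕ} (x : Vec m) : negNormSq m x = -‖x‖ ^ 2 := by
  simp [negNormSq]

/-- The complex Clifford algebra `Cl_m(ℂ) = ℂ ⊗ Cl_m`, where `x² = -‖x‖²` for `x ∈ ℝᵐ`. -/
def Cl (m : ℕ) : Type := ℂ ⊗[ℝ] CliffordAlgebra (negNormSq m)

instance (m : ℕ) : Ring (Cl m) :=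
  inferInstanceAs (Ring (ℂ ⊗[ℝ] CliffordAlgebra (negNormSq m)))

instance (m : ℕ) : Algebra ℂ (Cl m) :=
  inferInstanceAs (Algebra ℂ (ℂ ⊗[ℝ] CliffordAlgebra (negNormSq m)))

instance (m : ℕ) : StarModule ℝ (CliffordAlgebra (negNormSq m)) :=
  ⟨fun r a => by rw [CliffordAlgebra.star_smul, star_trivial r]⟩

/-- Clifford conjugation `a ↦ ā` on `Cl_m(ℂ)`: the conjugate-linear anti-automorphism with
`ēᵢ = -eᵢ` (see `star_vec`). -/
instance (m : ℕ) : StarRing (Cl m) :=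
  inferInstanceAs (StarRing (ℂ ⊗[ℝ] CliffordAlgebra (negNormSq m)))

instance (m : ℕ) : StarModule ℂ (Cl m) := by
  refine ⟨fun z a => ?_⟩
  have h : star (algebraMap ℂ (Cl m) z) = algebraMap ℂ (Cl m) (star z) := by
    change star (z ⊗ₜ[ℝ] (1 : CliffordAlgebra (negNormSq m))) =
      (star z) ⊗ₜ[ℝ] (1 : CliffordAlgebra (negNormSq m))
    rw [TensorProduct.star_tmul, star_one]
  rw [Algebra.smul_def, Algebra.smul_def, star_mul, h, Algebra.commutes]

/-- The basis of `Cl_m(ℂ)` indexed by subsets of `{1, …, m}`. -/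
def clBasis (m : ℕ) : Module.Basis (Finset (Fin m)) ℂ (Cl m) :=
  Algebra.TensorProduct.basis ℂ
    ((EuclideanSpace.basisFun (Fin m) ℝ).toBasis.ExteriorAlgebra.map
      (CliffordAlgebra.equivExterior (negNormSq m)).symm)

/-- `Cl_m(ℂ)` carries the norm of the largest coordinate. It is finite-dimensional, so that
derivatives and integrals of `Cl_m(ℂ)`-valued functions do not depend on the choice of norm. -/
instance (m : ℕ) : NormedAddCommGroup (Cl m) :=
  NormedAddCommGroup.induced (Cl m) (Finset (Fin m) → ℂ) (clBasis m).equivFun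
    (clBasis m).equivFun.injective

instance (m : ℕ) : NormedSpace ℂ (Cl m) :=
  NormedSpace.induced ℂ (Cl m) (Finset (Fin m) → ℂ) (clBasis m).equivFun

instance (m : ℕ) : FiniteDimensional ℂ (Cl m) := (clBasis m).finiteDimensional_of_finite

instance (m : ℕ) : CompleteSpace (Cl m) := FiniteDimensional.complete ℂ (Cl m)

/-- The embedding `ℝᵐ ⊆ Cl_m(ℂ)`. -/
def vec {m : ℕ} (x : Vec m) : Cl m :=
  (1 : ℂ) ⊗ₜ[ℝ] CliffordAlgebra.ι (negNormSq m) x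

lemma vec_add {m : ℕ} (x y : Vec m) : vec (x + y) = vec x + vec y := by
  simp only [vec, map_add]
  exact TensorProduct.tmul_add _ _ _

lemma vec_smul {m : ℕ} (r : ℝ) (x : Vec m) : vec (r • x) = (r : ℂ) • vec x := by
  simp only [vec, map_smul, TensorProduct.tmul_smul]
  rw [TensorProduct.smul_tmul']
  change _ = TensorProduct.tmul ℝ ((r : ℂ) • (1 : ℂ)) _
  simp

lemma vec_mul_self {m : ℕ} (x : Vec m) : vec x * vec x = algebraMap ℂ (Cl m) (-‖x‖ ^ 2 : ℝ) := by
  change ((1 : ℂ) ⊗ₜ[ℝ] CliffordAlgebra.ι (negNormSq m) x) * _ = _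
  erw [Algebra.TensorProduct.tmul_mul_tmul]
  rw [CliffordAlgebra.ι_sq_scalar, negNormSq_apply, Algebra.algebraMap_eq_smul_one,
    ← TensorProduct.smul_tmul]
  change _ = ((-‖x‖ ^ 2 : ℝ) : ℂ) ⊗ₜ[ℝ] (1 : CliffordAlgebra (negNormSq m))
  simp

lemma star_vec {m : ℕ} (x : Vec m) : star (vec x) = -vec x := by
  change star ((1 : ℂ) ⊗ₜ[ℝ] CliffordAlgebra.ι (negNormSq m) x) = _
  rw [TensorProduct.star_tmul, CliffordAlgebra.star_ι, TensorProduct.tmul_neg, star_one]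
  rfl

/-! ### Monogenic polynomials -/

/-- The `Cl_m(ℂ)`-valued polynomial functions on `ℝᵐ` that are homogeneous of degree `k`:
sums of terms `u₁^α₁ ⋯ u_m^α_m a` with `|α| = k` and `a ∈ Cl_m(ℂ)`. -/
def homogPoly (m k : ℕ) : Submodule ℂ (Vec m → Cl m) :=
  Submodule.span ℂ {p | ∃ (α : Fin m → ℕ) (a : Cl m), ∑ i, α i = k ∧
    p = fun u => (∏ i, u i ^ α i) • a}

/-- The Dirac operator `D_u = ∑ᵢ eᵢ ∂_{uᵢ}`. -/
def diracU {m : ℕ} (p : Vec m → Cl m) : Vec m → Cl m :=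
  fun u => ∑ i, vec (stdVec i) * fderiv ℝ p u (stdVec i)

/-- `𝓜_k`: the left monogenic polynomials that are homogeneous of degree `k`. -/
def Monogenic (m k : ℕ) : Set (Vec m → Cl m) :=
  {p | p ∈ homogPoly m k ∧ ∀ u, diracU p u = 0}

/-- `Z` is the reproducing kernel of `𝓜_k`: `Z(·, v) ∈ 𝓜_k`, and
`∫_{S^{m-1}} conj(Z(u, v)) f(u) dS(u) = f(v)` for all `f ∈ 𝓜_k` and `v ∈ ℝᵐ`. -/
def IsReproducingKernel (m k : ℕ) (Z : Vec m → Vec m → Cl m) : Prop :=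
  (∀ v, (fun u => Z u v) ∈ Monogenic m k) ∧
  ∀ f ∈ Monogenic m k, ∀ v,
    ∫ u : Metric.sphere (0 : Vec m) 1, star (Z u v) * f u ∂(volume : Measure (Vec m)).toSphere
      = f v

/-! ### The third order operator

The operators below act on `F : X → ℝᵐ → Cl_m(ℂ)`, `(t, u) ↦ F t u`, where the first argument is a
point `x` if `F` is a function of `(x, u)`, or a test function if `F` is a distribution in `x` that
depends on the parameter `u`. The argument `d` is the family of partial derivatives `∂_{xᵢ}`. -/

/-- Functions (or distributions) in `x`, with values in the functions of `u`. -/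
abbrev Field (m : ℕ) (X : Type*) : Type _ := X → Vec m → Cl m

variable {m : ℕ} {X : Type*}

/-- The partial derivative `∂_{uᵢ}`. -/
def partialU (i : Fin m) (F : Field m X) : Field m X :=
  fun t u => fderiv ℝ (F t) u (stdVec i)

/-- Left Clifford multiplication by `u`. -/
def mulU (F : Field m X) : Field m X := fun t u => vec u * F t u

/-- Multiplication by `‖u‖²`. -/
def normSqU (F : Field m X) : Field m X := fun t u => (‖u‖ ^ 2) • F t u

/-- The Dirac operator `D_x = ∑ᵢ eᵢ ∂_{xᵢ}`. -/
def Dx (d : Fin m → Field m X → Field m X) (F : Field m X) : Field m X :=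
  fun t u => ∑ i, vec (stdVec i) * d i F t u

/-- The operator `⟨u, D_x⟩ = ∑ᵢ uᵢ ∂_{xᵢ}`. -/
def innerUDx (d : Fin m → Field m X → Field m X) (F : Field m X) : Field m X :=
  fun t u => ∑ i, u i • d i F t u

/-- The operator `⟨D_u, D_x⟩ = ∑ᵢ ∂_{uᵢ} ∂_{xᵢ}`. -/
def innerDuDx (d : Fin m → Field m X → Field m X) (F : Field m X) : Field m X :=
  fun t u => ∑ i, partialU i (d i F) t u

/-- The third order higher spin operator `𝓓₃` on `𝓜_k`-valued functions (or distributions). -/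
def D3 (k : ℕ) (d : Fin m → Field m X → Field m X) (F : Field m X) : Field m X :=
  Dx d (Dx d (Dx d F))
  + (4 / (m + 2 * k) : ℝ) • innerUDx d (innerDuDx d (Dx d F))
  - (4 / ((m + 2 * k) * (m + 2 * k - 2)) : ℝ) • normSqU (innerDuDx d (innerDuDx d (Dx d F)))
  - (2 / (m + 2 * k) : ℝ) • mulU (innerDuDx d (Dx d (Dx d F)))
  - (8 / ((m + 2 * k) * (m + 2 * k - 2)) : ℝ) •
      mulU (innerUDx d (innerDuDx d (innerDuDx d F)))
  - (8 / ((m + 2 * k) * (m + 2 * k - 2) * (m + 2 * k - 4)) : ℝ) •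
      mulU (mulU (mulU (innerDuDx d (innerDuDx d (innerDuDx d F)))))

/-! ### Fundamental solutions -/

/-- Real-valued smooth compactly supported test functions on `ℝᵐ`. -/
abbrev Test (m : ℕ) : Type := 𝓓((⊤ : TopologicalSpace.Opens (Vec m)), ℝ)

/-- The regular distribution `φ ↦ ∫ φ(x) G(x, u) dx`, depending on the parameter `u`. -/
def toDistribution (G : Vec m → Vec m → Cl m) : Field m (Test m) :=
  fun φ u => ∫ x, φ x • G x u

/-- The distributional derivative `(∂_{xᵢ} T)(φ) = -T(∂_{xᵢ} φ)`. -/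
def distDeriv (i : Fin m) (T : Field m (Test m)) : Field m (Test m) :=
  fun φ u => -T (∂_{stdVec i} φ) u

/-- `G(x, u, v)` is a fundamental solution of `𝓓₃`: it is locally integrable in `x`, belongs to
`𝓜_k` in `u`, and `𝓓₃ G(x, u, v) = δ(x) Z(u, v)` in the sense of distributions in `x`, where `Z`
is the reproducing kernel of `𝓜_k`. -/
def IsFundamentalSolution (k : ℕ) (Z : Vec m → Vec m → Cl m)
    (G : Vec m → Vec m → Vec m → Cl m) : Prop :=
  ∀ v, (∀ u, LocallyIntegrable (fun x => G x u v)) ∧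
    (∀ x, x ≠ 0 → (fun u => G x u v) ∈ Monogenic m k) ∧
    ∀ (φ : Test m) (u : Vec m),
      D3 k distDeriv (toDistribution fun x w => G x w v) φ u = φ 0 • Z u v

/-- The vector `xux / ‖x‖²` of `ℝᵐ` (see `vec_conj`), that is, `u` reflected in the hyperplane
orthogonal to `x`. -/
def conj (x u : Vec m) : Vec m := u - (2 * inner ℝ x u / ‖x‖ ^ 2) • x

lemma vec_mul_add_mul (x u : Vec m) :
    vec x * vec u + vec u * vec x = algebraMap ℂ (Cl m) (-2 * inner ℝ x u : ℝ) := by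
  have h := vec_mul_self (x + u)
  have e : ((-‖x + u‖ ^ 2 : ℝ) : ℂ) =
      ((-‖x‖ ^ 2 : ℝ) : ℂ) + ((-2 * inner ℝ x u : ℝ) : ℂ) + ((-‖u‖ ^ 2 : ℝ) : ℂ) := by
    rw [norm_add_sq_real]; push_cast; ring
  rw [e, map_add, map_add, ← vec_mul_self, ← vec_mul_self, vec_add, add_mul, mul_add,
    mul_add] at h
  have h2 := sub_eq_zero.mpr h
  rw [← sub_eq_zero, ← h2]
  abel

lemma vec_conj {x : Vec m} (hx : x ≠ 0) (u : Vec m) :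
    vec (conj x u) = ((‖x‖ ^ 2 : ℝ) : ℂ)⁻¹ • (vec x * vec u * vec x) := by
  have hn : ((‖x‖ ^ 2 : ℝ) : ℂ) ≠ 0 := by
    exact_mod_cast pow_ne_zero 2 (norm_ne_zero_iff.mpr hx)
  have h : vec u * vec x = algebraMap ℂ (Cl m) (-2 * inner ℝ x u : ℝ) - vec x * vec u := by
    rw [← vec_mul_add_mul]; abel
  rw [mul_assoc, h, mul_sub, ← mul_assoc, vec_mul_self, ← Algebra.commutes,
    ← Algebra.smul_def, ← Algebra.smul_def, smul_sub, smul_smul, smul_smul, conj, sub_eq_add_neg,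
    ← neg_smul, vec_add, vec_smul]
  have e1 : (((‖x‖ ^ 2 : ℝ) : ℂ)⁻¹ * ((-‖x‖ ^ 2 : ℝ) : ℂ)) = -1 := by
    rw [Complex.ofReal_neg, mul_neg, inv_mul_cancel₀ hn]
  have e2 : ((-(2 * inner ℝ x u / ‖x‖ ^ 2) : ℝ) : ℂ) =
      ((‖x‖ ^ 2 : ℝ) : ℂ)⁻¹ * ((-2 * inner ℝ x u : ℝ) : ℂ) := by
    rw [← Complex.ofReal_inv, ← Complex.ofReal_mul]; congr 1; ring
  rw [e1, e2, neg_one_smul, sub_neg_eq_add, add_comm]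

end HigherSpin

end

/-! Fix `v` and let `f` be a real multiple of `Z_k(·, v)`, a monogenic polynomial of degree `k`. The
candidate is `xA` with `A = ‖x‖^{2-m} f(xux/‖x‖²)`. Its derivatives involve only three fields `A`,
`B`, `C` (`fieldA`, `fieldB`, `fieldC`), homogeneous in `x` of degrees `2-m`, `1-m`, `-m`. Away from
the origin `D_x(xA) = -2A + u xB`, `D_x(xB) = -2B + u xC`, `⟨D_u, D_x⟩A = (m+2k-2)/2 · B` and `Δ_x A
= 2⟨u, D_x⟩B - ‖u‖²C`. The first three identities also hold between distributions, since the fields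
differentiated there have degree above `1-m` (`HomogField.distDeriv_toDistribution`).

The key simplification is to compute modulo left multiples of `u`. Every term of `𝓓₃` but the first
two starts with `u` or `‖u‖² = -u²`, and the first two terms give `𝓓₃(xA) ≡ 2Δ_x A - 4⟨u, D_x⟩B`
(`OperatorRelations.thirdOrder_apply`). This is the divergence of a field of the critical degree
`1-m` (`fluxField`). Away from the origin that divergence is `-2‖u‖²C`, again a multiple of `u`, so
only a point mass at the origin survives (`sum_distDeriv_fluxField`). Its weight is a radial average
of `2(2-m)A - 4⟨x, u⟩B`. Two relations modulo `u`, one from Euler's formula and one from integration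
by parts, show that it is congruent to `diracConst m k • f` (`integral_fieldA_fieldB`). The constant
is nonzero exactly because `m = 4` forces `k = 0`.

The congruence becomes an equality because both sides are monogenic in `u`: `𝓓₃` preserves the
kernel of `D_u` (`OperatorRelations.dirac_thirdOrder`), and a monogenic polynomial divisible by `u`
is zero (`eq_zero_of_mem_vecMulPolys`).

The kernel `Z_k` comes from the Riesz representation in the finite-dimensional space `𝓜_k`. The
inner product integrates over the sphere a positive definite form on the Clifford algebra for which
left multiplication by `a` has adjoint left multiplication by `ā` (`exists_positiveForm_star`). -/

noncomputable section

namespace HigherSpin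

/-! ### The operator algebra generated by `e`, `u`, `∂_u`, `∂_x` -/

section OperatorAlgebra

open Module (End)

variable {V : Type*} [AddCommGroup V] [Module ℝ V] {m : ℕ}

/-- The relations between left multiplication by `eᵢ`, multiplication by `uᵢ`, and the
derivations `∂_{uᵢ}` and `∂_{xᵢ}`. -/
structure OperatorRelations (e y p d : Fin m → End ℝ V) : Prop where
  e_sq : ∀ i, e i * e i = -1
  e_anti : ∀ i j, i ≠ j → e i * e j = -(e j * e i)
  p_y : ∀ i j, p i * y j = y j * p i + if i = j then 1 else 0
  y_y : ∀ i j, y i * y j = y j * y i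
  p_p : ∀ i j, p i * p j = p j * p i
  d_d : ∀ i j, d i * d j = d j * d i
  y_e : ∀ i j, y i * e j = e j * y i
  p_e : ∀ i j, p i * e j = e j * p i
  d_e : ∀ i j, d i * e j = e j * d i
  d_y : ∀ i j, d i * y j = y j * d i
  d_p : ∀ i j, d i * p j = p j * d i

/-- The contraction `∑ᵢ aᵢ bᵢ` of two families of operators. -/
def contract (a b : Fin m → End ℝ V) : End ℝ V := ∑ i, a i * b i

lemma contract_mul_contract (a b a' b' : Fin m → End ℝ V) :
    contract a b * contract a' b' = ∑ i, ∑ j, a i * b i * (a' j * b' j) := by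
  simp only [contract, Finset.sum_mul_sum]

/-- Moving one Clifford contraction past another. -/
lemma clifford_contract_mul {e : Fin m → End ℝ V} (h1 : ∀ i, e i * e i = -1)
    (h2 : ∀ i j, i ≠ j → e i * e j = -(e j * e i)) {a b : Fin m → End ℝ V}
    (ha : ∀ i j, a i * e j = e j * a i) (hb : ∀ i j, b i * e j = e j * b i)
    {c : End ℝ V} (hab : ∀ i j, a i * b j = b j * a i + if i = j then c else 0) :
    contract e a * contract e b =
      -(contract e b * contract e a) - (2 : ℝ) • contract b a - (m : ℝ) • c := by
  have h3 : ∀ i j, e i * a i * (e j * b j) = -(e j * b j * (e i * a i))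
      - (if i = j then (2 : ℝ) • (b i * a i) else 0) - if i = j then c else 0 := by
    intro i j
    have h4 : e i * a i * (e j * b j) = e i * e j * (a i * b j) := by
      rw [mul_assoc, ← mul_assoc (a i), ha]; simp only [mul_assoc]
    have h5 : e j * b j * (e i * a i) = e j * e i * (b j * a i) := by
      rw [mul_assoc, ← mul_assoc (b j), hb]; simp only [mul_assoc]
    rw [h4, h5, hab]
    by_cases hij : i = j
    · subst hij
      simp only [if_true, h1, neg_mul, one_mul]
      module
    · simp only [hij, if_false, add_zero, sub_zero]
      rw [h2 i j hij, neg_mul]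
  rw [contract_mul_contract, contract_mul_contract, Finset.sum_comm (s := Finset.univ)]
  rw [Finset.sum_comm]
  simp only [h3, Finset.sum_sub_distrib, Finset.sum_neg_distrib, Finset.sum_ite_eq,
    Finset.mem_univ, if_true, contract, Finset.smul_sum, Finset.sum_const, Finset.card_univ,
    Fintype.card_fin, Nat.cast_smul_eq_nsmul]
  rw [Finset.sum_comm]

/-- The case of equal commuting families in `clifford_contract_mul`; the resulting identity is twice
the desired one, and the factor 2 is cancelled over `ℝ`. -/
lemma clifford_contract_sq {e : Fin m → End ℝ V} (h1 : ∀ i, e i * e i = -1)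
    (h2 : ∀ i j, i ≠ j → e i * e j = -(e j * e i)) {a : Fin m → End ℝ V}
    (ha : ∀ i j, a i * e j = e j * a i) (haa : ∀ i j, a i * a j = a j * a i) :
    contract e a * contract e a = -contract a a := by
  have h3 := clifford_contract_mul h1 h2 ha ha (c := 0) (fun i j => by simp [haa i j])
  refine smul_right_injective _ (two_ne_zero (α := ℝ)) ?_
  beta_reduce
  nth_rewrite 1 [two_smul]
  nth_rewrite 1 [h3]
  simp only [smul_zero, sub_zero, smul_neg]
  abel

lemma contract_comm {a b : Fin m → End ℝ V} (h : ∀ i j, a i * b j = b j * a i) :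
    contract a b = contract b a :=
  Finset.sum_congr rfl fun i _ => h i i

/-- Moving one contraction past another when a single pair of factors fails to commute. -/
lemma contract_mul_contract_of_comm {a b a' b' : Fin m → End ℝ V}
    (h1 : ∀ i j, a i * a' j = a' j * a i) (h2 : ∀ i j, a i * b' j = b' j * a i)
    (h3 : ∀ i j, b i * b' j = b' j * b i) {c : End ℝ V}
    (h4 : ∀ i j, b i * a' j = a' j * b i + if i = j then c else 0) :
    contract a b * contract a' b' = contract a' b' * contract a b + ∑ i, a i * c * b' i := by
  have h5 : ∀ i j, a i * b i * (a' j * b' j) =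
      a' j * b' j * (a i * b i) + if i = j then a i * c * b' i else 0 := by
    intro i j
    have h6 : a i * b i * (a' j * b' j) = a i * (b i * a' j) * b' j := by
      simp only [mul_assoc]
    have h7 : a i * a' j * b i * b' j = a' j * b' j * (a i * b i) := by
      rw [h1, mul_assoc, h3, mul_assoc, ← mul_assoc (a i), h2]; simp only [mul_assoc]
    rw [h6, h4, mul_add, add_mul, ← mul_assoc (a i), h7]
    by_cases hij : i = j
    · subst hij; simp
    · simp [hij]
  rw [contract_mul_contract, contract_mul_contract]
  simp only [h5, Finset.sum_add_distrib, Finset.sum_ite_eq, Finset.mem_univ, if_true]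
  rw [Finset.sum_comm]

namespace OperatorRelations

variable {e y p d : Fin m → End ℝ V} (h : OperatorRelations e y p d)
include h

lemma dirac_mul_vec : contract e p * contract e y =
    -(contract e y * contract e p) - (2 : ℝ) • contract y p - (m : ℝ) • 1 :=
  clifford_contract_mul h.e_sq h.e_anti h.p_e h.y_e h.p_y

lemma dirac_mul_diracX : contract e p * contract e d =
    -(contract e d * contract e p) - (2 : ℝ) • contract p d := by
  rw [contract_comm (a := p) (b := d) fun i j => (h.d_p j i).symm]
  simpa using clifford_contract_mul h.e_sq h.e_anti h.p_e h.d_e (c := 0)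
    (fun i j => by simp [h.d_p])

lemma diracX_sq : contract e d * contract e d = -contract d d :=
  clifford_contract_sq h.e_sq h.e_anti h.d_e h.d_d

lemma vec_sq : contract e y * contract e y = -contract y y :=
  clifford_contract_sq h.e_sq h.e_anti h.y_e h.y_y

lemma dirac_mul_innerUDx : contract e p * contract y d =
    contract y d * contract e p + contract e d := by
  simpa [contract] using contract_mul_contract_of_comm (a := e) (b := p) (a' := y) (b' := d)
    (c := 1) (fun i j => (h.y_e j i).symm) (fun i j => (h.d_e j i).symm)
    (fun i j => (h.d_p j i).symm) h.p_y

lemma dirac_mul_innerDuDx : contract e p * contract p d = contract p d * contract e p := by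
  simpa [contract] using contract_mul_contract_of_comm (a := e) (b := p) (a' := p) (b' := d)
    (c := 0) (fun i j => (h.p_e j i).symm) (fun i j => (h.d_e j i).symm)
    (fun i j => (h.d_p j i).symm) (fun i j => by simp [h.p_p i j])

lemma innerDuDx_mul_diracX : contract p d * contract e d = contract e d * contract p d := by
  simpa [contract] using contract_mul_contract_of_comm (a := p) (b := d) (a' := e) (b' := d)
    (c := 0) h.p_e (fun i j => (h.d_p j i).symm) h.d_d (fun i j => by simp [h.d_e i j])

lemma innerUDx_mul_vec : contract y d * contract e y = contract e y * contract y d := by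
  simpa [contract] using contract_mul_contract_of_comm (a := y) (b := d) (a' := e) (b' := y)
    (c := 0) h.y_e h.y_y h.d_y (fun i j => by simp [h.d_e i j])

lemma innerDuDx_mul_vec : contract p d * contract e y =
    contract e y * contract p d + contract e d := by
  have h1 : contract d p * contract e y = contract e y * contract d p + contract e d := by
    rw [contract_comm (a := e) (b := y) fun i j => (h.y_e j i).symm,
      contract_comm (a := e) (b := d) fun i j => (h.d_e j i).symm]
    simpa [contract] using contract_mul_contract_of_comm (a := d) (b := p) (a' := y) (b' := e)
      (c := 1) h.d_y h.d_e h.p_e h.p_y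
  rwa [contract_comm (a := d) (b := p) h.d_p] at h1

lemma euler_mul_innerDuDx : contract y p * contract p d =
    contract p d * contract y p - contract p d := by
  have h1 := contract_mul_contract_of_comm (a := d) (b := p) (a' := y) (b' := p)
      (c := 1) h.d_y h.d_p h.p_p h.p_y
  rw [contract_comm (a := d) (b := p) h.d_p] at h1
  rw [h1, eq_sub_iff_add_eq]
  simp [contract, h.d_p]

lemma euler_mul_diracX : contract y p * contract e d = contract e d * contract y p := by
  simpa [contract] using contract_mul_contract_of_comm (a := y) (b := p) (a' := e) (b' := d)
    (c := 0) h.y_e (fun i j => (h.d_y j i).symm) (fun i j => (h.d_p j i).symm)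
    (fun i j => by simp [h.p_e i j])

lemma euler_mul_innerUDx : contract y p * contract y d =
    contract y d * contract y p + contract y d := by
  simpa [contract] using contract_mul_contract_of_comm (a := y) (b := p) (a' := y) (b' := d)
    (c := 1) h.y_y (fun i j => (h.d_y j i).symm) (fun i j => (h.d_p j i).symm) h.p_y

lemma laplaceX_comm_innerDuDx : contract d d * contract p d = contract p d * contract d d := by
  rw [← neg_inj, ← neg_mul, ← mul_neg, ← h.diracX_sq, mul_assoc, ← h.innerDuDx_mul_diracX,
    ← mul_assoc, ← h.innerDuDx_mul_diracX, mul_assoc]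

lemma laplaceX_comm_vec : contract d d * contract e y = contract e y * contract d d := by
  simpa [contract] using contract_mul_contract_of_comm (a := d) (b := d) (a' := e) (b' := y)
    (c := 0) h.d_e h.d_y h.d_y (fun i j => by simp [h.d_e i j])

end OperatorRelations

/-! ### Invariance of monogenicity under the third order operator -/

/-- The operator `𝓓₃` in terms of left multiplication by `eᵢ`, multiplication by `uᵢ`, `∂_{uᵢ}` and
`∂_{xᵢ}`. -/
def thirdOrder (k : ℕ) (e y p d : Fin m → End ℝ V) : End ℝ V :=
  contract e d * (contract e d * contract e d)
  + (4 / (m + 2 * k) : ℝ) • (contract y d * (contract p d * contract e d))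
  - (4 / ((m + 2 * k) * (m + 2 * k - 2)) : ℝ) •
      (contract y y * (contract p d * (contract p d * contract e d)))
  - (2 / (m + 2 * k) : ℝ) • (contract e y * (contract p d * (contract e d * contract e d)))
  - (8 / ((m + 2 * k) * (m + 2 * k - 2)) : ℝ) •
      (contract e y * (contract y d * (contract p d * contract p d)))
  - (8 / ((m + 2 * k) * (m + 2 * k - 2) * (m + 2 * k - 4)) : ℝ) •
      (contract e y * (contract e y * (contract e y *
        (contract p d * (contract p d * contract p d)))))

/-- `𝓓₃` preserves the kernel of the Dirac operator `D_u`. -/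
theorem OperatorRelations.dirac_thirdOrder {e y p d : Fin m → End ℝ V}
    (h : OperatorRelations e y p d) {k : ℕ} (hm : 3 ≤ m) {F : V}
    (h4 : m + 2 * k = 4 → contract p d F = 0)
    (hF : contract e p F = 0) (hk : contract y p F = (k : ℝ) • F) :
    contract e p (thirdOrder k e y p d F) = 0 := by
  set P := contract e p
  set U := contract e y
  set D := contract e d
  set S := contract y d
  set T := contract p d
  set Eu := contract y p
  set L := contract d d
  have PU : ∀ x, P (U x) = -U (P x) - (2 : ℝ) • Eu x - (m : ℝ) • x := fun x =>
    congrArg (fun A : End ℝ V => A x) h.dirac_mul_vec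
  have PD : ∀ x, P (D x) = -D (P x) - (2 : ℝ) • T x := fun x =>
    congrArg (fun A : End ℝ V => A x) h.dirac_mul_diracX
  have PS : ∀ x, P (S x) = S (P x) + D x := fun x =>
    congrArg (fun A : End ℝ V => A x) h.dirac_mul_innerUDx
  have PT : ∀ x, P (T x) = T (P x) := fun x =>
    congrArg (fun A : End ℝ V => A x) h.dirac_mul_innerDuDx
  have DD : ∀ x, D (D x) = -L x := fun x =>
    congrArg (fun A : End ℝ V => A x) h.diracX_sq
  have TD : ∀ x, T (D x) = D (T x) := fun x =>
    congrArg (fun A : End ℝ V => A x) h.innerDuDx_mul_diracX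
  have UU : ∀ x, contract y y x = -U (U x) := fun x => by
    have := congrArg (fun A : End ℝ V => A x) h.vec_sq
    simp only [Module.End.mul_apply, LinearMap.neg_apply] at this
    rw [this, neg_neg]
  have ET : ∀ x, Eu (T x) = T (Eu x) - T x := fun x =>
    congrArg (fun A : End ℝ V => A x) h.euler_mul_innerDuDx
  have ES : ∀ x, Eu (S x) = S (Eu x) + S x := fun x =>
    congrArg (fun A : End ℝ V => A x) h.euler_mul_innerUDx
  have LT : ∀ x, T (L x) = L (T x) := fun x =>
    congrArg (fun A : End ℝ V => A x) h.laplaceX_comm_innerDuDx.symm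
  have EU : ∀ x, Eu (U x) = U (Eu x) + U x := fun x => by
    have h1 : Eu * U = U * Eu + U := by
      have h2 := contract_mul_contract_of_comm (a := y) (b := p) (a' := y) (b' := e)
        (c := 1) h.y_y h.y_e h.p_e h.p_y
      rw [contract_comm (a := y) (b := e) h.y_e] at h2
      simp only [Eu, U, h2]
      simp [contract, h.y_e]
    exact congrArg (fun A : End ℝ V => A x) h1
  have EL : ∀ x, Eu (L x) = L (Eu x) := fun x => by
    have h2 : Eu * L = L * Eu := by
      rw [← neg_inj, ← mul_neg, ← neg_mul, ← h.diracX_sq,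
        ← mul_assoc, h.euler_mul_diracX, mul_assoc, h.euler_mul_diracX, mul_assoc]
    exact congrArg (fun A : End ℝ V => A x) h2
  have PL : ∀ x, P (L x) = L (P x) := fun x => by
    have h3 := PD (D x)
    rw [PD x, DD, map_neg, map_sub, map_neg, DD, map_smul, TD] at h3
    rw [← neg_inj, h3]
    module
  have hM : (m + 2 * k : ℝ) ≠ 0 := by positivity
  have hm' : (3 : ℝ) ≤ m := by exact_mod_cast hm
  have hk' : (0 : ℝ) ≤ k := Nat.cast_nonneg k
  have hM2 : (m + 2 * k - 2 : ℝ) ≠ 0 := by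
    intro h0; linarith
  simp only [thirdOrder, LinearMap.add_apply, LinearMap.sub_apply, LinearMap.smul_apply,
    Module.End.mul_apply, map_add, map_sub, map_smul]
  change P (D (D (D F))) + _ • P (S (T (D F))) - _ • P (contract y y (T (T (D F))))
    - _ • P (U (T (D (D F)))) - _ • P (U (S (T (T F)))) - _ • P (U (U (U (T (T (T F)))))) = 0
  simp only [UU, PU, PD, PS, PT, DD, TD, PL, ES, ET, EU, EL, hF, hk, map_neg, map_sub, map_add,
    map_smul, map_zero, LT]
  -- Here the denominator `m+2k-4` is zero, so the last coefficient is `0` by convention. Every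
  -- remaining term contains `⟨D_u, D_x⟩F`, which vanishes by `h4`.
  by_cases hM4 : m + 2 * k = 4
  · simp [h4 hM4]
  have hM4' : (m + 2 * k - 4 : ℝ) ≠ 0 := by
    intro h0
    exact hM4 (by exact_mod_cast (by linarith : (m + 2 * k : ℝ) = 4))
  -- `D_u` has been moved to the right until it meets `F`, where it gives zero, and the Euler
  -- operator has become a scalar. What is left is that the coefficient of each remaining word in
  -- the operators cancels.
  match_scalars <;> field_simp <;> ring

end OperatorAlgebra

end HigherSpin

namespace HigherSpin

open scoped ContDiff

variable {m : ℕ}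

/-! ### Linear algebra in `Cl_m(ℂ)` -/

/-- Multiplication of `Cl_m(ℂ)` as a continuous bilinear map. -/
def mulCLM (m : ℕ) : Cl m →L[ℝ] Cl m →L[ℝ] Cl m :=
  LinearMap.toContinuousLinearMap
    (LinearMap.toContinuousLinearMap.toLinearMap ∘ₗ LinearMap.mul ℝ (Cl m))

@[simp] lemma mulCLM_apply (a b : Cl m) : mulCLM m a b = a * b := rfl

lemma vec_real_smul (r : ℝ) (x : Vec m) : vec (r • x) = r • vec x := by
  rw [vec_smul]; exact Complex.coe_smul r (vec x)

/-- The embedding `ℝᵐ ⊆ Cl_m(ℂ)` as a continuous linear map. -/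
def vecCLM (m : ℕ) : Vec m →L[ℝ] Cl m :=
  LinearMap.toContinuousLinearMap
    { toFun := vec, map_add' := vec_add, map_smul' := vec_real_smul }

@[simp] lemma vecCLM_apply (x : Vec m) : vecCLM m x = vec x := rfl

lemma sum_coord_smul_stdVec (x : Vec m) : ∑ i, x i • stdVec i = x := by
  simpa [stdVec] using (EuclideanSpace.basisFun (Fin m) ℝ).sum_repr x

lemma inner_stdVec (x : Vec m) (i : Fin m) : inner ℝ x (stdVec i) = x i := by
  simp [stdVec, EuclideanSpace.inner_single_right]

lemma stdVec_inner (x : Vec m) (i : Fin m) : inner ℝ (stdVec i) x = x i := by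
  rw [real_inner_comm, inner_stdVec]

lemma stdVec_apply (i j : Fin m) : (stdVec i : Vec m) j = if i = j then 1 else 0 := by
  simp [stdVec, eq_comm]

lemma vec_eq_sum (x : Vec m) : vec x = ∑ i, x i • vec (stdVec i) := by
  conv_lhs => rw [← sum_coord_smul_stdVec x]
  rw [← vecCLM_apply, map_sum]
  simp

lemma real_smul_eq (r : ℝ) (a : Cl m) : r • a = algebraMap ℂ (Cl m) r * a := by
  rw [← Algebra.smul_def]; exact (Complex.coe_smul r a).symm

lemma vec_mul_self_mul (x : Vec m) (a : Cl m) : vec x * (vec x * a) = -(‖x‖ ^ 2) • a := by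
  rw [← mul_assoc, vec_mul_self, ← real_smul_eq]

lemma vec_mul_vec_mul (x y : Vec m) (a : Cl m) :
    vec x * (vec y * a) = -(vec y * (vec x * a)) - (2 * inner ℝ x y) • a := by
  have h := congrArg (· * a) (vec_mul_add_mul x y)
  simp only [add_mul, mul_assoc, ← real_smul_eq] at h
  rw [eq_sub_iff_add_eq, ← sub_eq_zero] at *
  rw [← h]
  module

lemma norm_stdVec (i : Fin m) : ‖(stdVec i : Vec m)‖ = 1 := by simp [stdVec]

lemma stdVec_mul_stdVec (i : Fin m) (a : Cl m) :
    vec (stdVec i) * (vec (stdVec i) * a) = -a := by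
  rw [vec_mul_self_mul, norm_stdVec]; simp

/-! ### Homogeneous polynomials -/

/-- Homogeneous polynomials of integral degree; there are none but `0` in negative degrees. -/
def polys (m : ℕ) : ℤ → Submodule ℂ (Vec m → Cl m)
  | .ofNat n => homogPoly m n
  | .negSucc _ => ⊥

@[simp] lemma polys_natCast (n : ℕ) : polys m n = homogPoly m n := rfl

lemma const_mem_homogPoly (a : Cl m) : (fun _ => a) ∈ homogPoly m 0 :=
  Submodule.subset_span ⟨0, a, by simp, by simp⟩

lemma zero_fun_mem_homogPoly (n : ℕ) : (fun _ => 0 : Vec m → Cl m) ∈ homogPoly m n :=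
  Submodule.zero_mem _

lemma zero_fun_mem_polys (n : ℤ) : (fun _ => 0 : Vec m → Cl m) ∈ polys m n :=
  Submodule.zero_mem _

lemma coord_smul_mem_homogPoly {n : ℕ} {p : Vec m → Cl m} (hp : p ∈ homogPoly m n) (i : Fin m) :
    (fun u => u i • p u) ∈ homogPoly m (n + 1) := by
  induction hp using Submodule.span_induction with
  | mem p hp =>
    obtain ⟨α, a, hα, rfl⟩ := hp
    refine Submodule.subset_span ⟨α + Pi.single i 1, a, ?_, ?_⟩
    · simp [Finset.sum_add_distrib, hα]
    · funext u
      have : ∏ j, u j ^ (Pi.single i 1 : Fin m → ℕ) j = u i := by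
        rw [Finset.prod_eq_single i] <;> simp +contextual
      simp only [Pi.add_apply, pow_add, Finset.prod_mul_distrib, this]
      rw [smul_smul, mul_comm]
  | zero => simpa using zero_fun_mem_homogPoly _
  | add p q _ _ hp hq =>
    convert Submodule.add_mem _ hp hq using 1
    funext u; simp
  | smul c p _ hp =>
    convert Submodule.smul_mem _ c hp using 1
    funext u; simp only [Pi.smul_apply]; rw [smul_comm]

lemma homogPoly_induction {P : ∀ n p, p ∈ homogPoly m n → Prop}
    (const : ∀ a, P 0 (fun _ => a) (const_mem_homogPoly a))
    (mul : ∀ n i q hq, P n q hq → P (n + 1) (fun u => u i • q u) (coord_smul_mem_homogPoly hq i))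
    (zero : ∀ n, P n 0 (Submodule.zero_mem _))
    (add : ∀ n p q hp hq, P n p hp → P n q hq → P n (p + q) (Submodule.add_mem _ hp hq))
    (smul : ∀ n (c : ℂ) p hp, P n p hp → P n (c • p) (Submodule.smul_mem _ c hp))
    {n : ℕ} {p : Vec m → Cl m} (hp : p ∈ homogPoly m n) : P n p hp := by
  have key : ∀ n (α : Fin m → ℕ) (a : Cl m) (hα : ∑ i, α i = n),
      P n (fun u => (∏ i, u i ^ α i) • a) (Submodule.subset_span ⟨α, a, hα, rfl⟩) := by
    intro n
    induction n with
    | zero =>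
      intro α a hα
      obtain rfl : α = 0 := by
        funext i
        simpa using (Finset.sum_eq_zero_iff.1 hα) i
      convert const a using 1
      simp
    | succ n ih =>
      intro α a hα
      obtain ⟨i, hi⟩ : ∃ i, α i ≠ 0 := by
        by_contra! h0
        simp [h0] at hα
      have h1 : α = (α - Pi.single i 1) + Pi.single i 1 := by
        funext j
        by_cases hj : j = i
        · subst hj; simp; omega
        · simp [hj]
      have h2 : ∑ j, (α - Pi.single i 1 : Fin m → ℕ) j = n := by
        rw [h1] at hα
        simp only [Pi.add_apply, Finset.sum_add_distrib] at hα
        simpa using hα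
      have h3 : (fun u : Vec m => (∏ i, u i ^ α i) • a) =
          fun u => u i • (∏ j, u j ^ (α - Pi.single i 1 : Fin m → ℕ) j) • a := by
        funext u
        have h3 : ∏ j, u j ^ (Pi.single i 1 : Fin m → ℕ) j = u i := by
          rw [Finset.prod_eq_single i] <;> simp +contextual
        conv_lhs => rw [h1]
        simp only [Pi.add_apply, pow_add, Finset.prod_mul_distrib, h3]
        rw [smul_smul, mul_comm]
      -- The motive depends on the membership proof, so equality of the functions is transported by
      -- substitution.
      have h4 : ∀ q q' (hq : q ∈ homogPoly m (n + 1)) (hq' : q' ∈ homogPoly m (n + 1)),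
          q = q' → P _ q' hq' → P _ q hq := by
        rintro q _ _ _ rfl h
        exact h
      exact h4 _ _ _ _ h3
        (mul n i _ (Submodule.subset_span ⟨α - Pi.single i 1, a, h2, rfl⟩) (ih _ a h2))
  induction hp using Submodule.span_induction with
  | mem p hp => obtain ⟨α, a, hα, rfl⟩ := hp; exact key n α a hα
  | zero => exact zero n
  | add p q h1 h2 hp hq => exact add n p q h1 h2 hp hq
  | smul c p h1 hp => exact smul n c p h1 hp

lemma coord_smul_mem {n : ℤ} {p : Vec m → Cl m} (hp : p ∈ polys m n) (i : Fin m) :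
    (fun u => u i • p u) ∈ polys m (n + 1) := by
  cases n with
  | ofNat n => exact coord_smul_mem_homogPoly hp i
  | negSucc n =>
    obtain rfl : p = 0 := by simpa [polys] using hp
    simpa using zero_fun_mem_polys _

lemma const_mem_polys (a : Cl m) : (fun _ => a) ∈ polys m 0 := const_mem_homogPoly a

lemma polys_induction {P : ∀ n p, p ∈ polys m n → Prop}
    (const : ∀ a, P 0 (fun _ => a) (const_mem_polys a))
    (mul : ∀ n i q hq, P n q hq → P (n + 1) (fun u => u i • q u) (coord_smul_mem hq i))
    (zero : ∀ n, P n 0 (Submodule.zero_mem _))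
    (add : ∀ n p q hp hq, P n p hp → P n q hq → P n (p + q) (Submodule.add_mem _ hp hq))
    (smul : ∀ n (c : ℂ) p hp, P n p hp → P n (c • p) (Submodule.smul_mem _ c hp))
    {n : ℤ} {p : Vec m → Cl m} (hp : p ∈ polys m n) : P n p hp := by
  cases n with
  | ofNat n =>
    exact homogPoly_induction (P := fun n p hp => P n p hp) const (fun n => mul n)
      (fun n => zero n) (fun n => add n) (fun n => smul n) hp
  | negSucc n =>
    obtain rfl : p = 0 := by simpa [polys] using hp
    exact zero _

lemma polys_smooth {n : ℤ} {p : Vec m → Cl m} (hp : p ∈ polys m n) : ContDiff ℝ ∞ p := by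
  induction hp using polys_induction with
  | const a => exact contDiff_const
  | mul n i q _ hq =>
    have h1 : ContDiff ℝ ∞ fun u : Vec m => u i := by fun_prop
    exact h1.smul hq
  | zero n => exact contDiff_const
  | add n p q _ _ hp hq => exact hp.add hq
  | smul n c p _ hp => exact hp.const_smul c

lemma polys_differentiable {n : ℤ} {p : Vec m → Cl m} (hp : p ∈ polys m n) :
    Differentiable ℝ p := (polys_smooth hp).differentiable (by simp)

lemma real_smul_mem {n : ℤ} {p : Vec m → Cl m} (r : ℝ) (hp : p ∈ polys m n) :
    r • p ∈ polys m n := by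
  convert (polys m n).smul_mem (r : ℂ) hp using 1
  funext u
  exact (Complex.coe_smul r (p u)).symm

lemma bilin_mem (f : Cl m →ₗ[ℂ] Cl m) {n : ℤ} {p : Vec m → Cl m} (hp : p ∈ polys m n) :
    (fun u => f (p u)) ∈ polys m n := by
  induction hp using polys_induction with
  | const a => exact const_mem_homogPoly _
  | mul n i q _ hq =>
    convert coord_smul_mem hq i using 1
    funext u
    exact (f.restrictScalars ℝ).map_smul _ _
  | zero n => simpa using zero_fun_mem_polys _
  | add n p q _ _ hp hq => convert Submodule.add_mem _ hp hq using 1; funext u; simp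
  | smul n c p _ hp => convert Submodule.smul_mem _ c hp using 1; funext u; simp

lemma const_mul_mem (a : Cl m) {n : ℤ} {p : Vec m → Cl m} (hp : p ∈ polys m n) :
    (fun u => a * p u) ∈ polys m n := bilin_mem (LinearMap.mulLeft ℂ a) hp

lemma mul_const_mem (a : Cl m) {n : ℤ} {p : Vec m → Cl m} (hp : p ∈ polys m n) :
    (fun u => p u * a) ∈ polys m n := bilin_mem (LinearMap.mulRight ℂ a) hp

lemma sum_mem_polys {ι : Type*} {n : ℤ} {s : Finset ι} {p : ι → Vec m → Cl m}
    (hp : ∀ i ∈ s, p i ∈ polys m n) : (fun u => ∑ i ∈ s, p i u) ∈ polys m n := by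
  convert Submodule.sum_mem _ hp using 1
  funext u; simp

lemma add_mem_polys {n : ℤ} {p q : Vec m → Cl m} (hp : p ∈ polys m n) (hq : q ∈ polys m n) :
    (fun u => p u + q u) ∈ polys m n := Submodule.add_mem _ hp hq

lemma inner_smul_mem (x : Vec m) {n : ℤ} {p : Vec m → Cl m} (hp : p ∈ polys m n) :
    (fun u => (inner ℝ x u : ℝ) • p u) ∈ polys m (n + 1) := by
  have : (fun u => (inner ℝ x u : ℝ) • p u) = fun u => ∑ i, (x i • fun u => u i • p u) u := by
    funext u
    simp [PiLp.inner_apply, Finset.sum_smul, smul_smul, mul_comm]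
  rw [this]
  exact sum_mem_polys fun i _ => real_smul_mem _ (coord_smul_mem hp i)

lemma vec_mul_mem {n : ℤ} {p : Vec m → Cl m} (hp : p ∈ polys m n) :
    (fun u => vec u * p u) ∈ polys m (n + 1) := by
  have : (fun u => vec u * p u) = fun u => ∑ i, u i • (vec (stdVec i) * p u) := by
    funext u
    rw [vec_eq_sum u, Finset.sum_mul]
    simp
  rw [this]
  exact sum_mem_polys fun i _ => coord_smul_mem (const_mul_mem _ hp) i

lemma hasFDerivAt_coord_smul {p : Vec m → Cl m} (hp : Differentiable ℝ p) (i : Fin m)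
    (u v : Vec m) : fderiv ℝ (fun u : Vec m => u i • p u) u v = u i • fderiv ℝ p u v + v i • p u := by
  have h1 : HasFDerivAt (fun u : Vec m => u i) (EuclideanSpace.proj i : Vec m →L[ℝ] ℝ) u :=
    (EuclideanSpace.proj i : Vec m →L[ℝ] ℝ).hasFDerivAt
  have h2 : HasFDerivAt (fun u : Vec m => u i • p u) _ u := h1.smul (hp u).hasFDerivAt
  rw [h2.fderiv]
  simp

lemma fderiv_apply_mem {n : ℤ} {p : Vec m → Cl m} (hp : p ∈ polys m n) (v : Vec m) :
    (fun u => fderiv ℝ p u v) ∈ polys m (n - 1) := by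
  induction hp using polys_induction with
  | const a => simpa using zero_fun_mem_polys _
  | mul n i q hq ih =>
    simp only [hasFDerivAt_coord_smul (polys_differentiable hq)]
    rw [add_sub_cancel_right]
    refine add_mem_polys ?_ (real_smul_mem (v i) hq)
    simpa using coord_smul_mem ih i
  | zero n => simpa using zero_fun_mem_polys _
  | add n p q h1 h2 hp hq =>
    convert Submodule.add_mem _ hp hq using 1
    funext u
    simp [fderiv_add (polys_differentiable h1 u) (polys_differentiable h2 u)]
  | smul n c p h1 hp =>
    convert Submodule.smul_mem _ c hp using 1
    funext u
    simp [fderiv_const_smul (polys_differentiable h1 u) c]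

/-- Euler's formula. -/
lemma fderiv_apply_self {n : ℤ} {p : Vec m → Cl m} (hp : p ∈ polys m n) (u : Vec m) :
    fderiv ℝ p u u = (n : ℝ) • p u := by
  induction hp using polys_induction with
  | const a => simp
  | mul n i q hq ih =>
    rw [hasFDerivAt_coord_smul (polys_differentiable hq), ih]
    push_cast
    module
  | zero n => simp
  | add n p q h1 h2 hp hq =>
    rw [fderiv_add (polys_differentiable h1 u) (polys_differentiable h2 u)]
    simp [hp, hq]
  | smul n c p h1 hp =>
    rw [fderiv_const_smul (polys_differentiable h1 u) c]
    simp only [smul_apply, hp, Pi.smul_apply]; rw [smul_comm]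

lemma comp_linear_mem (L : Vec m →ₗ[ℝ] Vec m) {n : ℤ} {p : Vec m → Cl m} (hp : p ∈ polys m n) :
    (fun u => p (L u)) ∈ polys m n := by
  induction hp using polys_induction with
  | const a => exact const_mem_homogPoly a
  | mul n i q hq ih =>
    have : (fun u => (L u) i • q (L u)) =
        fun u => ∑ j, ((L (stdVec j)) i • fun u : Vec m => u j • q (L u)) u := by
      funext u
      conv_lhs => rw [← sum_coord_smul_stdVec u]
      simp only [map_sum, map_smul, WithLp.ofLp_sum, Finset.sum_apply, Finset.sum_smul]
      simp only [← map_smul, ← map_sum, sum_coord_smul_stdVec]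
      simp [smul_smul, mul_comm]
    rw [this]
    exact sum_mem_polys fun j _ => real_smul_mem _ (coord_smul_mem ih j)
  | zero n => exact Submodule.zero_mem _
  | add n p q _ _ hp hq => exact Submodule.add_mem _ hp hq
  | smul n c p _ hp => exact Submodule.smul_mem _ c hp

lemma polys_smul {n : ℕ} {p : Vec m → Cl m} (hp : p ∈ homogPoly m n) (t : ℝ) (u : Vec m) :
    p (t • u) = t ^ n • p u := by
  induction hp using homogPoly_induction with
  | const a => simp
  | mul n i q hq ih => simp only [ih, PiLp.smul_apply, smul_smul, smul_eq_mul]; ring_nf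
  | zero n => simp
  | add n p q _ _ hp hq => simp [hp, hq]
  | smul n c p _ hp => simp only [Pi.smul_apply, hp]; rw [smul_comm]

/-! ### Interpolation -/

/-- A finite-dimensional space of functions has an interpolation formula. -/
lemma exists_interpolation {α : Type*} (W : Submodule ℝ (α → ℝ)) [FiniteDimensional ℝ W] :
    ∃ (ι : Type) (_ : Fintype ι) (x : ι → α) (L : ι → α → ℝ), (∀ i, L i ∈ W) ∧
      ∀ q ∈ W, ∀ y, q y = ∑ i, L i y * q (x i) := by
  let ev : α → Module.Dual ℝ W := fun x => (LinearMap.proj x) ∘ₗ W.subtype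
  -- A functional on the dual that kills all evaluations is, by reflexivity, an element of `W`
  -- vanishing at every point, hence zero. So the dual has a basis consisting of evaluations; its
  -- nodes are the `x i`, and the dual basis, read in `W`, gives the `L i`.
  have hspan : Submodule.span ℝ (Set.range ev) = ⊤ := by
    by_contra hne
    obtain ⟨f, hf, hle⟩ := Submodule.exists_le_ker_of_lt_top _ (lt_top_iff_ne_top.2 hne)
    obtain ⟨w, rfl⟩ := (Module.evalEquiv ℝ W).surjective f
    apply hf
    have : w = 0 := by
      ext x
      have := hle (Submodule.subset_span ⟨x, rfl⟩)
      simpa [ev] using this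
    simp [this]
  obtain ⟨b, hb, hbs, hli⟩ := exists_linearIndependent ℝ (Set.range ev)
  have hfin : Finite b := hli.finite
  let B : Module.Basis b ℝ (Module.Dual ℝ W) := Module.Basis.mk hli (by
    rw [Subtype.range_coe, hbs, hspan])
  let n := Nat.card b
  let eq : b ≃ Fin n := Finite.equivFin b
  let B' := B.reindex eq
  have hx : ∀ i : Fin n, ∃ x, ev x = B' i := fun i => by
    have := hb (eq.symm i).2
    simpa [B', B] using this
  choose x hx using hx
  have hw : ∀ i : Fin n, ∃ w : W, Module.evalEquiv ℝ W w = B'.coord i :=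
    fun i => (Module.evalEquiv ℝ W).surjective _
  choose w hw using hw
  refine ⟨Fin n, inferInstance, x, fun i => w i, fun i => (w i).2, fun q hq y => ?_⟩
  have h1 := congrArg (fun f : Module.Dual ℝ W => f ⟨q, hq⟩) (B'.sum_repr (ev y))
  simp only [LinearMap.sum_apply, LinearMap.smul_apply, smul_eq_mul] at h1
  have h2 : ∀ i, B'.repr (ev y) i = (w i : α → ℝ) y := fun i => by
    have := congrArg (fun f => f (ev y)) (hw i)
    simp only [Module.Basis.coord_apply] at this
    rw [← this]; simp [ev]
  simp only [h2, ← hx] at h1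
  exact h1.symm

/-- Scalar homogeneous polynomials. -/
def scalarPolys (m n : ℕ) : Submodule ℝ (Vec m → ℝ) :=
  Submodule.span ℝ ((fun (α : Fin m → ℕ) (u : Vec m) => ∏ i, u i ^ α i) '' {α | ∑ i, α i = n})

lemma finite_multiIndex (m n : ℕ) : {α : Fin m → ℕ | ∑ i, α i = n}.Finite :=
  (Set.finite_Iic (fun _ : Fin m => n)).subset fun α hα i => by
    rw [← (show ∑ i, α i = n from hα)]
    exact Finset.single_le_sum (fun _ _ => Nat.zero_le _) (Finset.mem_univ i)

instance (m n : ℕ) : FiniteDimensional ℝ (scalarPolys m n) :=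
  FiniteDimensional.span_of_finite ℝ ((finite_multiIndex m n).image _)

lemma scalarPolys_smul_mem {n : ℕ} {q : Vec m → ℝ} (hq : q ∈ scalarPolys m n) (a : Cl m) :
    (fun u => q u • a) ∈ homogPoly m n := by
  induction hq using Submodule.span_induction with
  | mem q hq =>
    obtain ⟨α, hα, rfl⟩ := hq
    exact Submodule.subset_span ⟨α, a, hα, rfl⟩
  | zero => simpa using zero_fun_mem_homogPoly _
  | add p q _ _ hp hq => convert Submodule.add_mem _ hp hq using 1; funext u; simp [add_smul]
  | smul c p _ hp =>
    have := real_smul_mem c (n := n) hp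
    rw [polys_natCast] at this
    convert this using 1
    funext u; simp [smul_smul]

/-- Interpolation of homogeneous polynomials by finitely many values. -/
lemma polys_interpolation (m : ℕ) (n : ℤ) :
    ∃ (ι : Type) (_ : Fintype ι) (x : ι → Vec m) (L : ι → Vec m → ℝ),
      (∀ i (a : Cl m), (fun u => L i u • a) ∈ polys m n) ∧ (∀ i, ContDiff ℝ ∞ (L i)) ∧
      ∀ p ∈ polys m n, ∀ u, p u = ∑ i, L i u • p (x i) := by
  cases n with
  | ofNat n =>
    obtain ⟨ι, hι, x, L, hL, h⟩ := exists_interpolation (scalarPolys m n)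
    refine ⟨ι, hι, x, L, fun i a => scalarPolys_smul_mem (hL i) a, fun i => ?_, fun p hp u => ?_⟩
    · have hq := hL i
      generalize L i = q at hq
      induction hq using Submodule.span_induction with
      | mem q hq =>
        obtain ⟨α, hα, rfl⟩ := hq
        fun_prop
      | zero => exact contDiff_const
      | add p q _ _ hp hq => exact hp.add hq
      | smul c p _ hp => exact hp.const_smul c
    · induction hp using Submodule.span_induction with
      | mem q hq =>
        obtain ⟨α, a, hα, rfl⟩ := hq
        have := h _ (Submodule.subset_span ⟨α, hα, rfl⟩) u
        simp only [this, Finset.sum_smul, smul_smul]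
      | zero => simp
      | add p q _ _ hp hq => simp [hp, hq, Finset.sum_add_distrib]
      | smul c p _ hp =>
        simp only [Pi.smul_apply, hp, Finset.smul_sum]
        exact Finset.sum_congr rfl fun i _ => smul_comm _ _ _
  | negSucc n =>
    refine ⟨Empty, inferInstance, Empty.elim, Empty.elim, fun i => i.elim, fun i => i.elim, ?_⟩
    intro p hp u
    obtain rfl : p = 0 := by simpa [polys] using hp
    simp

/-- By interpolation a polynomial is determined by its values at finitely many nodes. -/
instance (m : ℕ) (n : ℤ) : FiniteDimensional ℂ (polys m n) := by
  obtain ⟨ι, hι, x, L, -, -, h⟩ := polys_interpolation m n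
  let f : polys m n →ₗ[ℂ] (ι → Cl m) :=
    { toFun := fun p i => (p : Vec m → Cl m) (x i)
      map_add' := fun _ _ => rfl
      map_smul' := fun _ _ => rfl }
  refine FiniteDimensional.of_injective f fun p q hpq => ?_
  ext1
  funext u
  rw [h _ p.2, h _ q.2]
  exact Finset.sum_congr rfl fun i _ => by rw [show (p : Vec m → Cl m) (x i) = q.1 (x i) from
    congrFun hpq i]

end HigherSpin

namespace HigherSpin

open scoped ContDiff Topology
open Filter

variable {m : ℕ}

lemma apply_eq_sum {F : Type*} [NormedAddCommGroup F] [NormedSpace ℝ F] (L : Vec m →L[ℝ] F)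
    (x : Vec m) : L x = ∑ i, x i • L (stdVec i) := by
  conv_lhs => rw [← sum_coord_smul_stdVec x]
  simp only [map_sum, map_smul]

lemma contDiffAt_norm_zpow (e : ℤ) {x : Vec m} (hx : x ≠ 0) :
    ContDiffAt ℝ ∞ (fun x : Vec m => ‖x‖ ^ e) x := by
  have h1 : ContDiffAt ℝ ∞ (fun x : Vec m => ‖x‖) x := contDiffAt_norm ℝ hx
  cases e with
  | ofNat n => simpa using h1.pow n
  | negSucc n =>
    simp only [zpow_negSucc]
    exact (h1.pow (n + 1)).inv (pow_ne_zero _ (norm_ne_zero_iff.2 hx))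

/-! ### Homogeneous functions and their distributional derivatives -/

/-- Functions that are smooth away from the origin and homogeneous of degree `d`. -/
structure HomogSmooth (d : ℤ) (g : Vec m → Cl m) : Prop where
  smooth : ContDiffOn ℝ ∞ g {0}ᶜ
  homog : ∀ t : ℝ, 0 < t → ∀ x : Vec m, x ≠ 0 → g (t • x) = t ^ d • g x

lemma isOpen_ne_zero : IsOpen ({0}ᶜ : Set (Vec m)) := isOpen_compl_singleton

namespace HomogSmooth

variable {d : ℤ} {g : Vec m → Cl m} (hg : HomogSmooth d g)
include hg

lemma contDiffAt {x : Vec m} (hx : x ≠ 0) : ContDiffAt ℝ ∞ g x :=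
  hg.smooth.contDiffAt (isOpen_ne_zero.mem_nhds hx)

lemma differentiableAt {x : Vec m} (hx : x ≠ 0) : DifferentiableAt ℝ g x :=
  (hg.contDiffAt hx).differentiableAt (by simp)

lemma continuousOn : ContinuousOn g {0}ᶜ := hg.smooth.continuousOn

/-- Homogeneity reduces the bound to the unit sphere, which is compact and avoids the origin. -/
lemma exists_bound : ∃ C, 0 ≤ C ∧ ∀ x, x ≠ 0 → ‖g x‖ ≤ C * ‖x‖ ^ d := by
  obtain ⟨C, hC⟩ := (isCompact_sphere (0 : Vec m) 1).exists_bound_of_continuousOn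
    (hg.continuousOn.mono fun x hx => by
      simp only [Set.mem_compl_iff, Set.mem_singleton_iff]
      rintro rfl
      simp at hx)
  refine ⟨max C 0, le_max_right _ _, fun x hx => ?_⟩
  have hx' : 0 < ‖x‖ := norm_pos_iff.2 hx
  have hn : ‖‖x‖⁻¹ • x‖ = 1 := by
    rw [norm_smul, norm_inv, norm_norm, inv_mul_cancel₀ hx'.ne']
  have h1 : g x = ‖x‖ ^ d • g (‖x‖⁻¹ • x) := by
    rw [← hg.homog ‖x‖ hx' _ (by rw [← norm_pos_iff, hn]; norm_num), smul_smul,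
      mul_inv_cancel₀ hx'.ne', one_smul]
  rw [h1, norm_smul, norm_zpow, norm_norm, mul_comm]
  have := hC (‖x‖⁻¹ • x) (by simp [hn])
  gcongr
  exact this.trans (le_max_left _ _)

/-- Euler's formula. -/
lemma fderiv_self {x : Vec m} (hx : x ≠ 0) : fderiv ℝ g x x = (d : ℝ) • g x := by
  have h1 : HasDerivAt (fun t : ℝ => g (t • x)) (fderiv ℝ g x x) 1 := by
    have h2 : HasDerivAt (fun t : ℝ => t • x) x 1 := by
      simpa using (hasDerivAt_id (1 : ℝ)).smul_const x
    have h3 : HasFDerivAt g (fderiv ℝ g x) ((1 : ℝ) • x) := by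
      simpa using (hg.differentiableAt hx).hasFDerivAt
    exact h3.comp_hasDerivAt (1 : ℝ) h2
  have h4 : HasDerivAt (fun t : ℝ => t ^ d • g x) ((d : ℝ) • g x) 1 := by
    have := (hasDerivAt_zpow d (1 : ℝ) (Or.inl one_ne_zero)).smul_const (g x)
    simpa using this
  refine h1.unique (h4.congr_of_eventuallyEq ?_)
  filter_upwards [lt_mem_nhds zero_lt_one] with t ht
  exact hg.homog t ht x hx

/-- Differentiating `g(tx) = t^d g(x)` in `x` produces a factor `t` on the left, which lowers the
degree by one. -/
lemma fderiv_apply (v : Vec m) : HomogSmooth (d - 1) fun x => fderiv ℝ g x v := by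
  refine ⟨?_, fun t ht x hx => ?_⟩
  · exact (hg.smooth.fderiv_of_isOpen isOpen_ne_zero (by simp)).clm_apply contDiffOn_const
  · have h1 : fderiv ℝ (fun y => g (t • y)) x = t • fderiv ℝ g (t • x) := fderiv_comp_smul t
    have h2 : (fun y => g (t • y)) =ᶠ[𝓝 x] fun y => t ^ d • g y := by
      filter_upwards [isOpen_ne_zero.mem_nhds hx] with y hy
      exact hg.homog t ht y hy
    rw [h2.fderiv_eq, fderiv_fun_const_smul (hg.differentiableAt hx)] at h1
    have h3 := congrArg (fun A : Vec m →L[ℝ] Cl m => t⁻¹ • A v) h1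
    simp only [FunLike.coe_smul, Pi.smul_apply, smul_smul,
      inv_mul_cancel₀ ht.ne', one_smul] at h3
    rw [← h3, zpow_sub_one₀ ht.ne', mul_comm]

lemma add {g' : Vec m → Cl m} (hg' : HomogSmooth d g') : HomogSmooth d fun x => g x + g' x :=
  ⟨hg.smooth.add hg'.smooth, fun t ht x hx => by rw [hg.homog t ht x hx, hg'.homog t ht x hx,
    smul_add]⟩

lemma const_smul (r : ℝ) : HomogSmooth d fun x => r • g x :=
  ⟨hg.smooth.const_smul r, fun t ht x hx => by rw [hg.homog t ht x hx, smul_comm]⟩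

lemma const_mul (a : Cl m) : HomogSmooth d fun x => a * g x :=
  ⟨(mulCLM m a).contDiff.comp_contDiffOn hg.smooth,
    fun t ht x hx => by rw [hg.homog t ht x hx, mul_smul_comm]⟩

/-- Multiplication by a scalar function that is homogeneous and smooth away from the origin. -/
lemma smul {e : ℤ} {f : Vec m → ℝ} (hf : ContDiffOn ℝ ∞ f {0}ᶜ)
    (hf' : ∀ t : ℝ, 0 < t → ∀ x : Vec m, x ≠ 0 → f (t • x) = t ^ e * f x) :
    HomogSmooth (e + d) fun x => f x • g x :=
  ⟨hf.smul hg.smooth, fun t ht x hx => by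
    rw [hg.homog t ht x hx, hf' t ht x hx, smul_smul, smul_smul, zpow_add₀ ht.ne']
    ring_nf⟩

lemma norm_zpow_smul (e : ℤ) : HomogSmooth (e + d) fun x => ‖x‖ ^ e • g x := by
  refine hg.smul (fun x hx => ?_) fun t ht x hx => ?_
  · exact (contDiffAt_norm_zpow e hx).contDiffWithinAt
  · rw [norm_smul, mul_zpow, Real.norm_of_nonneg ht.le]

lemma linear_smul (L : Vec m →L[ℝ] ℝ) : HomogSmooth (1 + d) fun x => L x • g x :=
  hg.smul L.contDiff.contDiffOn fun t ht x hx => by simp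

lemma vec_mul : HomogSmooth (1 + d) fun x => vec x * g x := by
  have h1 : (fun x : Vec m => vec x * g x) =
      fun x => ∑ i, (EuclideanSpace.proj i : Vec m →L[ℝ] ℝ) x • (vec (stdVec i) * g x) := by
    funext x
    rw [vec_eq_sum x, Finset.sum_mul]
    simp
  refine ⟨?_, fun t ht x hx => ?_⟩
  · rw [h1]
    exact ContDiffOn.sum fun i _ => ((hg.const_mul _).linear_smul _).smooth
  · rw [hg.homog t ht x hx, vec_real_smul, smul_mul_assoc, mul_smul_comm, smul_smul,
      zpow_one_add₀ ht.ne']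

lemma aestronglyMeasurable [NeZero m] : AEStronglyMeasurable g volume := by
  have : Nontrivial (Vec m) := inferInstance
  have h1 : AEStronglyMeasurable g (volume.restrict {0}ᶜ) :=
    hg.continuousOn.aestronglyMeasurable (measurableSet_singleton _).compl
  rwa [restrict_compl_singleton] at h1

end HomogSmooth

/-- In polar coordinates the radial density is `r^(m-1+d)`, whose exponent is a nonnegative integer.
-/
lemma integrableOn_norm_zpow [NeZero m] {d : ℤ} (hd : -(m : ℤ) < d) (r : ℝ) :
    IntegrableOn (fun x : Vec m => ‖x‖ ^ d) (Metric.ball 0 r) := by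
  have : Nontrivial (Vec m) := inferInstance
  rw [integrableOn_fun_norm_addHaar volume (f := fun y : ℝ => y ^ d)]
  simp only [finrank_euclideanSpace_fin, smul_eq_mul]
  have hm : 1 ≤ m := NeZero.one_le
  obtain ⟨n, hn⟩ : ∃ n : ℕ, (n : ℤ) = (m - 1 : ℤ) + d := ⟨((m - 1 : ℤ) + d).toNat, by
    rw [Int.toNat_of_nonneg]; omega⟩
  have h1 : IntegrableOn (fun y : ℝ => y ^ n) (Set.Ioo 0 r) :=
    ((continuous_pow n).integrableOn_Icc (a := 0) (b := r)).mono_set Set.Ioo_subset_Icc_self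
  refine h1.congr_fun (fun y hy => ?_) measurableSet_Ioo
  change y ^ n = y ^ (m - 1) * y ^ d
  rw [← zpow_natCast y (m - 1), ← zpow_add₀ hy.1.ne', ← zpow_natCast, hn]
  push_cast [hm]
  rfl

lemma HomogSmooth.locallyIntegrable [NeZero m] {d : ℤ} (hd : -(m : ℤ) < d) {g : Vec m → Cl m}
    (hg : HomogSmooth d g) : LocallyIntegrable g := by
  obtain ⟨C, hC, hb⟩ := hg.exists_bound
  rw [locallyIntegrable_iff]
  intro K hK
  obtain ⟨r, hr⟩ := hK.isBounded.subset_ball 0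
  refine IntegrableOn.mono_set ?_ hr
  refine Integrable.mono' ((integrableOn_norm_zpow hd r).const_mul C)
    hg.aestronglyMeasurable.restrict ?_
  have : Nontrivial (Vec m) := inferInstance
  have h0 : ∀ᵐ x : Vec m, x ≠ 0 := by simp [ae_iff]
  exact ae_restrict_of_ae (h0.mono fun x hx => hb x hx)

/-- The divergence of `x g(x)`. -/
lemma HomogSmooth.sum_fderiv_coord_smul {d : ℤ} {g : Vec m → Cl m}
    (hg : HomogSmooth d g) {x : Vec m} (hx : x ≠ 0) :
    ∑ i, fderiv ℝ (fun y : Vec m => (EuclideanSpace.proj i : Vec m →L[ℝ] ℝ) y • g y) x (stdVec i) =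
      (m + d : ℝ) • g x := by
  have h3 : ∀ i, fderiv ℝ (fun y : Vec m => (EuclideanSpace.proj i : Vec m →L[ℝ] ℝ) y • g y) x
      (stdVec i) = x i • fderiv ℝ g x (stdVec i) + g x := by
    intro i
    have h4 : HasFDerivAt
        (fun y : Vec m => (EuclideanSpace.proj i : Vec m →L[ℝ] ℝ) y • g y) _ x :=
      (EuclideanSpace.proj i : Vec m →L[ℝ] ℝ).hasFDerivAt.smul (hg.differentiableAt hx).hasFDerivAt
    rw [h4.fderiv]
    simp [stdVec_apply]
  simp only [h3]
  rw [Finset.sum_add_distrib, ← apply_eq_sum (fderiv ℝ g x) x, hg.fderiv_self hx]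
  simp [add_smul, add_comm, ← Nat.cast_smul_eq_nsmul ℝ]

/-! ### Integration by parts away from the origin -/

/-- Smooth real-valued functions with compact support away from the origin. -/
structure Annular (η : Vec m → ℝ) : Prop where
  smooth : ContDiff ℝ ∞ η
  compact : HasCompactSupport η
  zero : (0 : Vec m) ∉ tsupport η

namespace Annular

variable {η : Vec m → ℝ} (hη : Annular η)
include hη

lemma continuous_smul {E : Type*} [NormedAddCommGroup E] [NormedSpace ℝ E] {g : Vec m → E}
    (hg : ContinuousOn g {0}ᶜ) :
    Continuous fun x => η x • g x := by
  refine continuous_of_tsupport fun x hx => ?_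
  have hx' : x ≠ 0 := by
    rintro rfl
    exact hη.zero (closure_mono (Function.support_smul_subset_left η g) hx)
  exact hη.smooth.continuous.continuousAt.smul (hg.continuousAt (isOpen_ne_zero.mem_nhds hx'))

lemma integrable_smul {E : Type*} [NormedAddCommGroup E] [NormedSpace ℝ E] {g : Vec m → E}
    (hg : ContinuousOn g {0}ᶜ) :
    Integrable fun x => η x • g x :=
  (hη.continuous_smul hg).integrable_of_hasCompactSupport hη.compact.smul_right

lemma fderiv_apply (v : Vec m) : Annular fun x => fderiv ℝ η x v := by
  refine ⟨(hη.smooth.fderiv_right (m := ∞) (by simp)).clm_apply contDiff_const,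
    hη.compact.fderiv_apply ℝ v, fun h => hη.zero (tsupport_fderiv_apply_subset ℝ v h)⟩

lemma mul_left {f : Vec m → ℝ} (hf : ContDiff ℝ ∞ f) : Annular fun x => f x * η x :=
  ⟨hf.mul hη.smooth, hη.compact.mul_left,
    fun h => hη.zero (closure_mono (Function.support_mul_subset_right f η) h)⟩

/-- The weight is supported off the origin, so the singularity of `g` leaves no boundary term. -/
lemma integral_smul_fderiv {d : ℤ} {g : Vec m → Cl m} (hg : HomogSmooth d g) (v : Vec m) :
    ∫ x, η x • fderiv ℝ g x v = -∫ x, fderiv ℝ η x v • g x :=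
  integral_smul_fderiv_eq_neg_fderiv_smul_of_integrable
    ((hη.fderiv_apply v).integrable_smul hg.continuousOn)
    (hη.integrable_smul (hg.fderiv_apply v).continuousOn)
    (hη.integrable_smul hg.continuousOn)
    (fun x _ => hη.smooth.differentiable (by simp) x)
    (fun x hx => hg.differentiableAt fun h => hη.zero (h ▸ hx))

/-- The integral of a function of degree `-m` against a total radial derivative vanishes. -/
lemma integral_radial_smul {g : Vec m → Cl m} (hg : HomogSmooth (-m) g) :
    ∫ x, fderiv ℝ η x x • g x = 0 := by
  let c : Fin m → Vec m →L[ℝ] ℝ := fun i => EuclideanSpace.proj i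
  have hgi : ∀ i, HomogSmooth (1 + -m) fun x => c i x • g x := fun i => hg.linear_smul (c i)
  have h1 : ∀ x, fderiv ℝ η x x • g x = ∑ i, fderiv ℝ η x (stdVec i) • (c i x • g x) := by
    intro x
    rw [apply_eq_sum (fderiv ℝ η x) x, Finset.sum_smul]
    refine Finset.sum_congr rfl fun i _ => ?_
    rw [smul_smul, smul_eq_mul, mul_comm]
    rfl
  -- After integration by parts the divergence of `x g(x)` appears. It equals `(m + d) g` by Euler's
  -- formula, and `d = -m`.
  have h2 : ∀ x, ∑ i, η x • fderiv ℝ (fun x => c i x • g x) x (stdVec i) = 0 := by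
    intro x
    by_cases hx : x = 0
    · have : η x = 0 := by
        by_contra h0
        exact hη.zero (hx ▸ subset_tsupport η h0)
      simp [this]
    rw [← Finset.smul_sum, hg.sum_fderiv_coord_smul hx]
    simp
  simp only [h1]
  rw [integral_finsetSum _ fun i _ =>
    (hη.fderiv_apply (stdVec i)).integrable_smul (hgi i).continuousOn]
  have h6 : ∀ i, ∫ x, fderiv ℝ η x (stdVec i) • (c i x • g x) =
      -∫ x, η x • fderiv ℝ (fun x => c i x • g x) x (stdVec i) := fun i => by
    rw [hη.integral_smul_fderiv (hgi i), neg_neg]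
  simp only [h6]
  rw [Finset.sum_neg_distrib, ← integral_finsetSum _ fun i _ =>
    hη.integrable_smul ((hgi i).fderiv_apply _).continuousOn]
  simp [h2]

end Annular

/-! ### A radial cutoff -/

/-- A smooth radial function vanishing near the origin that is `1` far from it. -/
def cutoff (x : Vec m) : ℝ := Real.smoothTransition (‖x‖ ^ 2 - 1)

/-- The radial weight with `∇ cutoff = cutoffWeight x • x`. -/
def cutoffWeight (x : Vec m) : ℝ := 2 * deriv Real.smoothTransition (‖x‖ ^ 2 - 1)

lemma contDiff_cutoff : ContDiff ℝ ∞ (cutoff : Vec m → ℝ) :=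
  Real.smoothTransition.contDiff.comp ((contDiff_norm_sq ℝ).sub contDiff_const)

lemma fderiv_cutoff (x v : Vec m) : fderiv ℝ cutoff x v = inner ℝ x v * cutoffWeight x := by
  have h1 : HasFDerivAt (fun x : Vec m => ‖x‖ ^ 2 - 1) (2 • innerSL ℝ x) x :=
    ((hasStrictFDerivAt_norm_sq x).hasFDerivAt).sub_const 1
  have h2 : HasDerivAt Real.smoothTransition (deriv Real.smoothTransition (‖x‖ ^ 2 - 1))
      (‖x‖ ^ 2 - 1) :=
    ((Real.smoothTransition.contDiff (n := 1)).differentiable (by simp) _).hasDerivAt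
  have h3 : HasFDerivAt (cutoff : Vec m → ℝ) _ x := h2.comp_hasFDerivAt x h1
  rw [h3.fderiv]
  simp [cutoffWeight]
  ring

lemma cutoff_eq_zero {x : Vec m} (hx : ‖x‖ ≤ 1) : cutoff x = 0 :=
  Real.smoothTransition.zero_of_nonpos (by nlinarith [norm_nonneg x])

lemma cutoff_eq_one {x : Vec m} (hx : 2 ≤ ‖x‖) : cutoff x = 1 :=
  Real.smoothTransition.one_of_one_le (by nlinarith)

lemma cutoffWeight_nonneg (x : Vec m) : 0 ≤ cutoffWeight x :=
  mul_nonneg zero_le_two (Real.smoothTransition.monotone.deriv_nonneg)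

lemma deriv_smoothTransition_eq_zero {t : ℝ} (ht : t < 0 ∨ 1 < t) :
    deriv Real.smoothTransition t = 0 := by
  rcases ht with ht | ht
  · have : Real.smoothTransition =ᶠ[𝓝 t] fun _ => 0 := by
      filter_upwards [gt_mem_nhds ht] with s hs
      exact Real.smoothTransition.zero_of_nonpos hs.le
    rw [this.deriv_eq]; simp
  · have : Real.smoothTransition =ᶠ[𝓝 t] fun _ => 1 := by
      filter_upwards [lt_mem_nhds ht] with s hs
      exact Real.smoothTransition.one_of_one_le hs.le
    rw [this.deriv_eq]; simp

lemma annular_cutoffWeight : Annular (cutoffWeight : Vec m → ℝ) := by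
  have hsupp : tsupport (cutoffWeight : Vec m → ℝ) ⊆ {x | 1 ≤ ‖x‖ ^ 2 ∧ ‖x‖ ^ 2 ≤ 2} := by
    refine closure_minimal (fun x hx => ?_) ?_
    · by_contra h0
      apply hx
      rw [cutoffWeight, deriv_smoothTransition_eq_zero, mul_zero]
      rw [Set.mem_ofPred_eq, not_and_or, not_le, not_le] at h0
      rcases h0 with h0 | h0
      · left; linarith
      · right; linarith
    · have h1 : Continuous fun x : Vec m => ‖x‖ ^ 2 := by fun_prop
      exact (isClosed_le continuous_const h1).inter (isClosed_le h1 continuous_const)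
  refine ⟨?_, ?_, fun h => ?_⟩
  · have h1 : ContDiff ℝ ∞ (deriv Real.smoothTransition) :=
      ((contDiff_infty_iff_deriv (𝕜 := ℝ)).1 Real.smoothTransition.contDiff).2
    exact contDiff_const.mul (h1.comp ((contDiff_norm_sq ℝ).sub contDiff_const))
  · refine HasCompactSupport.of_support_subset_isCompact
      (isCompact_closedBall (0 : Vec m) 2) ((subset_tsupport _).trans (hsupp.trans ?_))
    intro x hx
    simp only [Metric.mem_closedBall, dist_zero_right]
    have := hx.2
    nlinarith [norm_nonneg x]
  · have := (hsupp h).1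
    simp at this
    linarith

/-- If the weight vanished identically, the cutoff would have zero gradient and could not pass from
0 to 1. This makes the average in `avgConst` strictly positive. -/
lemma exists_cutoffWeight_ne_zero [NeZero m] : ∃ x : Vec m, cutoffWeight x ≠ 0 := by
  by_contra! h0
  have hd : Differentiable ℝ (cutoff : Vec m → ℝ) := contDiff_cutoff.differentiable (by simp)
  have h1 : ∀ x : Vec m, fderiv ℝ cutoff x = 0 := fun x => by
    ext v; rw [fderiv_cutoff, h0, mul_zero]; rfl
  have h2 := is_const_of_fderiv_eq_zero hd h1 0 ((2 : ℝ) • stdVec (0 : Fin m))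
  rw [cutoff_eq_zero (by simp), cutoff_eq_one (by simp [norm_smul, norm_stdVec])] at h2
  exact zero_ne_one h2

lemma cutoff_nonneg (x : Vec m) : 0 ≤ cutoff x := Real.smoothTransition.nonneg _

lemma cutoff_le_one (x : Vec m) : cutoff x ≤ 1 := Real.smoothTransition.le_one _

lemma annular_mul_cutoff (φ : Test m) {t : ℝ} (ht : 0 < t) :
    Annular fun x => φ x * cutoff (t • x) := by
  refine ⟨φ.contDiff.mul (contDiff_cutoff.comp (contDiff_const_smul t)),
    φ.hasCompactSupport.mul_right, fun h => ?_⟩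
  have h1 : (fun x : Vec m => φ x * cutoff (t • x)) =ᶠ[𝓝 0] 0 := by
    filter_upwards [Metric.ball_mem_nhds (0 : Vec m) (inv_pos.2 ht)] with x hx
    rw [Metric.mem_ball, dist_zero_right] at hx
    have h2 : ‖t • x‖ ≤ 1 := by
      rw [norm_smul, Real.norm_of_nonneg ht.le]
      calc t * ‖x‖ ≤ t * t⁻¹ := by gcongr
        _ = 1 := mul_inv_cancel₀ ht.ne'
    simp [cutoff_eq_zero h2]
  rw [← notMem_tsupport_iff_eventuallyEq] at h1
  exact h1 h

lemma lineDeriv_test_apply (φ : Test m) (v x : Vec m) : (∂_{v} φ) x = fderiv ℝ φ x v := by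
  rw [TestFunction.lineDerivOp_eq_lineDerivCLM (𝕜 := ℝ), TestFunction.lineDerivCLM_eq_fderivCLM]
  rw [TestFunction.fderivCLM_apply_of_le (𝕜 := ℝ) φ (by simp)]

lemma fderiv_mul_cutoff (φ : Test m) (t : ℝ) (v x : Vec m) :
    fderiv ℝ (fun x => φ x * cutoff (t • x)) x v =
      (∂_{v} φ) x * cutoff (t • x) + φ x * (t * fderiv ℝ cutoff (t • x) v) := by
  have h1 : HasFDerivAt φ (fderiv ℝ φ x) x :=
    (φ.contDiff.differentiable (by simp) x).hasFDerivAt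
  have h2 : DifferentiableAt ℝ (fun x : Vec m => cutoff (t • x)) x :=
    (contDiff_cutoff.comp (contDiff_const_smul t)).differentiable (by simp) x
  have h3 : HasFDerivAt (fun x => φ x * cutoff (t • x)) _ x := h1.mul h2.hasFDerivAt
  rw [h3.fderiv, lineDeriv_test_apply, fderiv_comp_smul t]
  simp
  ring

/-- The dilated cutoffs are bounded by 1 and are eventually 1 at each `x ≠ 0`, so dominated
convergence applies. -/
lemma tendsto_integral_cutoff [NeZero m] {F : Vec m → Cl m} (hF : Integrable F) :
    Tendsto (fun n : ℕ => ∫ x, cutoff (((n : ℝ) + 1) • x) • F x) atTop (𝓝 (∫ x, F x)) := by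
  have : Nontrivial (Vec m) := inferInstance
  have h0 : ∀ᵐ x : Vec m, x ≠ 0 := by simp [ae_iff]
  refine tendsto_integral_of_dominated_convergence (fun x => ‖F x‖) (fun n => ?_) hF.norm
    (fun n => ?_) ?_
  · exact ((contDiff_cutoff.continuous.comp (continuous_const_smul _)).aestronglyMeasurable).smul
      hF.aestronglyMeasurable
  · refine Eventually.of_forall fun x => ?_
    rw [norm_smul, Real.norm_of_nonneg (cutoff_nonneg _)]
    exact mul_le_of_le_one_left (norm_nonneg _) (cutoff_le_one _)
  · filter_upwards [h0] with x hx
    refine tendsto_const_nhds.congr' ?_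
    obtain ⟨N, hN⟩ := exists_nat_ge (2 / ‖x‖)
    filter_upwards [eventually_ge_atTop N] with n hn
    rw [cutoff_eq_one, one_smul]
    have hx' : 0 < ‖x‖ := norm_pos_iff.2 hx
    rw [norm_smul, Real.norm_of_nonneg (by positivity), ← div_le_iff₀ hx']
    have : (N : ℝ) ≤ n := by exact_mod_cast hn
    linarith

/-- Integration by parts against a cutoff that is removed in the limit. In the critical degree
`1 - m` a point mass at the origin remains. -/
theorem HomogSmooth.tendsto_cutoff [NeZero m] {d : ℤ} {g : Vec m → Cl m} (hg : HomogSmooth d g)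
    (hd : 1 - (m : ℤ) ≤ d) (φ : Test m) (v : Vec m) :
    Tendsto (fun n : ℕ => ∫ x, (φ x * cutoff (((n : ℝ) + 1) • x)) • fderiv ℝ g x v) atTop
      (𝓝 (-(∫ x, (∂_{v} φ) x • g x) -
        (if d = 1 - m then φ 0 else 0) • ∫ x, fderiv ℝ cutoff x v • g x)) := by
  have hcut : Annular (fun x : Vec m => fderiv ℝ cutoff x v) := by
    simp only [fderiv_cutoff]
    exact annular_cutoffWeight.mul_left (contDiff_id.inner ℝ contDiff_const)
  have hloc := hg.locallyIntegrable (by omega)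
  have hint : Integrable fun x => (∂_{v} φ) x • g x :=
    hloc.integrable_smul_left_of_hasCompactSupport (∂_{v} φ).continuous (∂_{v} φ).hasCompactSupport
  -- After rescaling, the gradient of the cutoff sits in a fixed annulus, while the test function is
  -- evaluated ever closer to the origin.
  have hJ : Tendsto (fun n : ℕ => ∫ x, (φ (((n : ℝ) + 1)⁻¹ • x) * fderiv ℝ cutoff x v) • g x) atTop
      (𝓝 (φ 0 • ∫ x, fderiv ℝ cutoff x v • g x)) := by
    obtain ⟨C, hC⟩ := φ.hasCompactSupport.exists_bound_of_continuous φ.continuous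
    rw [← integral_smul]
    have hi := hcut.integrable_smul hg.continuousOn
    refine tendsto_integral_of_dominated_convergence
      (fun x => C * ‖fderiv ℝ cutoff x v • g x‖) (fun n => ?_) (hi.norm.const_mul C)
      (fun n => ?_) ?_
    · simp only [mul_smul]
      exact (φ.continuous.comp (continuous_const_smul _)).aestronglyMeasurable.smul
        hi.aestronglyMeasurable
    · refine Eventually.of_forall fun x => ?_
      rw [mul_smul, norm_smul]
      gcongr
      exact hC _
    · refine Eventually.of_forall fun x => ?_
      simp only [mul_smul]
      refine Tendsto.smul_const ?_ _
      have h1 : Tendsto (fun n : ℕ => ((n : ℝ) + 1)⁻¹ • x) atTop (𝓝 ((0 : ℝ) • x)) := by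
        refine Tendsto.smul_const ?_ _
        simpa [one_div] using tendsto_one_div_add_atTop_nhds_zero_nat (𝕜 := ℝ)
      rw [zero_smul] at h1
      exact (φ.continuous.tendsto 0).comp h1
  -- The scaling factor is constantly 1 in the critical degree `1 - m` and decays above it. This
  -- dichotomy decides whether a point mass appears.
  have hpow : Tendsto (fun n : ℕ => ((n : ℝ) + 1) ^ (1 - (m : ℤ) - d)) atTop
      (𝓝 (if d = 1 - m then 1 else 0)) := by
    by_cases h : d = 1 - m
    · simp [h]
    · rw [if_neg h]
      have h1 : Tendsto (fun n : ℕ => (n : ℝ) + 1) atTop atTop :=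
        tendsto_atTop_add_const_right _ _ tendsto_natCast_atTop_atTop
      obtain ⟨j, hj⟩ : ∃ j : ℕ, (1 - (m : ℤ) - d) = -((j + 1 : ℕ) : ℤ) :=
        ⟨(d + m - 2).toNat, by push_cast; omega⟩
      rw [hj]
      exact (tendsto_pow_neg_atTop (Nat.succ_ne_zero j)).comp h1 |>.congr fun n => by simp
  have hmain : ∀ n : ℕ, ∫ x, (φ x * cutoff (((n : ℝ) + 1) • x)) • fderiv ℝ g x v =
      -(∫ x, cutoff (((n : ℝ) + 1) • x) • ((∂_{v} φ) x • g x)) -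
      ((n : ℝ) + 1) ^ (1 - (m : ℤ) - d) •
        ∫ x, (φ (((n : ℝ) + 1)⁻¹ • x) * fderiv ℝ cutoff x v) • g x := by
    intro n
    set t : ℝ := (n : ℝ) + 1
    have ht : 0 < t := by positivity
    have hA := annular_mul_cutoff φ ht
    rw [hA.integral_smul_fderiv hg]
    simp only [fderiv_mul_cutoff]
    have hA1 := (annular_mul_cutoff (∂_{v} φ) ht).integrable_smul hg.continuousOn
    have hA2 : Integrable fun x => (φ x * (t * fderiv ℝ cutoff (t • x) v)) • g x := by
      have h1 := (hA.fderiv_apply v).integrable_smul hg.continuousOn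
      simp only [fderiv_mul_cutoff, add_smul] at h1
      refine (h1.sub hA1).congr (Eventually.of_forall fun x => ?_)
      simp
    simp only [add_smul]
    rw [integral_add hA1 hA2, neg_add, sub_eq_add_neg]
    congr 2
    · congr 1
      funext x
      rw [smul_smul, mul_comm]
    -- Substituting `y = tx` gives `t` from the gradient, `t^(-m)` from the volume and `t^(-d)` from
    -- the homogeneity of `g`.
    · have h1 := Measure.integral_comp_smul (μ := (volume : Measure (Vec m)))
        (fun y => (φ (t⁻¹ • y) * (t * fderiv ℝ cutoff y v)) • g (t⁻¹ • y)) t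
      simp only [smul_smul, inv_mul_cancel₀ ht.ne', one_smul, finrank_euclideanSpace_fin] at h1
      rw [h1, abs_of_pos (by positivity), ← integral_smul, ← integral_smul]
      refine integral_congr_ae (Eventually.of_forall fun y => ?_)
      by_cases hy : y = 0
      · subst hy
        simp [fderiv_cutoff]
      · simp only [hg.homog t⁻¹ (inv_pos.2 ht) y hy, smul_smul]
        congr 1
        rw [sub_sub, add_comm (m : ℤ), ← sub_sub, zpow_sub₀ ht.ne', zpow_sub₀ ht.ne', zpow_one,
          zpow_natCast, inv_zpow]
        field_simp
  simp only [hmain]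
  have := ((tendsto_integral_cutoff hint).neg).sub (hpow.smul hJ)
  convert this using 2
  split_ifs <;> simp

end HigherSpin

namespace HigherSpin

open scoped ContDiff Topology
open Filter

variable {m : ℕ}

/-! ### Fields that are homogeneous in `x` and polynomial in `u` -/

/-- Functions `G(x, u)` that are smooth in `x ≠ 0` and homogeneous of degree `d` in `x`, and
homogeneous polynomials of degree `e` in `u`. -/
structure HomogField (d e : ℤ) (G : Vec m → Vec m → Cl m) : Prop where
  poly : ∀ x, x ≠ 0 → G x ∈ polys m e
  homog : ∀ u, HomogSmooth d fun x => G x u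

lemma ae_ne_zero [NeZero m] : ∀ᵐ x : Vec m, x ≠ 0 := by
  have : Nontrivial (Vec m) := inferInstance
  simp [ae_iff]

/-- Integrals over `x` of polynomials in `u` are polynomials in `u`, and may be differentiated
under the integral sign. -/
lemma integral_polys [NeZero m] {e : ℤ} {G : Vec m → Vec m → Cl m}
    (hG : ∀ x, x ≠ 0 → G x ∈ polys m e) {W : Vec m → ℝ}
    (hW : ∀ u, Integrable fun x => W x • G x u) :
    (fun u => ∫ x, W x • G x u) ∈ polys m e ∧
      ∀ u v, fderiv ℝ (fun u => ∫ x, W x • G x u) u v = ∫ x, W x • fderiv ℝ (G x) u v := by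
  -- Interpolation writes the integrand as a finite sum of fixed functions of `u` times values at
  -- fixed nodes, so differentiating under the integral needs no domination argument.
  obtain ⟨ι, hι, y, L, hL, hLs, h⟩ := polys_interpolation m e
  have h1 : ∀ c : ι → Vec m → ℝ, ∀ u, ∫ x, W x • ∑ i, c i u • G x (y i) =
      ∑ i, c i u • ∫ x, W x • G x (y i) := by
    intro c u
    simp only [Finset.smul_sum, smul_comm (W _)]
    rw [integral_finsetSum (f := fun i x => c i u • W x • G x (y i)) _
      fun i _ => (hW (y i)).smul (c i u)]
    simp only [integral_smul]
  have h2 : (fun u => ∫ x, W x • G x u) = fun u => ∑ i, L i u • ∫ x, W x • G x (y i) := by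
    funext u
    rw [← h1]
    refine integral_congr_ae (ae_ne_zero.mono fun x hx => ?_)
    simp only
    rw [h _ (hG x hx) u]
  have hd : ∀ (a : ι → Cl m) u v, fderiv ℝ (fun u => ∑ i, L i u • a i) u v =
      ∑ i, fderiv ℝ (L i) u v • a i := by
    intro a u v
    have h3 : HasFDerivAt (fun u => ∑ i, L i u • a i)
        (∑ i, (fderiv ℝ (L i) u).smulRight (a i)) u :=
      HasFDerivAt.fun_sum fun i _ =>
        (((hLs i).differentiable (by simp) u).hasFDerivAt.smul_const (a i))
    rw [h3.fderiv]
    simp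
  refine ⟨?_, fun u v => ?_⟩
  · rw [h2]
    exact sum_mem_polys fun i _ => hL i _
  · rw [h2, hd, ← h1 (fun i u => fderiv ℝ (L i) u v)]
    refine integral_congr_ae (ae_ne_zero.mono fun x hx => ?_)
    simp only
    have h4 : G x = fun u => ∑ i, L i u • G x (y i) := funext (h _ (hG x hx))
    conv_rhs => rw [h4]
    rw [hd]

namespace HomogField

variable {d e : ℤ} {G G' : Vec m → Vec m → Cl m}

lemma add (hG : HomogField d e G) (hG' : HomogField d e G') :
    HomogField d e fun x u => G x u + G' x u :=
  ⟨fun x hx => add_mem_polys (hG.poly x hx) (hG'.poly x hx),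
    fun u => (hG.homog u).add (hG'.homog u)⟩

lemma const_smul (r : ℝ) (hG : HomogField d e G) : HomogField d e fun x u => r • G x u :=
  ⟨fun x hx => real_smul_mem r (hG.poly x hx), fun u => (hG.homog u).const_smul r⟩

lemma const_mul (a : Cl m) (hG : HomogField d e G) : HomogField d e fun x u => a * G x u :=
  ⟨fun x hx => const_mul_mem a (hG.poly x hx), fun u => (hG.homog u).const_mul a⟩

lemma vec_mul (hG : HomogField d e G) : HomogField (1 + d) e fun x u => vec x * G x u :=
  ⟨fun x hx => const_mul_mem _ (hG.poly x hx), fun u => (hG.homog u).vec_mul⟩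

lemma mulU (hG : HomogField d e G) : HomogField d (e + 1) fun x u => vec u * G x u :=
  ⟨fun x hx => vec_mul_mem (hG.poly x hx), fun u => (hG.homog u).const_mul _⟩

lemma coord_smul (hG : HomogField d e G) (i : Fin m) : HomogField d (e + 1) fun x u => u i • G x u :=
  ⟨fun x hx => coord_smul_mem (hG.poly x hx) i, fun u => (hG.homog u).const_smul _⟩

lemma inner_smul (hG : HomogField d e G) :
    HomogField (1 + d) (e + 1) fun x u => (inner ℝ x u : ℝ) • G x u :=
  ⟨fun x hx => inner_smul_mem x (hG.poly x hx), fun u => by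
    simpa [real_inner_comm] using (hG.homog u).linear_smul (innerSL ℝ u)⟩

lemma norm_zpow_smul (hG : HomogField d e G) (z : ℤ) :
    HomogField (z + d) e fun x u => ‖x‖ ^ z • G x u :=
  ⟨fun x hx => real_smul_mem _ (hG.poly x hx), fun u => (hG.homog u).norm_zpow_smul z⟩

lemma congr (hG : HomogField d e G) (h : ∀ x, x ≠ 0 → ∀ u, G' x u = G x u) :
    HomogField d e G' :=
  ⟨fun x hx => by rw [funext (h x hx)]; exact hG.poly x hx, fun u =>
    ⟨(hG.homog u).smooth.congr fun x hx => h x hx u, fun t ht x hx => by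
      rw [h _ (smul_ne_zero ht.ne' hx), h x hx, (hG.homog u).homog t ht x hx]⟩⟩

lemma sum {ι : Type*} [Fintype ι] {G : ι → Vec m → Vec m → Cl m}
    (hG : ∀ i, HomogField d e (G i)) : HomogField d e fun x u => ∑ i, G i x u :=
  ⟨fun x hx => sum_mem_polys fun i _ => (hG i).poly x hx, fun u =>
    ⟨ContDiffOn.sum fun i _ => ((hG i).homog u).smooth, fun t ht x hx => by
      rw [Finset.smul_sum]
      exact Finset.sum_congr rfl fun i _ => ((hG i).homog u).homog t ht x hx⟩⟩

/-- By interpolation a `u`-derivative is a finite combination of the values `G x (y i)` with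
coefficients independent of `x`, so smoothness and homogeneity in `x` are inherited. -/
lemma fderivU (hG : HomogField d e G) (v : Vec m) :
    HomogField d (e - 1) fun x u => fderiv ℝ (G x) u v := by
  refine ⟨fun x hx => fderiv_apply_mem (hG.poly x hx) v, fun u => ?_⟩
  obtain ⟨ι, hι, y, L, hL, hLs, h⟩ := polys_interpolation m e
  have h1 : ∀ x, x ≠ 0 → fderiv ℝ (G x) u v = ∑ i, fderiv ℝ (L i) u v • G x (y i) := by
    intro x hx
    have h3 : HasFDerivAt (fun u => ∑ i, L i u • G x (y i))
        (∑ i, (fderiv ℝ (L i) u).smulRight (G x (y i))) u :=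
      HasFDerivAt.fun_sum fun i _ =>
        (((hLs i).differentiable (by simp) u).hasFDerivAt.smul_const _)
    conv_lhs => rw [funext (h _ (hG.poly x hx)), h3.fderiv]
    simp
  refine ⟨ContDiffOn.congr (ContDiffOn.sum fun i _ =>
    ((hG.homog (y i)).const_smul _).smooth) h1, fun t ht x hx => ?_⟩
  rw [h1 _ (smul_ne_zero ht.ne' hx), h1 x hx, Finset.smul_sum]
  exact Finset.sum_congr rfl fun i _ => ((hG.homog (y i)).const_smul _).homog t ht x hx

lemma fderivX (hG : HomogField d e G) (v : Vec m) :
    HomogField (d - 1) e fun x u => fderiv ℝ (fun y => G y u) x v := by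
  refine ⟨fun x hx => ?_, fun u => (hG.homog u).fderiv_apply v⟩
  obtain ⟨ι, hι, y, L, hL, hLs, h⟩ := polys_interpolation m e
  have h1 : (fun u => fderiv ℝ (fun y => G y u) x v) =
      fun u => ∑ i, L i u • fderiv ℝ (fun z => G z (y i)) x v := by
    funext u
    have h2 : (fun z => G z u) =ᶠ[𝓝 x] fun z => ∑ i, L i u • G z (y i) := by
      filter_upwards [isOpen_ne_zero.mem_nhds hx] with z hz
      exact h _ (hG.poly z hz) u
    have h3 : HasFDerivAt (fun z => ∑ i, L i u • G z (y i))
        (∑ i, L i u • fderiv ℝ (fun z => G z (y i)) x) x :=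
      HasFDerivAt.fun_sum fun i _ =>
        ((hG.homog (y i)).differentiableAt hx).hasFDerivAt.const_smul _
    rw [h2.fderiv_eq, h3.fderiv]
    simp
  rw [h1]
  exact sum_mem_polys fun i _ => hL i _

variable [NeZero m]

lemma integrable (hG : HomogField d e G) (hd : -(m : ℤ) < d) (φ : Test m) (u : Vec m) :
    Integrable fun x => φ x • G x u :=
  ((hG.homog u).locallyIntegrable hd).integrable_smul_left_of_hasCompactSupport φ.continuous
    φ.hasCompactSupport

lemma toDistribution_mem (hG : HomogField d e G) (hd : -(m : ℤ) < d) (φ : Test m) :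
    toDistribution G φ ∈ polys m e :=
  (integral_polys hG.poly (hG.integrable hd φ)).1

lemma partialU_toDistribution (hG : HomogField d e G) (hd : -(m : ℤ) < d) (i : Fin m) :
    partialU i (toDistribution G) = toDistribution fun x u => fderiv ℝ (G x) u (stdVec i) := by
  funext φ u
  exact (integral_polys hG.poly (hG.integrable hd φ)).2 u (stdVec i)

/-- Above the critical degree the pointwise derivative is locally integrable and no point mass
appears. Both sides are limits of the same cut-off integrals. -/
lemma distDeriv_toDistribution (hG : HomogField d e G) (hd : 1 - (m : ℤ) < d) (i : Fin m) :
    distDeriv i (toDistribution G) =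
      toDistribution fun x u => fderiv ℝ (fun y => G y u) x (stdVec i) := by
  funext φ u
  have h1 := (hG.homog u).tendsto_cutoff hd.le φ (stdVec i)
  rw [if_neg hd.ne', zero_smul, sub_zero] at h1
  have h2 := tendsto_integral_cutoff ((hG.fderivX (stdVec i)).integrable (by omega) φ u)
  simp only [smul_smul, mul_comm (cutoff _)] at h2
  exact tendsto_nhds_unique h1 h2

lemma toDistribution_add (hG : HomogField d e G) (hd : -(m : ℤ) < d) {d' e' : ℤ}
    (hG' : HomogField d' e' G') (hd' : -(m : ℤ) < d') :
    toDistribution (fun x u => G x u + G' x u) = toDistribution G + toDistribution G' := by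
  funext φ u
  simp only [toDistribution, smul_add]
  exact integral_add (hG.integrable hd φ u) (hG'.integrable hd' φ u)

lemma toDistribution_sum {ι : Type*} [Fintype ι] {G : ι → Vec m → Vec m → Cl m}
    (hG : ∀ i, HomogField d e (G i)) (hd : -(m : ℤ) < d) :
    toDistribution (fun x u => ∑ i, G i x u) = fun φ u => ∑ i, toDistribution (G i) φ u := by
  funext φ u
  simp only [toDistribution, Finset.smul_sum]
  exact integral_finsetSum _ fun i _ => (hG i).integrable hd φ u

end HomogField

lemma toDistribution_smul (r : ℝ) (G : Vec m → Vec m → Cl m) :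
    toDistribution (fun x u => r • G x u) = r • toDistribution G := by
  funext φ u
  simp only [toDistribution, Pi.smul_apply, smul_comm _ r]
  exact integral_smul _ _

lemma integral_const_mul_cl (a : Cl m) {F : Vec m → Cl m} (hF : Integrable F) :
    ∫ x, a * F x = a * ∫ x, F x :=
  (mulCLM m a).integral_comp_comm hF

lemma toDistribution_congr [NeZero m] {G G' : Vec m → Vec m → Cl m}
    (h : ∀ x, x ≠ 0 → ∀ u, G x u = G' x u) : toDistribution G = toDistribution G' := by
  funext φ u
  exact integral_congr_ae (ae_ne_zero.mono fun x hx => by simp only [h x hx u])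

namespace HomogField

variable [NeZero m] {d e : ℤ} {G : Vec m → Vec m → Cl m}

lemma toDistribution_const_mul (hG : HomogField d e G) (hd : -(m : ℤ) < d) (a : Cl m)
    (φ : Test m) (u : Vec m) :
    toDistribution (fun x u => a * G x u) φ u = a * toDistribution G φ u := by
  simp only [toDistribution, ← mul_smul_comm]
  exact integral_const_mul_cl a (hG.integrable hd φ u)

lemma mulU_toDistribution (hG : HomogField d e G) (hd : -(m : ℤ) < d) :
    HigherSpin.mulU (toDistribution G) = toDistribution fun x u => vec u * G x u := by
  funext φ u
  simp only [HigherSpin.mulU, toDistribution, ← mul_smul_comm]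
  exact (integral_const_mul_cl (vec u) (hG.integrable hd φ u)).symm

lemma Dx_toDistribution (hG : HomogField d e G) (hd : 1 - (m : ℤ) < d) :
    Dx distDeriv (toDistribution G) = toDistribution fun x u =>
      ∑ i, vec (stdVec i) * fderiv ℝ (fun y => G y u) x (stdVec i) := by
  rw [toDistribution_sum (fun i => (hG.fderivX (stdVec i)).const_mul _) (by omega)]
  funext φ u
  refine Finset.sum_congr rfl fun i _ => ?_
  rw [hG.distDeriv_toDistribution hd,
    (hG.fderivX (stdVec i)).toDistribution_const_mul (by omega)]

lemma innerDuDx_toDistribution (hG : HomogField d e G) (hd : 1 - (m : ℤ) < d) :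
    innerDuDx distDeriv (toDistribution G) = toDistribution fun x u =>
      ∑ i, fderiv ℝ (fun w => fderiv ℝ (fun y => G y w) x (stdVec i)) u (stdVec i) := by
  rw [toDistribution_sum (fun i => (hG.fderivX (stdVec i)).fderivU _) (by omega)]
  funext φ u
  refine Finset.sum_congr rfl fun i _ => ?_
  rw [hG.distDeriv_toDistribution hd, (hG.fderivX (stdVec i)).partialU_toDistribution (by omega)]

end HomogField

end HigherSpin

namespace HigherSpin

open scoped ContDiff Topology
open Filter

variable {m : ℕ}

/-! ### The inverted field of a monogenic polynomial -/

/-- `u ↦ xux / ‖x‖²` as a linear map. -/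
def conjL (x : Vec m) : Vec m →L[ℝ] Vec m :=
  ContinuousLinearMap.id ℝ (Vec m) - ((2 / ‖x‖ ^ 2) • innerSL ℝ x).smulRight x

@[simp] lemma conjL_apply (x u : Vec m) : conjL x u = conj x u := by
  simp [conjL, conj]
  ring_nf

lemma conj_smul_left {t : ℝ} (ht : 0 < t) (x u : Vec m) : conj (t • x) u = conj x u := by
  by_cases hx : x = 0
  · simp [hx]
  have hx' : ‖x‖ ≠ 0 := norm_ne_zero_iff.2 hx
  simp only [conj, inner_smul_left, norm_smul, Real.norm_of_nonneg ht.le, smul_smul]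
  congr 2
  simp
  field_simp

lemma contDiffOn_conj (u : Vec m) : ContDiffOn ℝ ∞ (fun x => conj x u) {0}ᶜ := by
  have h1 : ContDiffOn ℝ ∞ (fun x : Vec m => 2 * inner ℝ x u / ‖x‖ ^ 2) {0}ᶜ := by
    refine ContDiffOn.div ?_ (contDiff_norm_sq ℝ).contDiffOn fun x hx => ?_
    · exact (contDiff_const.mul (contDiff_id.inner ℝ contDiff_const)).contDiffOn
    · exact pow_ne_zero _ (norm_ne_zero_iff.2 hx)
  exact contDiffOn_const.sub (h1.smul contDiffOn_id)

/-- The reflection depends only on the line through `x`, which gives degree 0 in `x`; it is linear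
in `u`, which preserves the degree in `u`. -/
lemma homogField_comp_conj {e : ℤ} {p : Vec m → Cl m} (hp : p ∈ polys m e) :
    HomogField 0 e fun x u => p (conj x u) := by
  refine ⟨fun x _ => ?_, fun u => ⟨?_, fun t ht x _ => ?_⟩⟩
  · simpa using comp_linear_mem (conjL x).toLinearMap hp
  · exact (polys_smooth hp).comp_contDiffOn (contDiffOn_conj u)
  · simp [conj_smul_left ht]

lemma HomogField.coordX_smul {d e : ℤ} {G : Vec m → Vec m → Cl m} (hG : HomogField d e G)
    (i : Fin m) : HomogField (1 + d) e fun x u => x i • G x u :=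
  ⟨fun x hx => real_smul_mem _ (hG.poly x hx), fun u =>
    (hG.homog u).linear_smul (EuclideanSpace.proj i)⟩

/-- The first derivative of `p` along `x`, at `conj x u`. -/
lemma homogField_fderiv_conj {e : ℤ} {p : Vec m → Cl m} (hp : p ∈ polys m e) :
    HomogField 1 (e - 1) fun x u => fderiv ℝ p (conj x u) x := by
  have h := HomogField.sum fun i : Fin m =>
    (homogField_comp_conj (fderiv_apply_mem hp (stdVec i))).coordX_smul i
  exact h.congr fun x _ u => apply_eq_sum _ x

/-- The second derivative of `p` along `x`, at `conj x u`. -/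
lemma homogField_fderiv_fderiv_conj {e : ℤ} {p : Vec m → Cl m} (hp : p ∈ polys m e) :
    HomogField 2 (e - 2) fun x u => fderiv ℝ (fderiv ℝ p) (conj x u) x x := by
  have h := HomogField.sum fun i : Fin m =>
    (homogField_fderiv_conj (fderiv_apply_mem hp (stdVec i))).coordX_smul i
  have h2 : (1 + 1 : ℤ) = 2 := rfl
  rw [h2, show e - 1 - 1 = e - 2 by ring] at h
  refine h.congr fun x _ u => ?_
  rw [apply_eq_sum (fderiv ℝ (fderiv ℝ p) (conj x u) x) x]
  refine Finset.sum_congr rfl fun i _ => ?_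
  have h3 : HasFDerivAt (fun w => fderiv ℝ p w (stdVec i)) _ (conj x u) :=
    ((((polys_smooth hp).fderiv_right (m := ∞) (by simp)).differentiable (by simp)
      (conj x u)).hasFDerivAt).clm_apply (hasFDerivAt_const (stdVec i) _)
  rw [h3.fderiv]
  simp

/-- `‖x‖^{2-m} f(xux/‖x‖²)`. -/
def fieldA (f : Vec m → Cl m) (x u : Vec m) : Cl m := ‖x‖ ^ (2 - (m : ℤ)) • f (conj x u)

/-- `-2 ‖x‖^{-m} (∂_x f)(xux/‖x‖²)`. -/
def fieldB (f : Vec m → Cl m) (x u : Vec m) : Cl m :=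
  (-2 : ℝ) • (‖x‖ ^ (-(m : ℤ)) • fderiv ℝ f (conj x u) x)

/-- `4 ‖x‖^{-m-2} (∂_x² f)(xux/‖x‖²)`. -/
def fieldC (f : Vec m → Cl m) (x u : Vec m) : Cl m :=
  (4 : ℝ) • (‖x‖ ^ (-(m : ℤ) - 2) • fderiv ℝ (fderiv ℝ f) (conj x u) x x)

lemma homogField_fieldA {e : ℤ} {f : Vec m → Cl m} (hf : f ∈ polys m e) :
    HomogField (2 - m) e (fieldA f) := by
  have := (homogField_comp_conj hf).norm_zpow_smul (2 - (m : ℤ))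
  rwa [add_zero] at this

lemma homogField_fieldB {e : ℤ} {f : Vec m → Cl m} (hf : f ∈ polys m e) :
    HomogField (1 - m) (e - 1) (fieldB f) := by
  have := ((homogField_fderiv_conj hf).norm_zpow_smul (-(m : ℤ))).const_smul (-2)
  rwa [neg_add_eq_sub] at this

lemma homogField_fieldC {e : ℤ} {f : Vec m → Cl m} (hf : f ∈ polys m e) :
    HomogField (-m) (e - 2) (fieldC f) := by
  have := ((homogField_fderiv_fderiv_conj hf).norm_zpow_smul (-(m : ℤ) - 2)).const_smul 4
  rwa [sub_add_cancel] at this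

/-! ### Derivatives of the inverted field -/

lemma sum_stdVec_mul_stdVec_mul (a : Cl m) :
    ∑ i : Fin m, vec (stdVec i) * (vec (stdVec i) * a) = -(m : ℝ) • a := by
  simp [stdVec_mul_stdVec, Nat.cast_smul_eq_nsmul]

lemma sum_coord_smul_vec (x : Vec m) (a : Cl m) :
    ∑ i, x i • (vec (stdVec i) * a) = vec x * a := by
  rw [vec_eq_sum x, Finset.sum_mul]
  simp

/-- The Dirac operator on `x G(x)`. -/
lemma sum_stdVec_mul_fderiv_vec_mul {d : ℝ} {G : Vec m → Cl m} {x : Vec m}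
    (hG : DifferentiableAt ℝ G x) (hd : fderiv ℝ G x x = d • G x) :
    ∑ i, vec (stdVec i) * fderiv ℝ (fun y => vec y * G y) x (stdVec i) =
      -(m + 2 * d : ℝ) • G x - vec x * ∑ i, vec (stdVec i) * fderiv ℝ G x (stdVec i) := by
  have h1 : ∀ i, fderiv ℝ (fun y => vec y * G y) x (stdVec i) =
      vec x * fderiv ℝ G x (stdVec i) + vec (stdVec i) * G x := by
    intro i
    have h2 := (mulCLM m).hasFDerivAt_of_bilinear (vecCLM m).hasFDerivAt
      hG.hasFDerivAt
    have h3 : HasFDerivAt (fun y => vec y * G y) _ x := h2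
    rw [h3.fderiv]
    simp
  have h4 : ∀ i, vec (stdVec i) * (vec x * fderiv ℝ G x (stdVec i)) =
      -(vec x * (vec (stdVec i) * fderiv ℝ G x (stdVec i))) -
        (2 : ℝ) • (x i • fderiv ℝ G x (stdVec i)) := by
    intro i
    rw [vec_mul_vec_mul, stdVec_inner, smul_smul]
  simp only [h1, mul_add, h4, Finset.sum_add_distrib, Finset.sum_sub_distrib,
    Finset.sum_neg_distrib, sum_stdVec_mul_stdVec_mul, ← Finset.smul_sum, ← Finset.mul_sum,
    ← apply_eq_sum (fderiv ℝ G x) x, hd]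
  module

lemma HomogSmooth.dirac_vec_mul {d : ℤ} {G : Vec m → Cl m} (hG : HomogSmooth d G) {x : Vec m}
    (hx : x ≠ 0) :
    ∑ i, vec (stdVec i) * fderiv ℝ (fun y => vec y * G y) x (stdVec i) =
      -(m + 2 * d : ℝ) • G x - vec x * ∑ i, vec (stdVec i) * fderiv ℝ G x (stdVec i) :=
  sum_stdVec_mul_fderiv_vec_mul (hG.differentiableAt hx) (hG.fderiv_self hx)

lemma hasFDerivAt_norm_zpow (z : ℤ) {x : Vec m} (hx : x ≠ 0) :
    ∃ L : Vec m →L[ℝ] ℝ, HasFDerivAt (fun x : Vec m => ‖x‖ ^ z) L x ∧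
      ∀ e, L e = z * ‖x‖ ^ (z - 2) * inner ℝ x e := by
  have hx' : ‖x‖ ≠ 0 := norm_ne_zero_iff.2 hx
  have h1 : HasFDerivAt (fun x : Vec m => √(‖x‖ ^ 2)) _ x :=
    (hasStrictFDerivAt_norm_sq x).hasFDerivAt.sqrt (pow_ne_zero _ hx')
  have h2 : (fun x : Vec m => √(‖x‖ ^ 2)) = fun x => ‖x‖ := by
    funext y; exact Real.sqrt_sq (norm_nonneg y)
  rw [h2] at h1
  have h3 : HasFDerivAt (fun x : Vec m => ‖x‖ ^ z) _ x :=
    (hasDerivAt_zpow z ‖x‖ (Or.inl hx')).comp_hasFDerivAt x h1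
  refine ⟨_, h3, fun e => ?_⟩
  simp only [smul_apply, innerSL_apply_apply, smul_eq_mul, nsmul_eq_mul,
    Real.sqrt_sq (norm_nonneg x)]
  rw [show z - 2 = z - 1 - 1 by ring, zpow_sub_one₀ hx' (z - 1)]
  push_cast
  field_simp

/-- The derivative of `conj x u` with respect to `x`. -/
lemma hasFDerivAt_conj {x : Vec m} (hx : x ≠ 0) (u : Vec m) :
    ∃ L : Vec m →L[ℝ] Vec m, HasFDerivAt (fun x => conj x u) L x ∧
      ∀ e, L e = -(2 / ‖x‖ ^ 2) • (inner ℝ x u • e + inner ℝ e u • x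
        - (2 * inner ℝ x u * inner ℝ x e / ‖x‖ ^ 2) • x) := by
  have hx' : ‖x‖ ≠ 0 := norm_ne_zero_iff.2 hx
  obtain ⟨L, hL, hLe⟩ := hasFDerivAt_norm_zpow (-2) hx
  have h2 : HasFDerivAt (fun x : Vec m => 2 * inner ℝ x u) ((2 : ℝ) • innerSL ℝ u) x := by
    have := ((innerSL ℝ u).hasFDerivAt (x := x)).const_mul 2
    simpa [real_inner_comm] using this
  have h3 : HasFDerivAt (fun x : Vec m => u - (2 * inner ℝ x u * ‖x‖ ^ (-2 : ℤ)) • x) _ x :=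
    ((h2.mul hL).smul (hasFDerivAt_id x)).const_sub u
  have h4 : (fun x : Vec m => conj x u) =
      fun x : Vec m => u - (2 * inner ℝ x u * ‖x‖ ^ (-2 : ℤ)) • x := by
    funext y
    simp only [conj, zpow_neg, div_eq_mul_inv]
    rfl
  rw [← h4] at h3
  refine ⟨_, h3, fun e => ?_⟩
  simp only [neg_apply, add_apply, smul_apply, ContinuousLinearMap.smulRight_apply,
    innerSL_apply_apply, ContinuousLinearMap.id_apply, smul_eq_mul, hLe, Pi.mul_apply, id_eq]
  rw [real_inner_comm e u]
  have e1 : ‖x‖ ^ (-2 : ℤ) = (‖x‖ ^ 2)⁻¹ := by rw [zpow_neg]; rfl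
  have e2 : ‖x‖ ^ (-2 - 2 : ℤ) = (‖x‖ ^ 4)⁻¹ := by
    rw [show (-2 - 2 : ℤ) = -4 by norm_num, zpow_neg]; rfl
  rw [e1, e2]
  match_scalars <;> field_simp
  ring

lemma conj_add (x u : Vec m) : conj x u + (2 * inner ℝ x u / ‖x‖ ^ 2) • x = u := by
  simp [conj]

section Monogenic

variable {f : Vec m → Cl m} {k : ℤ} (hf : f ∈ polys m k)
include hf

lemma hasFDerivAt_comp_conj {x : Vec m} (hx : x ≠ 0) (u : Vec m) :
    ∃ L : Vec m →L[ℝ] Cl m, HasFDerivAt (fun x => f (conj x u)) L x ∧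
      ∀ e, L e = -(2 / ‖x‖ ^ 2) • (inner ℝ x u • fderiv ℝ f (conj x u) e
        + inner ℝ e u • fderiv ℝ f (conj x u) x
        - (2 * inner ℝ x u * inner ℝ x e / ‖x‖ ^ 2) • fderiv ℝ f (conj x u) x) := by
  obtain ⟨L, hL, hLe⟩ := hasFDerivAt_conj hx u
  refine ⟨_, ((polys_differentiable hf _).hasFDerivAt).comp x hL, fun e => ?_⟩
  simp only [ContinuousLinearMap.comp_apply, hLe, map_smul, map_add, map_sub]

lemma differentiable_fderiv_polys : Differentiable ℝ (fderiv ℝ f) :=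
  ((polys_smooth hf).fderiv_right (m := ∞) (by simp)).differentiable (by simp)

lemma fderiv_fderiv_symm (w y z : Vec m) :
    fderiv ℝ (fderiv ℝ f) w y z = fderiv ℝ (fderiv ℝ f) w z y :=
  ((polys_smooth hf).contDiffAt.isSymmSndFDerivAt (by
    simpa using WithTop.coe_le_coe.2 (le_top : (2 : ℕ∞) ≤ ⊤))).eq y z

lemma fderiv_fderiv_apply (w y z : Vec m) :
    fderiv ℝ (fun w => fderiv ℝ f w z) w y = fderiv ℝ (fderiv ℝ f) w y z := by
  have h3 : HasFDerivAt (fun w => fderiv ℝ f w z) _ w :=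
    (differentiable_fderiv_polys hf w).hasFDerivAt.clm_apply (hasFDerivAt_const z w)
  rw [h3.fderiv]
  simp

lemma fderiv_fderiv_self (w z : Vec m) :
    fderiv ℝ (fderiv ℝ f) w w z = (k - 1 : ℝ) • fderiv ℝ f w z := by
  rw [← fderiv_fderiv_apply hf, fderiv_apply_self (fderiv_apply_mem hf z)]
  push_cast
  rfl

lemma hasFDerivAt_fderiv_comp_conj {x : Vec m} (hx : x ≠ 0) (u : Vec m) :
    ∃ L : Vec m →L[ℝ] Vec m →L[ℝ] Cl m, HasFDerivAt (fun x => fderiv ℝ f (conj x u)) L x ∧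
      ∀ e, L e = -(2 / ‖x‖ ^ 2) • (inner ℝ x u • fderiv ℝ (fderiv ℝ f) (conj x u) e
        + inner ℝ e u • fderiv ℝ (fderiv ℝ f) (conj x u) x
        - (2 * inner ℝ x u * inner ℝ x e / ‖x‖ ^ 2) • fderiv ℝ (fderiv ℝ f) (conj x u) x) := by
  obtain ⟨L, hL, hLe⟩ := hasFDerivAt_conj hx u
  refine ⟨_, ((differentiable_fderiv_polys hf _).hasFDerivAt).comp x hL, fun e => ?_⟩
  simp only [ContinuousLinearMap.comp_apply, hLe, map_smul, map_add, map_sub]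

/-- Euler's formula at the reflected point. -/
lemma fderiv_conj_apply (x u : Vec m) : fderiv ℝ f (conj x u) u =
    (k : ℝ) • f (conj x u) + (2 * inner ℝ x u / ‖x‖ ^ 2) • fderiv ℝ f (conj x u) x := by
  rw [show fderiv ℝ f (conj x u) u = fderiv ℝ f (conj x u)
    (conj x u + (2 * inner ℝ x u / ‖x‖ ^ 2) • x) by rw [conj_add]]
  rw [map_add, map_smul, fderiv_apply_self hf]

end Monogenic

end HigherSpin

namespace HigherSpin

open scoped ContDiff Topology
open Filter

variable {m : ℕ}

section InvertedField

variable {f : Vec m → Cl m} {k : ℤ}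

/-- Expresses the norm factor of `fieldA` through that of `fieldC`. With a single symbolic power of
the norm left, the field identities become rational in `‖x‖`. -/
lemma norm_zpow_two_sub {x : Vec m} (hx : x ≠ 0) :
    ‖x‖ ^ (2 - (m : ℤ)) = ‖x‖ ^ (-(m : ℤ) - 2) * ‖x‖ ^ 4 := by
  have hx' : ‖x‖ ≠ 0 := norm_ne_zero_iff.2 hx
  rw [← zpow_natCast, ← zpow_add₀ hx']
  congr 1
  push_cast
  ring

lemma norm_zpow_neg {x : Vec m} (hx : x ≠ 0) :
    ‖x‖ ^ (-(m : ℤ)) = ‖x‖ ^ (-(m : ℤ) - 2) * ‖x‖ ^ 2 := by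
  have hx' : ‖x‖ ≠ 0 := norm_ne_zero_iff.2 hx
  rw [← zpow_natCast, ← zpow_add₀ hx']
  congr 1
  push_cast
  ring

/-- Partial derivatives of `fieldA` with respect to `x`. -/
lemma fderiv_fieldA (hf : f ∈ polys m k) {x : Vec m} (hx : x ≠ 0) (u e : Vec m) :
    fderiv ℝ (fun y => fieldA f y u) x e =
      ((2 - m) * ‖x‖ ^ (-(m : ℤ)) * inner ℝ x e : ℝ) • f (conj x u)
      - (2 * ‖x‖ ^ (-(m : ℤ)) * inner ℝ x u : ℝ) • fderiv ℝ f (conj x u) e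
      + (inner ℝ e u - 2 * inner ℝ x u * inner ℝ x e / ‖x‖ ^ 2) • fieldB f x u := by
  have hx' : ‖x‖ ≠ 0 := norm_ne_zero_iff.2 hx
  -- Product rule: the norm factor contributes the first term of the formula, the chain rule through
  -- the reflection the other two. The factor `-2/‖x‖²` from the reflection explains the constant in
  -- `fieldB`.
  obtain ⟨L, hL, hLe⟩ := hasFDerivAt_norm_zpow (2 - (m : ℤ)) hx
  obtain ⟨L', hL', hLe'⟩ := hasFDerivAt_comp_conj hf hx u
  have h : HasFDerivAt (fun y => fieldA f y u) _ x := hL.smul hL'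
  rw [h.fderiv]
  simp only [add_apply, smul_apply, ContinuousLinearMap.smulRight_apply, hLe, hLe', fieldB]
  rw [show (2 - (m : ℤ) - 2) = -(m : ℤ) by ring, norm_zpow_two_sub hx, norm_zpow_neg hx]
  push_cast
  match_scalars <;> field_simp

/-- Partial derivatives of `fieldB` with respect to `x`. -/
lemma fderiv_fieldB (hf : f ∈ polys m k) {x : Vec m} (hx : x ≠ 0) (u e : Vec m) :
    fderiv ℝ (fun y => fieldB f y u) x e =
      (-m * inner ℝ x e / ‖x‖ ^ 2 : ℝ) • fieldB f x u
      - (2 * ‖x‖ ^ (-(m : ℤ))) • fderiv ℝ f (conj x u) e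
      + (4 * ‖x‖ ^ (-(m : ℤ) - 2) * inner ℝ x u) • fderiv ℝ (fderiv ℝ f) (conj x u) e x
      + (inner ℝ e u - 2 * inner ℝ x u * inner ℝ x e / ‖x‖ ^ 2) • fieldC f x u := by
  have hx' : ‖x‖ ≠ 0 := norm_ne_zero_iff.2 hx
  obtain ⟨L, hL, hLe⟩ := hasFDerivAt_norm_zpow (-(m : ℤ)) hx
  obtain ⟨L', hL', hLe'⟩ := hasFDerivAt_fderiv_comp_conj hf hx u
  have h : HasFDerivAt (fun y => fieldB f y u) _ x :=
    (hL.smul (hL'.clm_apply (hasFDerivAt_id x))).const_smul (-2 : ℝ)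
  rw [h.fderiv]
  simp only [add_apply, sub_apply, smul_apply, ContinuousLinearMap.smulRight_apply, hLe, hLe',
    fieldB, fieldC, ContinuousLinearMap.comp_apply, ContinuousLinearMap.flip_apply,
    ContinuousLinearMap.id_apply, id_eq]
  rw [norm_zpow_neg hx]
  push_cast
  match_scalars <;> field_simp <;> ring

variable (hf : f ∈ polys m k) (hD : ∀ u, diracU f u = 0)
include hf

/-- The vector `u` is `conj x u` plus a multiple of `x`, and Euler's formula for the degree `k - 1`
polynomial `∂_y f` evaluates the first part. -/
lemma sum_conj_fderiv_fderiv (x u y : Vec m) :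
    fderiv ℝ (fderiv ℝ f) (conj x u) u y = (k - 1 : ℝ) • fderiv ℝ f (conj x u) y
      + (2 * inner ℝ x u / ‖x‖ ^ 2) • fderiv ℝ (fderiv ℝ f) (conj x u) x y := by
  rw [show fderiv ℝ (fderiv ℝ f) (conj x u) u y = fderiv ℝ (fderiv ℝ f) (conj x u)
    (conj x u + (2 * inner ℝ x u / ‖x‖ ^ 2) • x) y by rw [conj_add]]
  rw [map_add, map_smul, add_apply, smul_apply, fderiv_fderiv_self hf]

/-- `⟨u, D_x⟩` applied to `fieldB`. -/
lemma fderiv_fieldB_self {x : Vec m} (hx : x ≠ 0) (u : Vec m) :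
    fderiv ℝ (fun y => fieldB f y u) x u = ‖u‖ ^ 2 • fieldC f x u
      + ((4 - m - 2 * k) * inner ℝ x u / ‖x‖ ^ 2 : ℝ) • fieldB f x u
      - (2 * k / ‖x‖ ^ 2 : ℝ) • fieldA f x u := by
  have hx' : ‖x‖ ≠ 0 := norm_ne_zero_iff.2 hx
  rw [fderiv_fieldB hf hx, sum_conj_fderiv_fderiv hf, fderiv_conj_apply hf,
    real_inner_self_eq_norm_sq, fieldA, fieldB, fieldC, norm_zpow_two_sub hx, norm_zpow_neg hx]
  match_scalars <;> field_simp <;> ring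

include hD

omit hf in
lemma sum_stdVec_mul_fderiv (w : Vec m) :
    ∑ i, vec (stdVec i) * fderiv ℝ f w (stdVec i) = 0 := hD w

/-- Obtained by differentiating the identity `D_u f = 0` in the direction `y`: derivatives of
monogenic polynomials are monogenic. -/
lemma sum_stdVec_mul_fderiv_fderiv (w y : Vec m) :
    ∑ i, vec (stdVec i) * fderiv ℝ (fderiv ℝ f) w (stdVec i) y = 0 := by
  have h1 : HasFDerivAt (fun w => ∑ i, vec (stdVec i) * fderiv ℝ f w (stdVec i))
      (∑ i, (mulCLM m (vec (stdVec i))).comp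
        ((fderiv ℝ (fderiv ℝ f) w).flip (stdVec i))) w := by
    refine HasFDerivAt.fun_sum fun i _ => (mulCLM m (vec (stdVec i))).hasFDerivAt.comp w ?_
    have := (differentiable_fderiv_polys hf w).hasFDerivAt.clm_apply
      (hasFDerivAt_const (stdVec i) w)
    simpa using this
  have h2 : (fun w => ∑ i, vec (stdVec i) * fderiv ℝ f w (stdVec i)) = fun _ => 0 := funext hD
  rw [h2] at h1
  have h3 := congrArg (fun A : Vec m →L[ℝ] Cl m => A y)
    (h1.unique (hasFDerivAt_const (0 : Cl m) w))
  simp only [sum_apply, ContinuousLinearMap.comp_apply, ContinuousLinearMap.flip_apply,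
    mulCLM_apply, zero_apply] at h3
  rw [← h3]
  exact Finset.sum_congr rfl fun i _ => by rw [fderiv_fderiv_symm hf]

/-- Monogenic polynomials are harmonic. -/
lemma sum_fderiv_fderiv (w : Vec m) :
    ∑ i, fderiv ℝ (fderiv ℝ f) w (stdVec i) (stdVec i) = 0 := by
  have h1 : ∑ j, vec (stdVec j) * ∑ i, vec (stdVec i) *
      fderiv ℝ (fderiv ℝ f) w (stdVec i) (stdVec j) = 0 := by
    simp [sum_stdVec_mul_fderiv_fderiv hf hD]
  have h2 : ∑ i, ∑ j, vec (stdVec i) * (vec (stdVec j) *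
      fderiv ℝ (fderiv ℝ f) w (stdVec i) (stdVec j)) = 0 := by
    rw [← h1]
    simp only [Finset.mul_sum]
    exact Finset.sum_congr rfl fun i _ => Finset.sum_congr rfl fun j _ => by
      rw [fderiv_fderiv_symm hf]
  -- The Clifford relation turns the double sum into minus its transpose minus twice the Laplacian;
  -- both double sums vanish by monogenicity.
  have h3 : ∀ i j : Fin m, vec (stdVec i) * (vec (stdVec j) *
      fderiv ℝ (fderiv ℝ f) w (stdVec i) (stdVec j)) =
      -(vec (stdVec j) * (vec (stdVec i) * fderiv ℝ (fderiv ℝ f) w (stdVec i) (stdVec j))) -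
      if i = j then (2 : ℝ) • fderiv ℝ (fderiv ℝ f) w (stdVec i) (stdVec i) else 0 := by
    intro i j
    rw [vec_mul_vec_mul, inner_stdVec, stdVec_apply]
    by_cases h : i = j
    · subst h; simp
    · simp [h]
  simp only [h3, Finset.sum_sub_distrib, Finset.sum_neg_distrib, Finset.sum_ite_eq,
    Finset.mem_univ, if_true] at h2
  rw [Finset.sum_comm] at h2
  simp only [← Finset.mul_sum, h1, ← Finset.smul_sum, neg_zero, zero_sub, neg_eq_zero,
    smul_eq_zero, two_ne_zero, false_or] at h2
  exact h2

/-- `D_x` applied to `fieldA`. -/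
lemma diracX_fieldA {x : Vec m} (hx : x ≠ 0) (u : Vec m) :
    ∑ i, vec (stdVec i) * fderiv ℝ (fun y => fieldA f y u) x (stdVec i) =
      ((2 - m) / ‖x‖ ^ 2 : ℝ) • (vec x * fieldA f x u) + vec u * fieldB f x u
      - (2 * inner ℝ x u / ‖x‖ ^ 2) • (vec x * fieldB f x u) := by
  have hx' : ‖x‖ ≠ 0 := norm_ne_zero_iff.2 hx
  have h1 : ∀ i, vec (stdVec i) * fderiv ℝ (fun y => fieldA f y u) x (stdVec i) =
      ((2 - m) * ‖x‖ ^ (-(m : ℤ)) : ℝ) • (x i • (vec (stdVec i) * f (conj x u)))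
      - (2 * ‖x‖ ^ (-(m : ℤ)) * inner ℝ x u : ℝ) •
        (vec (stdVec i) * fderiv ℝ f (conj x u) (stdVec i))
      + u i • (vec (stdVec i) * fieldB f x u)
      - (2 * inner ℝ x u / ‖x‖ ^ 2) • (x i • (vec (stdVec i) * fieldB f x u)) := by
    intro i
    simp only [fderiv_fieldA hf hx, inner_stdVec, stdVec_inner, mul_add, mul_sub, mul_smul_comm]
    match_scalars <;> field_simp
  simp only [h1, Finset.sum_add_distrib, Finset.sum_sub_distrib, ← Finset.smul_sum,
    sum_stdVec_mul_fderiv hD, sum_coord_smul_vec]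
  rw [fieldA, norm_zpow_two_sub hx, norm_zpow_neg hx, mul_smul_comm]
  match_scalars <;> field_simp

/-- `D_x` applied to `fieldB`. -/
lemma diracX_fieldB {x : Vec m} (hx : x ≠ 0) (u : Vec m) :
    ∑ i, vec (stdVec i) * fderiv ℝ (fun y => fieldB f y u) x (stdVec i) =
      (-m / ‖x‖ ^ 2 : ℝ) • (vec x * fieldB f x u) + vec u * fieldC f x u
      - (2 * inner ℝ x u / ‖x‖ ^ 2) • (vec x * fieldC f x u) := by
  have hx' : ‖x‖ ≠ 0 := norm_ne_zero_iff.2 hx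
  have h1 : ∀ i, vec (stdVec i) * fderiv ℝ (fun y => fieldB f y u) x (stdVec i) =
      (-m / ‖x‖ ^ 2 : ℝ) • (x i • (vec (stdVec i) * fieldB f x u))
      - (2 * ‖x‖ ^ (-(m : ℤ)) : ℝ) • (vec (stdVec i) * fderiv ℝ f (conj x u) (stdVec i))
      + (4 * ‖x‖ ^ (-(m : ℤ) - 2) * inner ℝ x u) •
        (vec (stdVec i) * fderiv ℝ (fderiv ℝ f) (conj x u) (stdVec i) x)
      + u i • (vec (stdVec i) * fieldC f x u)
      - (2 * inner ℝ x u / ‖x‖ ^ 2) • (x i • (vec (stdVec i) * fieldC f x u)) := by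
    intro i
    simp only [fderiv_fieldB hf hx, inner_stdVec, stdVec_inner, mul_add, mul_sub, mul_smul_comm]
    match_scalars <;> field_simp
  simp only [h1, Finset.sum_add_distrib, Finset.sum_sub_distrib, ← Finset.smul_sum,
    sum_stdVec_mul_fderiv hD, sum_stdVec_mul_fderiv_fderiv hf hD, sum_coord_smul_vec]
  module

/-- `D_x` applied to the inverted field `x A`. -/
lemma diracX_vec_mul_fieldA {x : Vec m} (hx : x ≠ 0) (u : Vec m) :
    ∑ i, vec (stdVec i) * fderiv ℝ (fun y => vec y * fieldA f y u) x (stdVec i) =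
      (-2 : ℝ) • fieldA f x u + vec u * (vec x * fieldB f x u) := by
  have hx' : ‖x‖ ≠ 0 := norm_ne_zero_iff.2 hx
  -- Degree `2 - m` gives the coefficient `m - 4`, and `x² = -‖x‖²` adds `2 - m`, leaving `-2`.
  -- Replacing `xu` by `-ux - 2⟨x, u⟩` cancels the term in `⟨x, u⟩B`.
  rw [((homogField_fieldA hf).homog u).dirac_vec_mul hx, diracX_fieldA hf hD hx, mul_sub, mul_add,
    mul_smul_comm, mul_smul_comm, vec_mul_self_mul, vec_mul_self_mul, vec_mul_vec_mul]
  push_cast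
  match_scalars <;> field_simp <;> ring

/-- `D_x` applied to `x B`. -/
lemma diracX_vec_mul_fieldB {x : Vec m} (hx : x ≠ 0) (u : Vec m) :
    ∑ i, vec (stdVec i) * fderiv ℝ (fun y => vec y * fieldB f y u) x (stdVec i) =
      (-2 : ℝ) • fieldB f x u + vec u * (vec x * fieldC f x u) := by
  have hx' : ‖x‖ ≠ 0 := norm_ne_zero_iff.2 hx
  rw [((homogField_fieldB hf).homog u).dirac_vec_mul hx, diracX_fieldB hf hD hx, mul_sub, mul_add,
    mul_smul_comm, mul_smul_comm, vec_mul_self_mul, vec_mul_self_mul, vec_mul_vec_mul]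
  push_cast
  match_scalars <;> field_simp <;> ring

omit hD in
lemma hasFDerivAt_comp_conjU (x u : Vec m) :
    ∃ L : Vec m →L[ℝ] Cl m, HasFDerivAt (fun w => f (conj x w)) L u ∧
      ∀ e, L e = fderiv ℝ f (conj x u) e
        - (2 * inner ℝ x e / ‖x‖ ^ 2) • fderiv ℝ f (conj x u) x := by
  have h1 : HasFDerivAt (fun w => conj x w) (conjL x) u := by
    rw [show (fun w => conj x w) = conjL x by funext w; simp]
    exact (conjL x).hasFDerivAt
  refine ⟨_, ((polys_differentiable hf _).hasFDerivAt).comp u h1, fun e => ?_⟩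
  simp [conj]

/-- `⟨D_u, D_x⟩` applied to `fieldA`. -/
lemma innerDuDx_fieldA {x : Vec m} (hx : x ≠ 0) (u : Vec m) :
    ∑ i, fderiv ℝ (fun w => fderiv ℝ (fun y => fieldA f y w) x (stdVec i)) u (stdVec i) =
      ((m + 2 * k - 2) / 2 : ℝ) • fieldB f x u := by
  have hx' : ‖x‖ ≠ 0 := norm_ne_zero_iff.2 hx
  obtain ⟨L, hL, hLe⟩ := hasFDerivAt_comp_conjU hf x u
  have hs : HasFDerivAt (fun w : Vec m => inner ℝ x w) (innerSL ℝ x) u :=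
    (innerSL ℝ x).hasFDerivAt
  -- The terms are arranged so that each sum over `i` is a directional derivative, `‖x‖²`, `⟨x, u⟩`,
  -- the number `m`, or the Laplacian of `f`, which vanishes.
  have h1 : ∀ i, fderiv ℝ (fun w => fderiv ℝ (fun y => fieldA f y w) x (stdVec i)) u (stdVec i) =
      ((2 - m) * ‖x‖ ^ (-(m : ℤ)) : ℝ) • (x i • fderiv ℝ f (conj x u) (stdVec i))
      - (2 * (2 - m) * ‖x‖ ^ (-(m : ℤ) - 2) : ℝ) • ((x i * x i) • fderiv ℝ f (conj x u) x)
      - (2 * ‖x‖ ^ (-(m : ℤ))) • (x i • fderiv ℝ f (conj x u) (stdVec i))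
      - (2 * ‖x‖ ^ (-(m : ℤ)) * inner ℝ x u) •
        fderiv ℝ (fderiv ℝ f) (conj x u) (stdVec i) (stdVec i)
      + (4 * ‖x‖ ^ (-(m : ℤ) - 2) * inner ℝ x u) •
        (x i • fderiv ℝ (fderiv ℝ f) (conj x u) x (stdVec i))
      + fieldB f x u - (2 / ‖x‖ ^ 2) • ((x i * x i) • fieldB f x u)
      - (2 * ‖x‖ ^ (-(m : ℤ))) • (u i • fderiv ℝ (fderiv ℝ f) (conj x u) x (stdVec i))
      + (4 * ‖x‖ ^ (-(m : ℤ) - 2)) • ((x i * u i) • fderiv ℝ (fderiv ℝ f) (conj x u) x x)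
      + (4 * ‖x‖ ^ (-(m : ℤ) - 2) * inner ℝ x u) •
        (x i • fderiv ℝ (fderiv ℝ f) (conj x u) x (stdVec i))
      - (8 * ‖x‖ ^ (-(m : ℤ) - 2) * inner ℝ x u / ‖x‖ ^ 2) •
        ((x i * x i) • fderiv ℝ (fderiv ℝ f) (conj x u) x x) := by
    intro i
    obtain ⟨Li, hLi, hLie⟩ := hasFDerivAt_comp_conjU (fderiv_apply_mem hf (stdVec i)) x u
    obtain ⟨Lx, hLx, hLxe⟩ := hasFDerivAt_comp_conjU (fderiv_apply_mem hf x) x u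
    have hi : HasFDerivAt (fun w : Vec m => inner ℝ (stdVec i) w) (innerSL ℝ (stdVec i)) u :=
      (innerSL ℝ (stdVec i)).hasFDerivAt
    simp only [fderiv_fieldA hf hx]
    have h2 : HasFDerivAt (fun w => ((2 - m) * ‖x‖ ^ (-(m : ℤ)) * inner ℝ x (stdVec i) : ℝ) •
        f (conj x w) - (2 * ‖x‖ ^ (-(m : ℤ)) * inner ℝ x w : ℝ) • fderiv ℝ f (conj x w) (stdVec i)
        + (inner ℝ (stdVec i) w - 2 * inner ℝ x w * inner ℝ x (stdVec i) * (‖x‖ ^ 2)⁻¹) •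
          fieldB f x w) _ u :=
      ((hL.const_smul ((2 - m) * ‖x‖ ^ (-(m : ℤ)) * inner ℝ x (stdVec i) : ℝ)).sub ((hs.const_mul (2 * ‖x‖ ^ (-(m : ℤ)))).smul hLi)).add
        ((hi.sub (((hs.const_mul 2).mul_const (inner ℝ x (stdVec i))).mul_const (‖x‖ ^ 2)⁻¹)).smul
          ((hLx.const_smul (‖x‖ ^ (-(m : ℤ)))).const_smul (-2 : ℝ)))
    simp only [← div_eq_mul_inv] at h2
    rw [h2.fderiv]
    simp only [add_apply, sub_apply, Pi.sub_apply, smul_apply, ContinuousLinearMap.smulRight_apply, hLe, hLie,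
      hLxe, innerSL_apply_apply, inner_stdVec, stdVec_inner, fderiv_fderiv_apply hf, fieldB,
      norm_zpow_neg hx, smul_eq_mul, stdVec_apply, if_true]
    simp only [fderiv_fderiv_symm hf _ (stdVec i) x]
    match_scalars <;> field_simp <;> ring
  have hxx : ∑ i, x i * x i = ‖x‖ ^ 2 := by
    rw [EuclideanSpace.real_norm_sq_eq]; simp [sq]
  have hxu : ∑ i, x i * u i = inner ℝ x u := by
    simp [PiLp.inner_apply, mul_comm]
  simp only [h1, Finset.sum_add_distrib, Finset.sum_sub_distrib, ← Finset.smul_sum,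
    ← apply_eq_sum, ← Finset.sum_smul, hxx, hxu, sum_fderiv_fderiv hf hD]
  rw [fderiv_fderiv_symm hf _ x u, sum_conj_fderiv_fderiv hf]
  simp only [Finset.sum_const, Finset.card_univ, Fintype.card_fin, ← Nat.cast_smul_eq_nsmul ℝ,
    fieldB, norm_zpow_neg hx]
  match_scalars <;> field_simp <;> ring

/-- The Laplacian `Δ_x` applied to `fieldA`. -/
lemma laplaceX_fieldA {x : Vec m} (hx : x ≠ 0) (u : Vec m) :
    ∑ i, fderiv ℝ (fun z => fderiv ℝ (fun y => fieldA f y u) z (stdVec i)) x (stdVec i) =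
      (2 : ℝ) • fderiv ℝ (fun y => fieldB f y u) x u - ‖u‖ ^ 2 • fieldC f x u := by
  have hx' : ‖x‖ ≠ 0 := norm_ne_zero_iff.2 hx
  let c : Fin m → Vec m →L[ℝ] ℝ := fun i => EuclideanSpace.proj i
  have hΦ : HomogSmooth (-m) fun y => ‖y‖ ^ (-(m : ℤ)) • f (conj y u) := by
    have := ((homogField_comp_conj hf).homog u).norm_zpow_smul (-(m : ℤ))
    rwa [add_zero] at this
  have hB := (homogField_fieldB hf).homog u
  have hΘ : HomogSmooth (-m)
      fun y => innerSL ℝ u y • (‖y‖ ^ (-2 : ℤ) • ((2 : ℝ) • fieldB f y u)) := by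
    have := ((hB.const_smul 2).norm_zpow_smul (-2)).linear_smul (innerSL ℝ u)
    rwa [show 1 + (-2 + (1 - (m : ℤ))) = -m by ring] at this
  have hΨ : ∀ i, HomogSmooth (1 - m) fun y => innerSL ℝ u y • (‖y‖ ^ (-(m : ℤ)) •
      fderiv ℝ f (conj y u) (stdVec i)) := fun i => by
    have := (((homogField_comp_conj (fderiv_apply_mem hf (stdVec i))).homog u).norm_zpow_smul
      (-(m : ℤ))).linear_smul (innerSL ℝ u)
    rwa [show 1 + (-(m : ℤ) + 0) = 1 - m by ring] at this
  -- The gradient is split so that two terms have the form `y_i g(y)` with `g` homogeneous of degree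
  -- `-m`. Their divergences vanish by Euler's formula, so only the two middle terms contribute.
  have h1 : ∀ i, (fun z => fderiv ℝ (fun y => fieldA f y u) z (stdVec i)) =ᶠ[𝓝 x] fun y =>
      (2 - m : ℝ) • (c i y • (‖y‖ ^ (-(m : ℤ)) • f (conj y u)))
      - (2 : ℝ) • (innerSL ℝ u y • (‖y‖ ^ (-(m : ℤ)) • fderiv ℝ f (conj y u) (stdVec i)))
      + u i • fieldB f y u
      - c i y • (innerSL ℝ u y • (‖y‖ ^ (-2 : ℤ) • ((2 : ℝ) • fieldB f y u))) := by
    intro i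
    filter_upwards [isOpen_ne_zero.mem_nhds hx] with y hy
    have hy' : ‖y‖ ≠ 0 := norm_ne_zero_iff.2 hy
    rw [fderiv_fieldA hf hy, inner_stdVec, stdVec_inner, innerSL_apply_apply, real_inner_comm,
      show ‖y‖ ^ (-2 : ℤ) = (‖y‖ ^ 2)⁻¹ by rw [zpow_neg]; rfl]
    change _ = (2 - m : ℝ) • (y i • _) - _ + _ - y i • _
    match_scalars <;> field_simp
  have h2 : ∀ i, fderiv ℝ (fun z => fderiv ℝ (fun y => fieldA f y u) z (stdVec i)) x (stdVec i) =
      (2 - m : ℝ) • fderiv ℝ (fun y => c i y • (‖y‖ ^ (-(m : ℤ)) • f (conj y u))) x (stdVec i)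
      - (2 : ℝ) • fderiv ℝ (fun y => innerSL ℝ u y • (‖y‖ ^ (-(m : ℤ)) •
          fderiv ℝ f (conj y u) (stdVec i))) x (stdVec i)
      + u i • fderiv ℝ (fun y => fieldB f y u) x (stdVec i)
      - fderiv ℝ (fun y => c i y • (innerSL ℝ u y • (‖y‖ ^ (-2 : ℤ) •
          ((2 : ℝ) • fieldB f y u)))) x (stdVec i) := by
    intro i
    rw [(h1 i).fderiv_eq]
    have e1 := (((hΦ.linear_smul (c i)).differentiableAt hx).hasFDerivAt).const_smul (2 - m : ℝ)
    have e2 := (((hΨ i).differentiableAt hx).hasFDerivAt).const_smul (2 : ℝ)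
    have e3 := ((hB.differentiableAt hx).hasFDerivAt).const_smul (u i)
    have e4 := ((hΘ.linear_smul (c i)).differentiableAt hx).hasFDerivAt
    have e5 := ((e1.sub e2).add e3).sub e4
    refine (congrArg (fun A : Vec m →L[ℝ] Cl m => A (stdVec i)) (HasFDerivAt.fderiv e5)).trans ?_
    simp
  have h3 : ∀ i, fderiv ℝ (fun y => innerSL ℝ u y • (‖y‖ ^ (-(m : ℤ)) •
          fderiv ℝ f (conj y u) (stdVec i))) x (stdVec i) =
      ‖x‖ ^ (-(m : ℤ)) • (u i • fderiv ℝ f (conj x u) (stdVec i))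
      - (m * ‖x‖ ^ (-(m : ℤ) - 2) * inner ℝ x u) • (x i • fderiv ℝ f (conj x u) (stdVec i))
      - (2 * ‖x‖ ^ (-(m : ℤ) - 2) * inner ℝ x u * inner ℝ x u) •
        fderiv ℝ (fderiv ℝ f) (conj x u) (stdVec i) (stdVec i)
      - (2 * ‖x‖ ^ (-(m : ℤ) - 2) * inner ℝ x u) •
        (u i • fderiv ℝ (fderiv ℝ f) (conj x u) x (stdVec i))
      + (4 * ‖x‖ ^ (-(m : ℤ) - 2) * inner ℝ x u * inner ℝ x u / ‖x‖ ^ 2) •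
        (x i • fderiv ℝ (fderiv ℝ f) (conj x u) x (stdVec i)) := by
    intro i
    obtain ⟨L, hL, hLe⟩ := hasFDerivAt_norm_zpow (-(m : ℤ)) hx
    obtain ⟨Li, hLi, hLie⟩ := hasFDerivAt_comp_conj (fderiv_apply_mem hf (stdVec i)) hx u
    have h4 : HasFDerivAt (fun y => innerSL ℝ u y • (‖y‖ ^ (-(m : ℤ)) •
          fderiv ℝ f (conj y u) (stdVec i))) _ x :=
      (innerSL ℝ u).hasFDerivAt.smul (hL.smul hLi)
    rw [h4.fderiv]
    simp only [add_apply, smul_apply, ContinuousLinearMap.smulRight_apply, hLe, hLie,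
      innerSL_apply_apply, inner_stdVec, stdVec_inner, fderiv_fderiv_apply hf, norm_zpow_neg hx,
      real_inner_comm x u]
    push_cast
    match_scalars <;> field_simp <;> ring
  simp only [h2, Finset.sum_add_distrib, Finset.sum_sub_distrib, ← Finset.smul_sum,
    ← apply_eq_sum]
  have e1 := hΦ.sum_fderiv_coord_smul hx
  have e2 := hΘ.sum_fderiv_coord_smul hx
  change ∑ i, fderiv ℝ (fun y => c i y • _) x (stdVec i) = _ at e1
  change ∑ i, fderiv ℝ (fun y => c i y • _) x (stdVec i) = _ at e2
  rw [e1, e2]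
  simp only [h3, Finset.sum_add_distrib, Finset.sum_sub_distrib, ← Finset.smul_sum,
    ← apply_eq_sum, sum_fderiv_fderiv hf hD]
  rw [fderiv_fderiv_symm hf _ x u, sum_conj_fderiv_fderiv hf, fderiv_conj_apply hf,
    fderiv_fieldB_self hf hx]
  simp only [fieldA, fieldB, fieldC, norm_zpow_two_sub hx, norm_zpow_neg hx]
  push_cast
  match_scalars <;> field_simp <;> ring

end InvertedField

end HigherSpin

namespace HigherSpin

open scoped ContDiff Topology
open Filter

/-! ### The leading part of `𝓓₃` -/

section OperatorAlgebra

open Module (End)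

variable {V : Type*} [AddCommGroup V] [Module ℝ V] {m : ℕ}

/-- If `D_x F = -2 A + u G`, `⟨D_u, D_x⟩ A = (m + 2k - 2) / 2 B` and `D_x G = -2 B + u H`, then
`𝓓₃ F = 2 Δ_x A - 4 ⟨u, D_x⟩ B` modulo multiples of `u`. -/
lemma OperatorRelations.thirdOrder_apply {e y p d : Fin m → End ℝ V}
    (h : OperatorRelations e y p d) {k : ℕ} (hm : 3 ≤ m) {F A B G H : V}
    (hF : contract e d F = (-2 : ℝ) • A + contract e y G)
    (hA : contract p d A = ((m + 2 * k - 2) / 2 : ℝ) • B)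
    (hG : contract e d G = (-2 : ℝ) • B + contract e y H) :
    thirdOrder k e y p d F =
      (2 : ℝ) • contract d d A - (4 : ℝ) • contract y d B + contract e y
        (-contract d d G + (4 / (m + 2 * k) : ℝ) • contract y d (contract p d G + H)
        + (4 / ((m + 2 * k) * (m + 2 * k - 2)) : ℝ) •
            contract e y (contract p d (contract p d (contract e d F)))
        - (2 / (m + 2 * k) : ℝ) • contract p d (contract e d (contract e d F))
        - (8 / ((m + 2 * k) * (m + 2 * k - 2)) : ℝ) •
            contract y d (contract p d (contract p d F))
        - (8 / ((m + 2 * k) * (m + 2 * k - 2) * (m + 2 * k - 4)) : ℝ) •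
            contract e y (contract e y (contract p d (contract p d (contract p d F))))) := by
  have hM : (m + 2 * k : ℝ) ≠ 0 := by positivity
  have DD : ∀ x, contract e d (contract e d x) = -contract d d x := fun x =>
    congrArg (fun A : End ℝ V => A x) h.diracX_sq
  have UU : ∀ x, contract y y x = -contract e y (contract e y x) := fun x => by
    have := congrArg (fun A : End ℝ V => A x) h.vec_sq
    simp only [Module.End.mul_apply, LinearMap.neg_apply] at this
    rw [this, neg_neg]
  have TU : ∀ x, contract p d (contract e y x) =
      contract e y (contract p d x) + contract e d x := fun x =>
    congrArg (fun A : End ℝ V => A x) h.innerDuDx_mul_vec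
  have SU : ∀ x, contract y d (contract e y x) = contract e y (contract y d x) := fun x =>
    congrArg (fun A : End ℝ V => A x) h.innerUDx_mul_vec
  have LU : ∀ x, contract d d (contract e y x) = contract e y (contract d d x) := fun x =>
    congrArg (fun A : End ℝ V => A x) h.laplaceX_comm_vec
  -- Moving `⟨D_u, D_x⟩` past `u` produces `D_x G`, which contributes another `-2B`: the coefficient
  -- `m+2k-2` becomes `m+2k` and cancels the denominator in `𝓓₃`.
  have h1 : contract p d (contract e d F) =
      (-(m + 2 * k) : ℝ) • B + contract e y (contract p d G + H) := by
    rw [hF, map_add, map_smul, hA, TU, hG, map_add]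
    module
  have h2 : contract e d (contract e d (contract e d F)) =
      (2 : ℝ) • contract d d A - contract e y (contract d d G) := by
    rw [DD, hF, map_add, map_smul, LU]
    module
  simp only [thirdOrder, LinearMap.add_apply, LinearMap.sub_apply, LinearMap.smul_apply,
    Module.End.mul_apply]
  rw [h2, show contract y d (contract p d (contract e d F)) = (-(m + 2 * k) : ℝ) •
    contract y d B + contract e y (contract y d (contract p d G + H)) by
      rw [h1, map_add, map_smul, SU], UU]
  simp only [map_add, map_sub, map_neg, map_smul]
  match_scalars <;> field_simp

end OperatorAlgebra

variable {m : ℕ}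

/-! ### Smooth fields of distributions -/

/-- Distributions in `x` whose values are smooth functions of `u`. -/
def smoothFields (m : ℕ) : Submodule ℝ (Field m (Test m)) where
  carrier := {F | ∀ φ, ContDiff ℝ ∞ (F φ)}
  add_mem' hF hG φ := (hF φ).add (hG φ)
  zero_mem' _ := contDiff_const
  smul_mem' r _ hF φ := (hF φ).const_smul r

namespace smoothFields

open Module (End)

lemma differentiable (F : smoothFields m) (φ : Test m) : Differentiable ℝ (F.1 φ) :=
  (F.2 φ).differentiable (by simp)

/-- Left multiplication by `eᵢ`. -/
def mulE (i : Fin m) : End ℝ (smoothFields m) where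
  toFun F := ⟨fun φ u => vec (stdVec i) * F.1 φ u, fun φ =>
    (mulCLM m (vec (stdVec i))).contDiff.comp (F.2 φ)⟩
  map_add' F G := Subtype.ext <| by funext φ u; exact mul_add _ _ _
  map_smul' r F := Subtype.ext <| by funext φ u; exact mul_smul_comm r _ (F.1 φ u)

/-- Multiplication by `uᵢ`. -/
def mulCoord (i : Fin m) : End ℝ (smoothFields m) where
  toFun F := ⟨fun φ u => u i • F.1 φ u, fun φ => by
    have h1 : ContDiff ℝ ∞ fun u : Vec m => u i := by fun_prop
    exact h1.smul (F.2 φ)⟩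
  map_add' F G := Subtype.ext <| by funext φ u; exact smul_add _ _ _
  map_smul' r F := Subtype.ext <| by funext φ u; exact smul_comm (u i) r (F.1 φ u)

/-- The partial derivative `∂_{uᵢ}`. -/
def derivU (i : Fin m) : End ℝ (smoothFields m) where
  toFun F := ⟨partialU i F.1, fun φ =>
    ((F.2 φ).fderiv_right (m := ∞) (by simp)).clm_apply contDiff_const⟩
  map_add' F G := Subtype.ext <| by
    funext φ u
    change fderiv ℝ (F.1 φ + G.1 φ) u _ = _
    rw [fderiv_add (differentiable F φ u) (differentiable G φ u)]
    rfl
  map_smul' r F := Subtype.ext <| by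
    funext φ u
    change fderiv ℝ (r • F.1 φ) u _ = _
    rw [fderiv_const_smul (differentiable F φ u)]
    rfl

/-- The partial derivative `∂_{xᵢ}`. -/
def derivX (i : Fin m) : End ℝ (smoothFields m) where
  toFun F := ⟨distDeriv i F.1, fun φ => (F.2 _).neg⟩
  map_add' F G := Subtype.ext <| by funext φ u; exact neg_add _ _
  map_smul' r F := Subtype.ext <| by funext φ u; exact (smul_neg r (F.1 _ u)).symm

lemma coe_mulE (i : Fin m) (F : smoothFields m) (φ : Test m) (u : Vec m) :
    (mulE i F).1 φ u = vec (stdVec i) * F.1 φ u := rfl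

lemma coe_mulCoord (i : Fin m) (F : smoothFields m) (φ : Test m) (u : Vec m) :
    (mulCoord i F).1 φ u = u i • F.1 φ u := rfl

lemma coe_sum {ι : Type*} (s : Finset ι) (F : ι → smoothFields m) (φ : Test m) (u : Vec m) :
    (∑ i ∈ s, F i : smoothFields m).1 φ u = ∑ i ∈ s, (F i).1 φ u := by
  simp

lemma coe_contract (a b : Fin m → End ℝ (smoothFields m)) (F : smoothFields m) (φ : Test m)
    (u : Vec m) : (contract a b F).1 φ u = ∑ i, (a i (b i F)).1 φ u := by
  rw [contract, LinearMap.sum_apply, coe_sum]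
  rfl

lemma coe_dirac (F : smoothFields m) (φ : Test m) :
    (contract mulE derivU F).1 φ = diracU (F.1 φ) := by
  funext u; rw [coe_contract]; rfl

lemma coe_euler (F : smoothFields m) (φ : Test m) (u : Vec m) :
    (contract mulCoord derivU F).1 φ u = fderiv ℝ (F.1 φ) u u := by
  rw [coe_contract, apply_eq_sum _ u]; rfl

lemma coe_diracX (F : smoothFields m) : (contract mulE derivX F).1 = Dx distDeriv F.1 := by
  funext φ u; rw [coe_contract]; rfl

lemma coe_innerUDx (F : smoothFields m) :
    (contract mulCoord derivX F).1 = innerUDx distDeriv F.1 := by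
  funext φ u; rw [coe_contract]; rfl

lemma coe_innerDuDx (F : smoothFields m) :
    (contract derivU derivX F).1 = innerDuDx distDeriv F.1 := by
  funext φ u; rw [coe_contract]; rfl

lemma coe_mulU (F : smoothFields m) : (contract mulE mulCoord F).1 = mulU F.1 := by
  funext φ u
  rw [coe_contract, mulU, vec_eq_sum u, Finset.sum_mul]
  exact Finset.sum_congr rfl fun i _ => by
    rw [coe_mulE, coe_mulCoord, mul_smul_comm, smul_mul_assoc]

lemma coe_normSqU (F : smoothFields m) : (contract mulCoord mulCoord F).1 = normSqU F.1 := by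
  funext φ u
  rw [coe_contract, normSqU, EuclideanSpace.real_norm_sq_eq, Finset.sum_smul]
  exact Finset.sum_congr rfl fun i _ => by rw [coe_mulCoord, coe_mulCoord, smul_smul, sq]

lemma coe_thirdOrder (k : ℕ) (F : smoothFields m) :
    (thirdOrder k mulE mulCoord derivU derivX F).1 = D3 k distDeriv F.1 := by
  simp only [thirdOrder, D3, LinearMap.add_apply, LinearMap.sub_apply, LinearMap.smul_apply,
    Module.End.mul_apply, Submodule.coe_add, Submodule.coe_sub, Submodule.coe_smul, coe_diracX,
    coe_innerUDx, coe_innerDuDx, coe_mulU, coe_normSqU]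

lemma lineDeriv_comm (φ : Test m) (v w : Vec m) : ∂_{v} (∂_{w} φ) = ∂_{w} (∂_{v} φ) := by
  have h1 : ∀ v w x, (∂_{v} (∂_{w} φ)) x = fderiv ℝ (fderiv ℝ φ) x v w := by
    intro v w x
    rw [lineDeriv_test_apply, show ⇑(∂_{w} φ : Test m) = fun x => fderiv ℝ φ x w from
      funext fun x => lineDeriv_test_apply φ w x]
    have h2 : DifferentiableAt ℝ (fderiv ℝ φ) x :=
      (φ.contDiff.fderiv_right (m := 1) (WithTop.coe_le_coe.2 le_top)).differentiable (by simp) x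
    rw [(h2.hasFDerivAt.clm_apply (hasFDerivAt_const w x)).fderiv]
    simp
  ext x
  rw [h1, h1]
  exact (φ.contDiff.contDiffAt.isSymmSndFDerivAt (by
    simpa using WithTop.coe_le_coe.2 (le_top : (2 : ℕ∞) ≤ ⊤))) v w

lemma operatorRelations : OperatorRelations (mulE (m := m)) mulCoord derivU derivX where
  e_sq i := by
    ext F φ u
    change vec (stdVec i) * (vec (stdVec i) * F.1 φ u) = -F.1 φ u
    rw [vec_mul_self_mul, norm_stdVec]
    simp
  e_anti i j hij := by
    ext F φ u
    change vec (stdVec i) * (vec (stdVec j) * F.1 φ u) =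
      -(vec (stdVec j) * (vec (stdVec i) * F.1 φ u))
    rw [vec_mul_vec_mul, inner_stdVec, stdVec_apply, if_neg hij]
    simp
  p_y i j := by
    ext F φ u
    have h1 : HasFDerivAt (fun u : Vec m => u j) (EuclideanSpace.proj j : Vec m →L[ℝ] ℝ) u :=
      (EuclideanSpace.proj j : Vec m →L[ℝ] ℝ).hasFDerivAt
    have h2 := h1.smul (differentiable F φ u).hasFDerivAt
    change fderiv ℝ ((fun u : Vec m => u j) • F.1 φ) u (stdVec i) = _
    rw [h2.fderiv]
    change u j • fderiv ℝ (F.1 φ) u (stdVec i) + (stdVec i : Vec m) j • F.1 φ u = _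
    rw [stdVec_apply]
    by_cases hij : i = j
    · simp only [hij, if_true, one_smul]
      rfl
    · simp only [hij, if_false, zero_smul, add_zero]
      rfl
  y_y i j := by ext F φ u; exact smul_comm _ _ _
  p_p i j := by
    ext F φ u
    have h1 : ∀ i j, fderiv ℝ (fun u => fderiv ℝ (F.1 φ) u (stdVec j)) u (stdVec i) =
        fderiv ℝ (fderiv ℝ (F.1 φ)) u (stdVec i) (stdVec j) := by
      intro i j
      have h2 : DifferentiableAt ℝ (fderiv ℝ (F.1 φ)) u :=
        ((F.2 φ).fderiv_right (m := ∞) (by simp)).differentiable (by simp) u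
      rw [(h2.hasFDerivAt.clm_apply (hasFDerivAt_const (stdVec j) u)).fderiv]
      simp
    refine (h1 i j).trans (Eq.trans ?_ (h1 j i).symm)
    exact ((F.2 φ).contDiffAt.isSymmSndFDerivAt (by
    simpa using WithTop.coe_le_coe.2 (le_top : (2 : ℕ∞) ≤ ⊤))) _ _
  d_d i j := by
    ext F φ u
    change - -F.1 (∂_{stdVec j} (∂_{stdVec i} φ)) u = - -F.1 (∂_{stdVec i} (∂_{stdVec j} φ)) u
    rw [lineDeriv_comm]
  y_e i j := by ext F φ u; exact (mul_smul_comm _ _ _).symm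
  p_e i j := by
    ext F φ u
    have h1 := (mulCLM m (vec (stdVec j))).hasFDerivAt.comp u (differentiable F φ u).hasFDerivAt
    change fderiv ℝ ((mulCLM m (vec (stdVec j))) ∘ F.1 φ) u (stdVec i) = _
    rw [h1.fderiv]
    rfl
  d_e i j := by ext F φ u; exact (mul_neg _ _).symm
  d_y i j := by ext F φ u; exact (smul_neg _ _).symm
  d_p i j := by
    ext F φ u
    change -fderiv ℝ (F.1 _) u (stdVec j) = fderiv ℝ (fun u => -F.1 _ u) u (stdVec j)
    rw [fderiv_fun_neg]
    rfl

end smoothFields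

/-! ### Degree in `u` of fields of distributions -/

/-- Distributions in `x` whose values are homogeneous polynomials of degree `n` in `u`. -/
def polyFields (m : ℕ) (n : ℤ) : Submodule ℝ (smoothFields m) where
  carrier := {F | ∀ φ, F.1 φ ∈ polys m n}
  add_mem' hF hG φ := add_mem (hF φ) (hG φ)
  zero_mem' := fun _ => zero_mem _
  smul_mem' r _ hF φ := real_smul_mem r (hF φ)

namespace polyFields

open smoothFields Module

variable {n : ℤ} {F : smoothFields m}

lemma contract_mem {a b : Fin m → End ℝ (smoothFields m)} (h : ∀ i, a i (b i F) ∈ polyFields m n) :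
    contract a b F ∈ polyFields m n := by
  rw [contract, LinearMap.sum_apply]
  exact sum_mem fun i _ => h i

variable (hF : F ∈ polyFields m n)
include hF

lemma mulE_mem (i : Fin m) : mulE i F ∈ polyFields m n := fun φ => const_mul_mem _ (hF φ)

lemma mulCoord_mem (i : Fin m) : mulCoord i F ∈ polyFields m (n + 1) :=
  fun φ => coord_smul_mem (hF φ) i

lemma derivU_mem (i : Fin m) : derivU i F ∈ polyFields m (n - 1) :=
  fun φ => fderiv_apply_mem (hF φ) _

lemma derivX_mem (i : Fin m) : derivX i F ∈ polyFields m n :=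
  fun _ => neg_mem (hF _)

lemma diracX_mem : contract mulE derivX F ∈ polyFields m n :=
  contract_mem fun i => mulE_mem (derivX_mem hF i) i

lemma laplaceX_mem : contract derivX derivX F ∈ polyFields m n :=
  contract_mem fun i => derivX_mem (derivX_mem hF i) i

lemma innerUDx_mem : contract mulCoord derivX F ∈ polyFields m (n + 1) :=
  contract_mem fun i => mulCoord_mem (derivX_mem hF i) i

lemma innerDuDx_mem : contract derivU derivX F ∈ polyFields m (n - 1) :=
  contract_mem fun i => derivU_mem (derivX_mem hF i) i

lemma mulU_mem : contract mulE mulCoord F ∈ polyFields m (n + 1) :=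
  contract_mem fun i => mulE_mem (mulCoord_mem hF i) i

lemma normSqU_mem : contract mulCoord mulCoord F ∈ polyFields m (n + 2) := by
  rw [show n + 2 = n + 1 + 1 by ring]
  exact contract_mem fun i => mulCoord_mem (mulCoord_mem hF i) i

lemma cast_mem {n' : ℤ} (h : n = n') : F ∈ polyFields m n' := h ▸ hF

/-- In every term the powers of `u` are balanced by derivatives in `u`. -/
lemma thirdOrder_mem (k : ℕ) :
    thirdOrder k mulE mulCoord derivU derivX F ∈ polyFields m n := by
  have hT := innerDuDx_mem hF
  have hD := diracX_mem hF
  simp only [thirdOrder, LinearMap.add_apply, LinearMap.sub_apply, LinearMap.smul_apply,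
    Module.End.mul_apply]
  refine sub_mem (sub_mem (sub_mem (sub_mem (add_mem ?_ (Submodule.smul_mem _ _ ?_))
    (Submodule.smul_mem _ _ ?_)) (Submodule.smul_mem _ _ ?_)) (Submodule.smul_mem _ _ ?_))
    (Submodule.smul_mem _ _ ?_)
  · exact diracX_mem (diracX_mem hD)
  · exact cast_mem (innerUDx_mem (innerDuDx_mem hD)) (by ring)
  · exact cast_mem (normSqU_mem (innerDuDx_mem (innerDuDx_mem hD))) (by ring)
  · exact cast_mem (mulU_mem (innerDuDx_mem (diracX_mem hD))) (by ring)
  · exact cast_mem (mulU_mem (innerUDx_mem (innerDuDx_mem hT))) (by ring)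
  · exact cast_mem (mulU_mem (mulU_mem (mulU_mem (innerDuDx_mem (innerDuDx_mem hT))))) (by ring)

end polyFields

end HigherSpin

namespace HigherSpin

open scoped ContDiff Topology
open Filter

variable {m : ℕ}

/-! ### Polynomials divisible by `u` -/

lemma diracU_mem {n : ℤ} {p : Vec m → Cl m} (hp : p ∈ polys m n) : diracU p ∈ polys m (n - 1) :=
  sum_mem_polys fun _ _ => const_mul_mem _ (fderiv_apply_mem hp _)

/-- The computation of `D_x(xG)` applied in the variable `u`; only Euler's formula at the point is
needed. -/
lemma diracU_vec_mul {n : ℤ} {p : Vec m → Cl m} (hp : p ∈ polys m n) (u : Vec m) :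
    diracU (fun u => vec u * p u) u = -(m + 2 * n : ℝ) • p u - vec u * diracU p u :=
  sum_stdVec_mul_fderiv_vec_mul (polys_differentiable hp u) (fderiv_apply_self hp u)

lemma diracU_smul {n : ℤ} {p : Vec m → Cl m} (hp : p ∈ polys m n) (r : ℝ) (u : Vec m) :
    diracU (fun u => r • p u) u = r • diracU p u := by
  simp only [diracU, Finset.smul_sum]
  refine Finset.sum_congr rfl fun i _ => ?_
  rw [fderiv_fun_const_smul (polys_differentiable hp u)]
  simp

/-- An eigenvector equation for `-u D_u` without solutions. -/
lemma eq_zero_of_smul_eq_neg_vec_mul_diracU (hm : 0 < m) {n : ℤ} {r : Vec m → Cl m}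
    (hr : r ∈ polys m n) {c : ℝ} (hc : 2 * n + m ≤ c)
    (h : ∀ u, c • r u = -(vec u * diracU r u)) : r = 0 := by
  induction hN : (n + 1).toNat using Nat.strong_induction_on generalizing n c r with
  | _ N ih =>
    subst hN
    rcases lt_or_ge n 0 with hn | hn
    · obtain ⟨j, rfl⟩ := Int.exists_eq_neg_ofNat hn.le
      obtain ⟨j, rfl⟩ := Nat.exists_eq_succ_of_ne_zero (n := j) (by rintro rfl; simp at hn)
      exact (Submodule.mem_bot ℂ).1 hr
    have hn' : (0 : ℝ) ≤ n := by exact_mod_cast hn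
    have hm' : (0 : ℝ) < m := by exact_mod_cast hm
    -- Applying `D_u` to `c r = -u D_u r` gives `c' D_u r = u D_u² r`. The bound on `c` makes `c' ≥
    -- 2`, so `D_u r` is itself divisible by `u`.
    set c' : ℝ := c - 2 * n + 2 - m with hc'
    have hc0 : 0 < c' := by linarith
    have hP := diracU_mem hr
    have hPP := diracU_mem hP
    have h1 : ∀ u, c' • diracU r u = vec u * diracU (diracU r) u := by
      intro u
      have h2 := diracU_smul hr c u
      rw [show (fun u => c • r u) = fun u => (-1 : ℝ) • (vec u * diracU r u) by
        funext u; rw [h u, neg_one_smul], diracU_smul (vec_mul_mem hP), diracU_vec_mul hP] at h2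
      push_cast at h2
      rw [hc', show c - 2 * n + 2 - m = c + (-1) * (m + 2 * (n - 1)) by ring, add_smul, ← h2]
      module
    have hr2 : (fun u => c'⁻¹ • diracU (diracU r) u) ∈ polys m (n - 1 - 1) :=
      real_smul_mem _ hPP
    have h3 : diracU r = fun u => vec u * (c'⁻¹ • diracU (diracU r) u) := by
      funext u
      rw [mul_smul_comm, ← h1, smul_smul, inv_mul_cancel₀ hc0.ne', one_smul]
    -- The quotient `r₂ = D_u² r / c'` satisfies the same equation with degree `n - 2` and constant
    -- `c - 2`. The lower bound on the constant persists, and the descent stops in negative degree.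
    have h4 := ih (n - 1 - 1 + 1).toNat (by omega) hr2 (c := c - 2) (by push_cast; linarith)
      (fun u => by
        have h5 := diracU_vec_mul hr2 u
        rw [← h3] at h5
        have h6 : diracU (diracU r) u = c' • (c'⁻¹ • diracU (diracU r) u) := by
          rw [smul_smul, mul_inv_cancel₀ hc0.ne', one_smul]
        push_cast at h5
        have h7 := h6.symm.trans h5
        rw [hc'] at h7
        linear_combination (norm := module) (1 : ℝ) • h7) rfl
    have h7 : diracU r = 0 := by
      rw [h3]
      funext u
      rw [congrFun h4 u]
      simp
    funext u
    have h8 := h u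
    rw [h7] at h8
    simp only [Pi.zero_apply, mul_zero, neg_zero] at h8
    exact (smul_eq_zero.1 h8).resolve_left (by linarith)

/-- The homogeneous polynomials of degree `n` of the form `u q(u)`. -/
def vecMulPolys (m : ℕ) (n : ℤ) : Submodule ℝ (Vec m → Cl m) :=
  ((polys m (n - 1)).restrictScalars ℝ).map
    (LinearMap.pi fun u => LinearMap.mulLeft ℝ (vec u) ∘ₗ LinearMap.proj u)

lemma vec_mul_mem_vecMulPolys {n : ℤ} {q : Vec m → Cl m} (hq : q ∈ polys m (n - 1)) :
    (fun u => vec u * q u) ∈ vecMulPolys m n := ⟨q, hq, rfl⟩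

lemma exists_of_mem_vecMulPolys {n : ℤ} {p : Vec m → Cl m} (hp : p ∈ vecMulPolys m n) :
    ∃ q ∈ polys m (n - 1), p = fun u => vec u * q u := by
  obtain ⟨q, hq, rfl⟩ := hp
  exact ⟨q, hq, rfl⟩

/-- Finite dimension gives closedness, so congruences modulo `u` survive the limit in which the
cutoff is removed. -/
lemma isClosed_vecMulPolys (n : ℤ) : IsClosed (vecMulPolys m n : Set (Vec m → Cl m)) := by
  have h1 : FiniteDimensional ℝ (polys m (n - 1)) := FiniteDimensional.complexToReal _
  have h2 : FiniteDimensional ℝ ((polys m (n - 1)).restrictScalars ℝ) := h1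
  have h3 : FiniteDimensional ℝ (vecMulPolys m n) := by
    unfold vecMulPolys; infer_instance
  exact Submodule.closed_of_finiteDimensional _

/-- A homogeneous monogenic polynomial that is divisible by `u` vanishes. -/
lemma eq_zero_of_mem_vecMulPolys (hm : 0 < m) {n : ℤ} {p : Vec m → Cl m}
    (hp : p ∈ vecMulPolys m n) (hD : ∀ u, diracU p u = 0) : p = 0 := by
  obtain ⟨q, hq, rfl⟩ := exists_of_mem_vecMulPolys hp
  -- For `p = u q` the equation `D_u p = 0` is the eigenvector equation for `q`, of degree `n - 1`,
  -- with the smallest admissible constant.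
  have h1 := eq_zero_of_smul_eq_neg_vec_mul_diracU hm hq (c := m + 2 * (n - 1))
    (by push_cast; linarith) fun u => by
      have h2 := diracU_vec_mul hq u
      rw [hD u] at h2
      push_cast at h2
      rw [← sub_eq_zero, sub_neg_eq_add, ← neg_eq_zero, h2]
      module
  rw [h1]
  funext u
  simp

lemma coord_smul_mem_vecMulPolys {n : ℤ} {p : Vec m → Cl m} (hp : p ∈ vecMulPolys m (n - 1))
    (i : Fin m) : (fun u => u i • p u) ∈ vecMulPolys m n := by
  obtain ⟨q, hq, rfl⟩ := exists_of_mem_vecMulPolys hp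
  have h1 := coord_smul_mem hq i
  rw [sub_add_cancel] at h1
  convert vec_mul_mem_vecMulPolys h1 using 2
  rw [mul_smul_comm]

end HigherSpin

namespace HigherSpin

open scoped ContDiff Topology
open Filter

variable {m : ℕ}

/-! ### Averages over an annulus -/

/-- Euler's formula for `f` at the reflected point: the `u` part of that point gives the derivatives
`∂_i f`, the `x` part gives `fieldB`. It drives the induction on the degree in `integral_fieldA`. -/
lemma euler_fieldA {k : ℤ} {f : Vec m → Cl m} (hf : f ∈ polys m k) {x : Vec m}
    (hx : x ≠ 0) (u : Vec m) :
    (k : ℝ) • fieldA f x u =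
      ∑ i, u i • fieldA (fun w => fderiv ℝ f w (stdVec i)) x u
        + (inner ℝ x u : ℝ) • fieldB f x u := by
  have hx' : ‖x‖ ≠ 0 := norm_ne_zero_iff.2 hx
  have h1 : ∑ i, u i • fieldA (fun w => fderiv ℝ f w (stdVec i)) x u =
      ‖x‖ ^ (2 - (m : ℤ)) • fderiv ℝ f (conj x u) u := by
    simp only [fieldA, smul_comm (_ : ℝ) (‖x‖ ^ (2 - (m : ℤ)))]
    rw [← Finset.smul_sum, ← apply_eq_sum]
  have h2 := fderiv_apply_self hf (conj x u)
  rw [h1, fieldA, fieldB, smul_comm, ← h2]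
  nth_rewrite 2 [conj]
  rw [map_sub, map_smul, norm_zpow_two_sub hx, norm_zpow_neg hx]
  match_scalars <;> field_simp

/-- The radial weight `‖x‖² κ(x)`, where `∇ cutoff = κ(x) x`. -/
def sqCutoffWeight (x : Vec m) : ℝ := ‖x‖ ^ 2 * cutoffWeight x

lemma annular_sqCutoffWeight : Annular (sqCutoffWeight : Vec m → ℝ) :=
  annular_cutoffWeight.mul_left (contDiff_norm_sq ℝ)

/-- The gradient of a radial function is parallel to `x`. -/
lemma fderiv_sqCutoffWeight (x v : Vec m) :
    ‖x‖ ^ 2 * fderiv ℝ sqCutoffWeight x v = inner ℝ x v * fderiv ℝ sqCutoffWeight x x := by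
  let h : ℝ → ℝ := fun r => r * (2 * deriv Real.smoothTransition (r - 1))
  have h0 : Differentiable ℝ (deriv Real.smoothTransition) :=
    (Real.smoothTransition.contDiff (n := 2)).differentiable_deriv_two
  have h1 : DifferentiableAt ℝ h (‖x‖ ^ 2) := by fun_prop
  have h2 : HasFDerivAt (fun x : Vec m => ‖x‖ ^ 2) (2 • innerSL ℝ x) x :=
    (hasStrictFDerivAt_norm_sq x).hasFDerivAt
  have h3 : (sqCutoffWeight : Vec m → ℝ) = h ∘ fun x => ‖x‖ ^ 2 := rfl
  rw [h3, (h1.hasDerivAt.comp_hasFDerivAt x h2).fderiv]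
  simp
  ring

variable [NeZero m]

omit [NeZero m] in
lemma Annular.integrable_homogField {η : Vec m → ℝ} (hη : Annular η) {d e : ℤ}
    {G : Vec m → Vec m → Cl m} (hG : HomogField d e G) (u : Vec m) :
    Integrable fun x => η x • G x u :=
  hη.integrable_smul (hG.homog u).continuousOn

lemma integral_vec_mul_mem_vecMulPolys {n : ℤ} {W : Vec m → ℝ} {G : Vec m → Vec m → Cl m}
    (hG : ∀ x, x ≠ 0 → G x ∈ polys m (n - 1)) (hW : ∀ u, Integrable fun x => W x • G x u) :
    (fun u => ∫ x, W x • (vec u * G x u)) ∈ vecMulPolys m n := by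
  convert vec_mul_mem_vecMulPolys (integral_polys hG hW).1 using 2 with u
  simp only [← mul_smul_comm]
  exact integral_const_mul_cl (vec u) (hW u)

/-- Integration by parts puts the derivative on the radial weight. This leaves a total radial
derivative against `⟨x, u⟩‖x‖⁻² B`, of degree `-m`, and such integrals vanish. -/
lemma integral_sqCutoffWeight_smul {k : ℤ} {f : Vec m → Cl m} (hf : f ∈ polys m k) (u : Vec m) :
    ∫ x, sqCutoffWeight x • fderiv ℝ (fun y => fieldB f y u) x u = 0 := by
  have hB := homogField_fieldB hf
  rw [annular_sqCutoffWeight.integral_smul_fderiv (hB.homog u), neg_eq_zero]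
  have h1 := (hB.inner_smul.norm_zpow_smul (-2)).homog u
  rw [show -2 + (1 + (1 - (m : ℤ))) = -m by ring] at h1
  rw [← annular_sqCutoffWeight.integral_radial_smul h1]
  refine integral_congr_ae (ae_ne_zero.mono fun x hx => ?_)
  have hx' : ‖x‖ ≠ 0 := norm_ne_zero_iff.2 hx
  simp only [smul_smul]
  congr 1
  rw [zpow_neg, show ((2 : ℤ)) = ((2 : ℕ) : ℤ) from rfl, zpow_natCast]
  field_simp
  rw [mul_comm, fderiv_sqCutoffWeight, mul_comm]

/-- The average of `⟨x, u⟩ fieldB` in terms of the average of `fieldA`. -/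
lemma integral_inner_smul_fieldB {k : ℤ} {f : Vec m → Cl m} (hf : f ∈ polys m k) :
    (fun u => (4 - m - 2 * k : ℝ) • (∫ x, cutoffWeight x • ((inner ℝ x u : ℝ) • fieldB f x u)) -
      (2 * k : ℝ) • ∫ x, cutoffWeight x • fieldA f x u) ∈ vecMulPolys m k := by
  have hA := homogField_fieldA hf
  have hB := homogField_fieldB hf
  have hC := (homogField_fieldC hf).mulU
  -- `⟨u, D_x⟩B` has average zero, so in its expansion the terms in `A` and `⟨x, u⟩B` balance the
  -- average of `‖u‖²C = -u(uC)`, which is divisible by `u`. The weight `‖x‖²κ` clears the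
  -- denominators.
  have h1 : (fun u => ∫ x, sqCutoffWeight x • (vec u * (vec u * fieldC f x u))) ∈
      vecMulPolys m k := by
    refine integral_vec_mul_mem_vecMulPolys (fun x hx => ?_)
      (annular_sqCutoffWeight.integrable_homogField hC)
    have := hC.poly x hx
    rwa [show k - 2 + 1 = k - 1 by ring] at this
  convert h1 using 2 with u
  have h2 := annular_sqCutoffWeight.integrable_homogField hC.mulU u
  have h3 := annular_cutoffWeight.integrable_homogField hB.inner_smul u
  have h4 := annular_cutoffWeight.integrable_homogField hA u
  have h5 : Integrable fun x => (4 - m - 2 * k : ℝ) •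
    (cutoffWeight x • ((inner ℝ x u : ℝ) • fieldB f x u)) := h3.smul _
  have h6 : Integrable fun x => (2 * k : ℝ) • (cutoffWeight x • fieldA f x u) := h4.smul _
  have h7 : Integrable fun x => (4 - m - 2 * k : ℝ) •
    (cutoffWeight x • ((inner ℝ x u : ℝ) • fieldB f x u)) -
      (2 * k : ℝ) • (cutoffWeight x • fieldA f x u) := h5.sub h6
  rw [← sub_eq_zero, ← integral_smul, ← integral_smul, ← integral_sub h5 h6,
    ← integral_sub h7 h2, ← integral_sqCutoffWeight_smul hf u]
  refine integral_congr_ae (ae_ne_zero.mono fun x hx => ?_)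
  have hx' : ‖x‖ ≠ 0 := norm_ne_zero_iff.2 hx
  simp only [fderiv_fieldB_self hf hx, sqCutoffWeight, vec_mul_self_mul]
  match_scalars <;> field_simp

/-- The average of `‖x‖^{2-m}`. -/
def avgConst (m : ℕ) : ℝ := ∫ x : Vec m, cutoffWeight x * ‖x‖ ^ (2 - (m : ℤ))

lemma avgConst_pos : 0 < avgConst m := by
  have h1 : ContinuousOn (fun x : Vec m => ‖x‖ ^ (2 - (m : ℤ))) {0}ᶜ := fun x hx =>
    (contDiffAt_norm_zpow _ hx).continuousAt.continuousWithinAt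
  obtain ⟨x, hx⟩ := exists_cutoffWeight_ne_zero (m := m)
  refine (annular_cutoffWeight.continuous_smul h1).integral_pos_of_hasCompactSupport_nonneg_nonzero
    annular_cutoffWeight.compact.smul_right
    (fun x => mul_nonneg (cutoffWeight_nonneg x) (by positivity)) (x := x) ?_
  refine mul_ne_zero hx (zpow_ne_zero _ (norm_ne_zero_iff.2 ?_))
  rintro rfl
  exact annular_cutoffWeight.zero (subset_tsupport _ hx)

/-- Induction on the degree. Euler's formula relates the averages of `A` and `⟨x, u⟩B` to averages
for the derivatives `∂_i f`, known by induction. `integral_inner_smul_fieldB` gives a second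
relation modulo `u`, and the two determine the average of `A`. -/
lemma integral_fieldA (hm : 3 ≤ m) (k : ℕ) {f : Vec m → Cl m} (hf : f ∈ polys m k)
    (hD : ∀ u, diracU f u = 0) :
    (fun u => ∫ x, cutoffWeight x • fieldA f x u) -
      (avgConst m * (m - 2) / (m + 2 * k - 2) : ℝ) • f ∈ vecMulPolys m k := by
  have hm' : (3 : ℝ) ≤ m := by exact_mod_cast hm
  induction k generalizing f with
  | zero =>
    have h1 : ∀ u, f u = f 0 := fun u => by
      have := polys_smul hf 0 u
      simpa using this.symm
    have h2 : (fun u => ∫ x, cutoffWeight x • fieldA f x u) =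
        (avgConst m * (m - 2) / (m + 2 * (0 : ℕ) - 2) : ℝ) • f := by
      funext u
      rw [Pi.smul_apply, Nat.cast_zero, mul_zero, add_zero, mul_div_cancel_right₀ _ (by linarith)]
      simp only [fieldA, h1 (conj _ u), h1 u, smul_smul]
      rw [integral_smul_const]
      rfl
    rw [h2, sub_self]
    exact zero_mem _
  | succ k ih =>
    have hk : (0 : ℝ) ≤ k := Nat.cast_nonneg k
    have hfi : ∀ i, (fun u => fderiv ℝ f u (stdVec i)) ∈ polys m k := fun i => by
      have := fderiv_apply_mem hf (stdVec i)
      rwa [Nat.cast_succ, add_sub_cancel_right] at this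
    have hDi : ∀ i u, diracU (fun u => fderiv ℝ f u (stdVec i)) u = 0 := fun i u => by
      simpa only [diracU, fderiv_fderiv_apply hf] using sum_stdVec_mul_fderiv_fderiv hf hD u _
    set I₁ : Vec m → Cl m := fun u =>
      ∫ x, cutoffWeight x • ((inner ℝ x u : ℝ) • fieldB f x u) with hI₁
    set I₂ : Vec m → Cl m := fun u => ∫ x, cutoffWeight x • fieldA f x u with hI₂
    set l : ℝ := avgConst m * (m - 2) / (m + 2 * k - 2) with hl
    have h1 : (k + 1 : ℝ) • I₂ - I₁ - (l * (k + 1)) • f ∈ vecMulPolys m (k + 1 : ℕ) := by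
      have h2 : (∑ i, fun u : Vec m => u i •
          ((fun u => ∫ x, cutoffWeight x • fieldA (fun w => fderiv ℝ f w (stdVec i)) x u) -
            l • fun u => fderiv ℝ f u (stdVec i)) u) ∈ vecMulPolys m (k + 1 : ℕ) :=
        sum_mem fun i _ => coord_smul_mem_vecMulPolys
          (by rw [Nat.cast_succ, add_sub_cancel_right]; exact ih (hfi i) (hDi i)) i
      convert h2 using 1
      funext u
      have h3 : (k + 1 : ℝ) • I₂ u = ∑ i, u i •
          (∫ x, cutoffWeight x • fieldA (fun w => fderiv ℝ f w (stdVec i)) x u) + I₁ u := by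
        have h4 : ∀ i, Integrable fun x => u i •
            (cutoffWeight x • fieldA (fun w => fderiv ℝ f w (stdVec i)) x u) := fun i =>
          (annular_cutoffWeight.integrable_homogField (homogField_fieldA (hfi i)) u).smul _
        have h5 := annular_cutoffWeight.integrable_homogField (homogField_fieldB hf).inner_smul u
        simp only [hI₁, hI₂, ← integral_smul]
        rw [← integral_finsetSum _ fun i _ => h4 i, ← integral_add (integrable_finsetSum _
          fun i _ => h4 i) h5]
        refine integral_congr_ae (ae_ne_zero.mono fun x hx => ?_)
        have h6 := euler_fieldA hf hx u
        push_cast at h6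
        simp only [smul_comm _ (cutoffWeight x)]
        rw [h6, smul_add, Finset.smul_sum]
      have h7 : ∑ i, u i • fderiv ℝ f u (stdVec i) = (k + 1 : ℝ) • f u := by
        rw [← apply_eq_sum, fderiv_apply_self hf]
        push_cast
        rfl
      simp only [Finset.sum_apply, Pi.sub_apply, Pi.smul_apply, h3, smul_sub,
        Finset.sum_sub_distrib, smul_comm _ l]
      rw [← Finset.smul_sum, h7]
      module
    have h2 : (4 - m - 2 * (k + 1) : ℝ) • I₁ - (2 * (k + 1) : ℝ) • I₂ ∈
        vecMulPolys m (k + 1 : ℕ) := by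
      have := integral_inner_smul_fieldB hf
      push_cast at this ⊢
      exact this
    have h3 : (m + 2 * k - 2 : ℝ) ≠ 0 := by linarith
    have h4 : (m + 2 * k : ℝ) ≠ 0 := by linarith
    have h5 : (k + 1 : ℝ) ≠ 0 := by linarith
    have h6 : (m + 2 * (k + 1) - 2 : ℝ) ≠ 0 := by linarith
    -- Subtracting `h2 / (m+2k-2)` eliminates `I₁`. The coefficient of `I₂` is then
    -- `(k+1)(m+2k)/(m+2k-2)`, whose inverse is the prefactor.
    have h8 := Submodule.smul_mem _ ((m + 2 * k - 2) / ((k + 1) * (m + 2 * k)) : ℝ)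
      (sub_mem h1 (Submodule.smul_mem _ ((m + 2 * k - 2 : ℝ)⁻¹) h2))
    convert h8 using 1
    rw [hl]
    push_cast
    match_scalars <;> field_simp <;> ring

/-! ### The mass at the origin -/

/-- The factor in front of the Dirac distribution. -/
def diracConst (m k : ℕ) : ℝ :=
  if k = 0 then 2 * (2 - m) * avgConst m
  else -(2 * (m - 2) * (m - 4) * avgConst m) / (m + 2 * k - 4)

/-- For `k ≥ 1` the only factor that can vanish is `m - 4`, which the hypothesis excludes. The case
`k = 0` is separate because the general formula is `0/0` at `m = 4`. -/
lemma diracConst_ne_zero (hm : 3 ≤ m) {k : ℕ} (hmk : m = 4 → k = 0) : diracConst m k ≠ 0 := by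
  have hm' : (3 : ℝ) ≤ m := by exact_mod_cast hm
  have h1 := (avgConst_pos (m := m)).ne'
  have h2 : (m - 2 : ℝ) ≠ 0 := by linarith
  rw [diracConst]
  split_ifs with hk
  · exact mul_ne_zero (mul_ne_zero two_ne_zero (by linarith)) h1
  · have hk' : (1 : ℝ) ≤ k := by exact_mod_cast Nat.one_le_iff_ne_zero.2 hk
    have h4 : (m - 4 : ℝ) ≠ 0 := fun h => hk (hmk (by exact_mod_cast sub_eq_zero.1 h))
    exact div_ne_zero (neg_ne_zero.2 (mul_ne_zero (mul_ne_zero (mul_ne_zero two_ne_zero h2) h4) h1))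
      (by linarith)

/-- Combines the two averaging relations. For `k ≥ 1` the average of `⟨x, u⟩B` is `-2k/(m+2k-4)`
times that of `A` modulo `u`; for `k = 0` the field `B` vanishes. -/
lemma integral_fieldA_fieldB (hm : 3 ≤ m) {k : ℕ} {f : Vec m → Cl m} (hf : f ∈ polys m k)
    (hD : ∀ u, diracU f u = 0) :
    (fun u => ∫ x, cutoffWeight x • ((2 * (2 - m) : ℝ) • fieldA f x u -
      (4 : ℝ) • ((inner ℝ x u : ℝ) • fieldB f x u))) - diracConst m k • f ∈ vecMulPolys m k := by
  have hm' : (3 : ℝ) ≤ m := by exact_mod_cast hm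
  have hI := integral_fieldA hm k hf hD
  have hJ := integral_inner_smul_fieldB hf
  set I₁ : Vec m → Cl m := fun u =>
    ∫ x, cutoffWeight x • ((inner ℝ x u : ℝ) • fieldB f x u) with hI₁
  set I₂ : Vec m → Cl m := fun u => ∫ x, cutoffWeight x • fieldA f x u with hI₂
  have h1 : (fun u => ∫ x, cutoffWeight x • ((2 * (2 - m) : ℝ) • fieldA f x u -
      (4 : ℝ) • ((inner ℝ x u : ℝ) • fieldB f x u))) =
      (2 * (2 - m) : ℝ) • I₂ - (4 : ℝ) • I₁ := by
    funext u
    have h3 := annular_cutoffWeight.integrable_homogField (homogField_fieldB hf).inner_smul u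
    have h4 := annular_cutoffWeight.integrable_homogField (homogField_fieldA hf) u
    simp only [smul_sub, smul_comm (cutoffWeight _) (_ : ℝ) (fieldA f _ u),
      smul_comm (cutoffWeight _) (4 : ℝ)]
    have h5 : Integrable fun x => (4 : ℝ) •
      (cutoffWeight x • ((inner ℝ x u : ℝ) • fieldB f x u)) := h3.smul _
    have h6 : Integrable fun x => (2 * (2 - m) : ℝ) • (cutoffWeight x • fieldA f x u) :=
      h4.smul _
    rw [integral_sub h6 h5, integral_smul, integral_smul]
    rfl
  rw [h1, diracConst]
  split_ifs with hk
  · subst hk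
    have h2 : I₁ = 0 := by
      funext u
      refine integral_eq_zero_of_ae (ae_ne_zero.mono fun x hx => ?_)
      have := (homogField_fieldB hf).poly x hx
      have h5 : fieldB f x = 0 := (Submodule.mem_bot ℂ).1 this
      simp [h5]
    have h3 := Submodule.smul_mem _ (2 * (2 - m) : ℝ) hI
    convert h3 using 1
    have h6 : (m - 2 : ℝ) ≠ 0 := by linarith
    rw [h2, Nat.cast_zero, mul_zero, add_zero, mul_div_cancel_right₀ _ h6]
    module
  · have hk' : (1 : ℝ) ≤ k := by exact_mod_cast Nat.one_le_iff_ne_zero.2 hk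
    have h4 : (m + 2 * k - 4 : ℝ) ≠ 0 := by linarith
    have h5 : (m + 2 * k - 2 : ℝ) ≠ 0 := by linarith
    have h3 : (4 - m - 2 * k : ℝ) • I₁ - (2 * k : ℝ) • I₂ ∈ vecMulPolys m k := by
      push_cast at hJ
      exact hJ
    -- The multiple `4/(m+2k-4)` of `h3` reproduces `-4 I₁`. What remains is a multiple of `I₂`,
    -- with coefficient `2(2-m) + 8k/(m+2k-4) = -2(m-4)(m+2k-2)/(m+2k-4)`.
    have h6 := add_mem (Submodule.smul_mem _
      (-(2 * (m - 4) * (m + 2 * k - 2)) / (m + 2 * k - 4) : ℝ) hI)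
      (Submodule.smul_mem _ (4 / (m + 2 * k - 4) : ℝ) h3)
    convert h6 using 1
    match_scalars <;> field_simp <;> ring

end HigherSpin

namespace HigherSpin

open scoped ContDiff Topology
open Filter

variable {m : ℕ}

/-! ### The fundamental solution up to normalization -/

lemma diracU_sub {n : ℤ} {p q : Vec m → Cl m} (hp : p ∈ polys m n) (hq : q ∈ polys m n)
    (u : Vec m) : diracU (p - q) u = diracU p u - diracU q u := by
  simp only [diracU, ← Finset.sum_sub_distrib, ← mul_sub]
  refine Finset.sum_congr rfl fun i _ => ?_
  rw [fderiv_sub (polys_differentiable hp u) (polys_differentiable hq u)]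
  rfl

section Monogenic

variable {f : Vec m → Cl m} {k : ℤ} (hf : f ∈ polys m k) (hD : ∀ u, diracU f u = 0)
include hf hD

/-- The reflection covariance of the Dirac operator: for monogenic `f`, `u ↦ x f(xux/‖x‖²)` is again
monogenic. Moving `e_i` past `x` leaves `-2∂_x f`, which cancels against the derivative of the
reflection. -/
lemma diracU_vec_mul_fieldA {x : Vec m} (hx : x ≠ 0) (u : Vec m) :
    diracU (fun u => vec x * fieldA f x u) u = 0 := by
  have hx' : ‖x‖ ≠ 0 := norm_ne_zero_iff.2 hx
  obtain ⟨L, hL, hLe⟩ := hasFDerivAt_comp_conjU hf x u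
  have h1 : HasFDerivAt (fun u => vec x * fieldA f x u)
      ((mulCLM m (vec x)).comp (‖x‖ ^ (2 - (m : ℤ)) • L)) u :=
    (mulCLM m (vec x)).hasFDerivAt.comp u (hL.const_smul (‖x‖ ^ (2 - (m : ℤ))))
  set F := fderiv ℝ f (conj x u)
  have h2 : ∀ i, vec (stdVec i) * fderiv ℝ (fun u => vec x * fieldA f x u) u (stdVec i) =
      ‖x‖ ^ (2 - (m : ℤ)) • (-(vec x * (vec (stdVec i) * F (stdVec i)))
        - (2 : ℝ) • (x i • F (stdVec i))
        - (2 / ‖x‖ ^ 2) • (x i • (vec (stdVec i) * (vec x * F x)))) := by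
    intro i
    rw [h1.fderiv]
    simp only [ContinuousLinearMap.comp_apply, smul_apply, mulCLM_apply, hLe, inner_stdVec,
      mul_smul_comm, mul_sub]
    rw [vec_mul_vec_mul (stdVec i) x (F (stdVec i)), stdVec_inner]
    match_scalars <;> ring
  have h3 := hD (conj x u)
  simp only [diracU] at h3
  rw [diracU]
  simp only [h2, ← Finset.smul_sum, Finset.sum_sub_distrib, Finset.sum_neg_distrib,
    ← Finset.mul_sum, h3, ← apply_eq_sum, sum_coord_smul_vec, F]
  rw [vec_mul_self_mul, mul_zero, smul_smul, show 2 / ‖x‖ ^ 2 * -‖x‖ ^ 2 = -2 by field_simp]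
  module

end Monogenic

/-- The vector field whose distributional divergence is the leading part of `𝓓₃`. -/
def fluxField (f : Vec m → Cl m) (i : Fin m) (x u : Vec m) : Cl m :=
  (2 : ℝ) • fderiv ℝ (fun y => fieldA f y u) x (stdVec i) + (-4 : ℝ) • (u i • fieldB f x u)

section Monogenic

variable {f : Vec m → Cl m} {k : ℤ} (hf : f ∈ polys m k)
include hf

lemma homogField_fluxField (i : Fin m) : HomogField (1 - m) k (fluxField f i) := by
  have h1 := ((homogField_fieldA hf).fderivX (stdVec i)).const_smul 2
  have h2 := ((homogField_fieldB hf).coord_smul i).const_smul (-4)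
  rw [show 2 - (m : ℤ) - 1 = 1 - m by ring] at h1
  rw [sub_add_cancel] at h2
  exact h1.add h2

/-- The radial component, which is the density of the point mass because the gradient of the cutoff
is radial. Euler's formula in degree `2 - m` evaluates the gradient term. -/
lemma sum_coord_smul_fluxField {x : Vec m} (hx : x ≠ 0) (u : Vec m) :
    ∑ i, x i • fluxField f i x u =
      (2 * (2 - m) : ℝ) • fieldA f x u - (4 : ℝ) • ((inner ℝ x u : ℝ) • fieldB f x u) := by
  have h1 : ∑ i, u i * x i = inner ℝ x u := by simp [PiLp.inner_apply]
  simp only [fluxField, smul_add, smul_comm (_ : ℝ) (2 : ℝ), smul_comm (_ : ℝ) (-4 : ℝ)]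
  rw [Finset.sum_add_distrib, ← Finset.smul_sum, ← Finset.smul_sum, ← apply_eq_sum,
    ((homogField_fieldA hf).homog u).fderiv_self hx]
  simp only [smul_smul, ← Finset.sum_smul, mul_comm (x _), h1]
  push_cast
  module

variable (hD : ∀ u, diracU f u = 0)
include hD

/-- The `⟨u, D_x⟩B` terms cancel in `2Δ_x A - 4⟨u, D_x⟩B`, leaving `-2‖u‖²C`; this uses the
coefficient 2 of `laplaceX_fieldA`. -/
lemma sum_fderiv_fluxField {x : Vec m} (hx : x ≠ 0) (u : Vec m) :
    ∑ i, fderiv ℝ (fun y => fluxField f i y u) x (stdVec i) =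
      vec u * (vec u * ((2 : ℝ) • fieldC f x u)) := by
  have h1 : ∀ i, fderiv ℝ (fun y => fluxField f i y u) x (stdVec i) =
      (2 : ℝ) • fderiv ℝ (fun z => fderiv ℝ (fun y => fieldA f y u) z (stdVec i)) x (stdVec i)
      + (-4 : ℝ) • (u i • fderiv ℝ (fun y => fieldB f y u) x (stdVec i)) := by
    intro i
    have h2 := ((((homogField_fieldA hf).homog u).fderiv_apply
      (stdVec i)).differentiableAt hx).hasFDerivAt.const_smul (2 : ℝ)
    have h3 := ((((homogField_fieldB hf).homog u).differentiableAt hx).hasFDerivAt.const_smul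
      (u i)).const_smul (-4 : ℝ)
    have h4 : HasFDerivAt (fun y => fluxField f i y u) _ x := h2.add h3
    rw [h4.fderiv]
    rfl
  simp only [h1]
  rw [Finset.sum_add_distrib, ← Finset.smul_sum, ← Finset.smul_sum, ← apply_eq_sum,
    laplaceX_fieldA hf hD hx, vec_mul_self_mul]
  module

end Monogenic

variable [NeZero m]

/-- The field of distributions given by an integrable field. -/
def HomogField.toSmoothField {d e : ℤ} {G : Vec m → Vec m → Cl m} (hG : HomogField d e G)
    (hd : -(m : ℤ) < d) : smoothFields m :=
  ⟨toDistribution G, fun φ => polys_smooth (hG.toDistribution_mem hd φ)⟩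

lemma HomogField.toSmoothField_mem {d e : ℤ} {G : Vec m → Vec m → Cl m} (hG : HomogField d e G)
    (hd : -(m : ℤ) < d) : hG.toSmoothField hd ∈ polyFields m e :=
  fun φ => hG.toDistribution_mem hd φ

section Monogenic

variable {f : Vec m → Cl m} {k : ℤ} (hf : f ∈ polys m k) (hD : ∀ u, diracU f u = 0)
include hf hD

/-- The distributional divergence of `fluxField`, modulo multiples of `u`. -/
lemma sum_distDeriv_fluxField (φ : Test m) :
    ((fun u => ∑ i, distDeriv i (toDistribution (fluxField f i)) φ u) -
      φ 0 • fun u => ∫ x, cutoffWeight x • ((2 * (2 - m) : ℝ) • fieldA f x u -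
        (4 : ℝ) • ((inner ℝ x u : ℝ) • fieldB f x u))) ∈ vecMulPolys m k := by
  have hF := fun i => homogField_fluxField hf i
  -- The pointwise divergence has degree `-m` and need not be locally integrable. Its cut-off
  -- integrals are multiples of `u`, and they converge to the distributional divergence minus the
  -- point mass.
  refine (isClosed_vecMulPolys k).mem_of_tendsto (b := atTop) (f := fun (n : ℕ) u =>
    ∑ i, ∫ x, (φ x * cutoff (((n : ℝ) + 1) • x)) •
      fderiv ℝ (fun y => fluxField f i y u) x (stdVec i)) (tendsto_pi_nhds.2 fun u => ?_)
    (Eventually.of_forall fun n => ?_)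
  · have h1 := tendsto_finsetSum Finset.univ fun i _ =>
      ((hF i).homog u).tendsto_cutoff le_rfl φ (stdVec i)
    convert h1 using 2
    simp only [if_true, Finset.sum_sub_distrib, ← Finset.smul_sum]
    have h2 : ∀ i, Annular fun x : Vec m => x i * cutoffWeight x := fun i =>
      annular_cutoffWeight.mul_left (by fun_prop)
    simp only [fderiv_cutoff, inner_stdVec]
    rw [← integral_finsetSum _ fun i _ => (h2 i).integrable_homogField (hF i) u]
    simp only [Pi.sub_apply, Pi.smul_apply]
    congr 2
    refine integral_congr_ae (ae_ne_zero.mono fun x hx => ?_)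
    simp only
    rw [← sum_coord_smul_fluxField hf hx, Finset.smul_sum]
    exact Finset.sum_congr rfl fun i _ => by rw [smul_smul, mul_comm]
  · have hη := annular_mul_cutoff φ (t := (n : ℝ) + 1) (by positivity)
    have hC := ((homogField_fieldC hf).const_smul 2).mulU
    have h1 : (fun u => ∫ x, (φ x * cutoff (((n : ℝ) + 1) • x)) •
        (vec u * (vec u * ((2 : ℝ) • fieldC f x u)))) ∈ vecMulPolys m k := by
      refine integral_vec_mul_mem_vecMulPolys (fun x hx => ?_) (hη.integrable_homogField hC)
      have := hC.poly x hx
      rwa [show k - 2 + 1 = k - 1 by ring] at this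
    refine SetLike.mem_coe.2 ?_
    convert h1 using 1
    funext u
    rw [← integral_finsetSum _ fun i _ =>
      hη.integrable_homogField ((hF i).fderivX (stdVec i)) u]
    refine integral_congr_ae (ae_ne_zero.mono fun x hx => ?_)
    simp only [← Finset.smul_sum, sum_fderiv_fluxField hf hD hx]

lemma diracU_toDistribution_vec_mul_fieldA (φ : Test m) (u : Vec m) :
    diracU (toDistribution (fun x u => vec x * fieldA f x u) φ) u = 0 := by
  have hE := (homogField_fieldA hf).vec_mul
  have hd : -(m : ℤ) < 1 + (2 - m) := by omega
  have h1 := (integral_polys hE.poly (hE.integrable hd φ)).2 u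
  have h2 : ∀ i, Integrable fun x =>
      φ x • fderiv ℝ (fun u => vec x * fieldA f x u) u (stdVec i) := fun i =>
    (hE.fderivU (stdVec i)).integrable hd φ u
  have h3 : ∀ i, Integrable fun x =>
      φ x • (vec (stdVec i) * fderiv ℝ (fun u => vec x * fieldA f x u) u (stdVec i)) := fun i =>
    ((hE.fderivU (stdVec i)).const_mul _).integrable hd φ u
  have h4 : ∀ i, vec (stdVec i) *
      fderiv ℝ (toDistribution (fun x u => vec x * fieldA f x u) φ) u (stdVec i) =
      ∫ x, φ x • (vec (stdVec i) * fderiv ℝ (fun u => vec x * fieldA f x u) u (stdVec i)) := by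
    intro i
    rw [show fderiv ℝ (toDistribution (fun x u => vec x * fieldA f x u) φ) u (stdVec i) = _ from
      h1 (stdVec i), ← integral_const_mul_cl _ (h2 i)]
    simp only [mul_smul_comm]
  rw [diracU]
  simp only [h4]
  rw [← integral_finsetSum _ fun i _ => h3 i]
  refine integral_eq_zero_of_ae (ae_ne_zero.mono fun x hx => ?_)
  simp only [← Finset.smul_sum]
  rw [show ∑ i, vec (stdVec i) * fderiv ℝ (fun u => vec x * fieldA f x u) u (stdVec i) = 0 from
    diracU_vec_mul_fieldA hf hD hx u, smul_zero]
  rfl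

end Monogenic

open smoothFields in
/-- `𝓓₃` applied to the inverted field of a monogenic polynomial. -/
theorem D3_toDistribution_vec_mul_fieldA (hm : 3 ≤ m) {k : ℕ} {f : Vec m → Cl m}
    (hf : f ∈ polys m k) (hD : ∀ u, diracU f u = 0) (φ : Test m) (u : Vec m) :
    D3 k distDeriv (toDistribution fun x u => vec x * fieldA f x u) φ u =
      φ 0 • (diracConst m k • f u) := by
  have hA := homogField_fieldA hf
  have hB := homogField_fieldB hf
  have hC := homogField_fieldC hf
  have hE := hA.vec_mul
  have hxB := hB.vec_mul
  have hxC := hC.vec_mul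
  let FA := hA.toSmoothField (by omega)
  let FB := hB.toSmoothField (by omega)
  let FE := hE.toSmoothField (by omega)
  let FxB := hxB.toSmoothField (by omega)
  let FxC := hxC.toSmoothField (by omega)
  -- `xA`, `xB` and `A` have degrees `3-m`, `2-m` and `2-m`, all above `1-m`, so the pointwise
  -- identities in `h1`, `h2`, `h3` hold for distributions without point masses.
  have h1 : contract mulE derivX FE = (-2 : ℝ) • FA + contract mulE mulCoord FxB := by
    refine Subtype.ext ?_
    rw [coe_diracX, Submodule.coe_add, Submodule.coe_smul, coe_mulU]
    change Dx distDeriv (toDistribution _) = (-2 : ℝ) • toDistribution (fieldA f) +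
      mulU (toDistribution _)
    rw [hE.Dx_toDistribution (by omega), hxB.mulU_toDistribution (by omega), ← toDistribution_smul,
      ← (hA.const_smul (-2)).toDistribution_add (by omega) hxB.mulU (by omega)]
    exact toDistribution_congr fun x hx u => diracX_vec_mul_fieldA hf hD hx u
  have h2 : contract derivU derivX FA = ((m + 2 * k - 2) / 2 : ℝ) • FB := by
    refine Subtype.ext ?_
    rw [coe_innerDuDx, Submodule.coe_smul]
    change innerDuDx distDeriv (toDistribution (fieldA f)) = _ • toDistribution (fieldB f)
    rw [hA.innerDuDx_toDistribution (by omega), ← toDistribution_smul]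
    refine toDistribution_congr fun x hx u => (innerDuDx_fieldA hf hD hx u).trans ?_
    norm_num
  have h3 : contract mulE derivX FxB = (-2 : ℝ) • FB + contract mulE mulCoord FxC := by
    refine Subtype.ext ?_
    rw [coe_diracX, Submodule.coe_add, Submodule.coe_smul, coe_mulU]
    change Dx distDeriv (toDistribution _) = (-2 : ℝ) • toDistribution (fieldB f) +
      mulU (toDistribution _)
    rw [hxB.Dx_toDistribution (by omega), hxC.mulU_toDistribution (by omega),
      ← toDistribution_smul,
      ← (hB.const_smul (-2)).toDistribution_add (by omega) hxC.mulU (by omega)]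
    exact toDistribution_congr fun x hx u => diracX_vec_mul_fieldB hf hD hx u
  have hEm : FE ∈ polyFields m k := hE.toSmoothField_mem _
  have hxBm : FxB ∈ polyFields m (k - 1) := hxB.toSmoothField_mem _
  have hxCm : FxC ∈ polyFields m (k - 2) := hxC.toSmoothField_mem _
  -- The inner derivative acts on `A` and is still regular. Only the outer one acts on a field of
  -- critical degree, so the singular contribution is confined to it.
  have hflux : ∀ i, (derivX i ((2 : ℝ) • derivX i FA + (-4 : ℝ) • mulCoord i FB)).1 =
      distDeriv i (toDistribution (fluxField f i)) := by
    intro i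
    change distDeriv i ((2 : ℝ) • distDeriv i (toDistribution (fieldA f)) +
      (-4 : ℝ) • fun φ u => u i • toDistribution (fieldB f) φ u) = _
    rw [hA.distDeriv_toDistribution (by omega), show (fun φ u => u i • toDistribution (fieldB f) φ u)
      = toDistribution fun x u => u i • fieldB f x u by
        funext φ u
        simp only [toDistribution, smul_comm _ (u i)]
        exact (integral_smul _ _).symm, ← toDistribution_smul, ← toDistribution_smul,
      ← ((hA.fderivX (stdVec i)).const_smul 2).toDistribution_add (by omega)
        ((hB.coord_smul i).const_smul (-4)) (by omega)]
    rfl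
  have hlead : (2 : ℝ) • contract derivX derivX FA - (4 : ℝ) • contract mulCoord derivX FB =
      ∑ i, derivX i ((2 : ℝ) • derivX i FA + (-4 : ℝ) • mulCoord i FB) := by
    simp only [contract, LinearMap.sum_apply, Module.End.mul_apply, map_add, map_smul,
      Finset.sum_add_distrib, ← Finset.smul_sum]
    have : ∀ i, derivX i (mulCoord i FB) = mulCoord i (derivX i FB) := fun i =>
      congrArg (fun A : Module.End ℝ (smoothFields m) => A FB) (operatorRelations.d_y i i)
    simp only [this]
    module
  have hmain := operatorRelations.thirdOrder_apply hm h1 h2 h3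
  rw [hlead] at hmain
  set R := -contract derivX derivX FxB +
        (4 / (m + 2 * k) : ℝ) • contract mulCoord derivX (contract derivU derivX FxB + FxC)
        + (4 / ((m + 2 * k) * (m + 2 * k - 2)) : ℝ) • contract mulE mulCoord
            (contract derivU derivX (contract derivU derivX (contract mulE derivX FE)))
        - (2 / (m + 2 * k) : ℝ) •
            contract derivU derivX (contract mulE derivX (contract mulE derivX FE))
        - (8 / ((m + 2 * k) * (m + 2 * k - 2)) : ℝ) • contract mulCoord derivX
            (contract derivU derivX (contract derivU derivX FE))
        - (8 / ((m + 2 * k) * (m + 2 * k - 2) * (m + 2 * k - 4)) : ℝ) •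
            contract mulE mulCoord (contract mulE mulCoord
              (contract derivU derivX (contract derivU derivX (contract derivU derivX FE)))) with hR
  have hRm : R ∈ polyFields m (k - 1) := by
    have hT := polyFields.innerDuDx_mem hEm
    have hDE := polyFields.diracX_mem hEm
    refine sub_mem (sub_mem (sub_mem (add_mem (add_mem (neg_mem ?_) (Submodule.smul_mem _ _ ?_))
      (Submodule.smul_mem _ _ ?_)) (Submodule.smul_mem _ _ ?_)) (Submodule.smul_mem _ _ ?_))
      (Submodule.smul_mem _ _ ?_)
    · exact polyFields.laplaceX_mem hxBm
    · exact polyFields.cast_mem (polyFields.innerUDx_mem (add_mem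
        (polyFields.cast_mem (polyFields.innerDuDx_mem hxBm) (by ring)) hxCm)) (by ring)
    · exact polyFields.cast_mem (polyFields.mulU_mem (polyFields.innerDuDx_mem
        (polyFields.innerDuDx_mem hDE))) (by ring)
    · exact polyFields.innerDuDx_mem (polyFields.diracX_mem hDE)
    · exact polyFields.cast_mem (polyFields.innerUDx_mem (polyFields.innerDuDx_mem hT)) (by ring)
    · exact polyFields.cast_mem (polyFields.mulU_mem (polyFields.mulU_mem
        (polyFields.innerDuDx_mem (polyFields.innerDuDx_mem hT)))) (by ring)
  have hD3 : D3 k distDeriv (toDistribution fun x u => vec x * fieldA f x u) φ =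
      (fun u => ∑ i, distDeriv i (toDistribution (fluxField f i)) φ u) +
        fun u => vec u * R.1 φ u := by
    have h5 := congrArg (fun F : smoothFields m => F.1 φ) hmain
    simp only [coe_thirdOrder] at h5
    refine Eq.trans h5 ?_
    funext u
    rw [Submodule.coe_add, Pi.add_apply, Pi.add_apply, coe_sum, coe_mulU]
    simp only [hflux]
    rfl
  set p := D3 k distDeriv (toDistribution fun x u => vec x * fieldA f x u) φ with hp
  have hpm : p ∈ polys m k := by
    rw [hp]
    have := polyFields.thirdOrder_mem hEm k φ
    rwa [coe_thirdOrder] at this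
  have hpD : ∀ u, diracU p u = 0 := by
    have hk : contract mulCoord derivU FE = (k : ℝ) • FE := by
      refine Subtype.ext (funext fun φ => funext fun u => ?_)
      rw [coe_euler]
      simpa using fderiv_apply_self (hEm φ) u
    have hF : contract mulE derivU FE = 0 := by
      refine Subtype.ext (funext fun φ => funext fun u => ?_)
      rw [coe_dirac]
      exact diracU_toDistribution_vec_mul_fieldA hf hD φ u
    -- With `m ≥ 3` this forces `m = 4`, `k = 0`; the field is then constant in `u`, and its
    -- `u`-derivatives lie in the zero space of degree `-1`.
    have h4 : m + 2 * k = 4 → contract derivU derivX FE = 0 := by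
      intro h
      obtain rfl : k = 0 := by omega
      refine Subtype.ext (funext fun φ => ?_)
      exact (Submodule.mem_bot ℂ).1 (polyFields.innerDuDx_mem hEm φ)
    have h5 := congrArg (fun F : smoothFields m => F.1 φ)
      (operatorRelations.dirac_thirdOrder hm h4 hF hk)
    simp only [coe_dirac, coe_thirdOrder] at h5
    exact fun u => congrFun h5 u
  -- Three congruences add up: the divergence of the flux against its point mass, the point mass
  -- against `diracConst m k • f`, and the remainder `u R`.
  have hmem : p - (φ 0 * diracConst m k) • f ∈ vecMulPolys m k := by
    have h6 := add_mem (add_mem (sum_distDeriv_fluxField hf hD φ)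
      (Submodule.smul_mem _ (φ 0) (integral_fieldA_fieldB hm hf hD)))
      (vec_mul_mem_vecMulPolys (hRm φ))
    convert h6 using 1
    rw [hD3]
    module
  have hcf : (φ 0 * diracConst m k) • f ∈ polys m k := real_smul_mem _ hf
  -- The difference is also monogenic, hence zero.
  have h7 := eq_zero_of_mem_vecMulPolys (by omega) hmem fun u => by
    rw [diracU_sub hpm hcf, hpD,
      show diracU ((φ 0 * diracConst m k) • f) u = _ from diracU_smul hf _ u, hD]
    simp
  have h8 := congrFun (sub_eq_zero.1 h7) u
  rw [h8, Pi.smul_apply, smul_smul]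

end HigherSpin

namespace HigherSpin

open scoped ContDiff Topology
open Filter

variable {m : ℕ}

/-! ### A positive definite invariant form on the Clifford algebra -/

/-- Induction over the Clifford algebra. -/
theorem cl_induction {C : Cl m → Prop} (one : C 1) (vec : ∀ v, C (vec v))
    (mul : ∀ x y, C x → C y → C (x * y)) (add : ∀ x y, C x → C y → C (x + y))
    (smul : ∀ (z : ℂ) x, C x → C (z • x)) (x : Cl m) : C x := by
  let ι : CliffordAlgebra (negNormSq m) → Cl m := fun y => (1 : ℂ) ⊗ₜ[ℝ] y
  have hsmul : ∀ (z : ℂ) y, (TensorProduct.tmul ℝ z y : Cl m) = z • ι y := by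
    intro z y
    change _ = TensorProduct.tmul ℝ (z • (1 : ℂ)) y
    rw [smul_eq_mul, mul_one]
  have h : ∀ y, C (ι y) := by
    intro y
    induction y using CliffordAlgebra.induction with
    | algebraMap r =>
      have h1 : ι (algebraMap ℝ (CliffordAlgebra (negNormSq m)) r) = (r : ℂ) • (1 : Cl m) := by
        change (1 : ℂ) ⊗ₜ[ℝ] _ = TensorProduct.tmul ℝ ((r : ℂ) • (1 : ℂ)) 1
        rw [Algebra.algebraMap_eq_smul_one, ← TensorProduct.smul_tmul]
        simp
      rw [h1]
      exact smul _ _ one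
    | ι v => exact vec v
    | mul y z hy hz =>
      have h1 : ι (y * z) = ι y * ι z := by
        change _ = TensorProduct.tmul ℝ (1 : ℂ) y * TensorProduct.tmul ℝ (1 : ℂ) z
        erw [Algebra.TensorProduct.tmul_mul_tmul, mul_one]
      rw [h1]
      exact mul _ _ hy hz
    | add y z hy hz =>
      have h1 : ι (y + z) = ι y + ι z := TensorProduct.tmul_add _ _ _
      rw [h1]
      exact add _ _ hy hz
  have h0 : C 0 := by
    have := smul 0 _ one
    rwa [zero_smul] at this
  refine TensorProduct.induction_on (motive := fun x => C x) x h0 (fun z y => ?_) fun x y => add x y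
  rw [hsmul]
  exact smul z _ (h y)

/-- Positive definite real forms for which the adjoint of a complex scalar is its conjugate. -/
structure PositiveForm (β : LinearMap.BilinForm ℝ (Cl m)) : Prop where
  pos : ∀ a, a ≠ 0 → 0 < β a a
  smul : ∀ (c : ℂ) a b, β (c • a) b = β a (star c • b)

lemma PositiveForm.nonneg {β : LinearMap.BilinForm ℝ (Cl m)} (h : PositiveForm β) (a : Cl m) :
    0 ≤ β a a := by
  by_cases ha : a = 0
  · simp [ha]
  · exact (h.pos a ha).le

/-- The form `∑ Re(conj(a_S) b_S)` in the coordinates of `clBasis`. -/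
def coordForm (m : ℕ) : LinearMap.BilinForm ℝ (Cl m) :=
  LinearMap.mk₂ ℝ
    (fun a b => ∑ S, ((starRingEnd ℂ) ((clBasis m).repr a S) * (clBasis m).repr b S).re)
    (fun a a' b => by
      simp only [map_add, Finsupp.add_apply, add_mul, Complex.add_re, Finset.sum_add_distrib])
    (fun r a b => by
      rw [← Complex.coe_smul, Finset.smul_sum]
      refine Finset.sum_congr rfl fun S _ => ?_
      rw [map_smul, Finsupp.smul_apply, smul_eq_mul, map_mul, Complex.conj_ofReal, mul_assoc,
        Complex.re_ofReal_mul, smul_eq_mul])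
    (fun a b b' => by
      simp only [map_add, Finsupp.add_apply, mul_add, Complex.add_re, Finset.sum_add_distrib])
    (fun r a b => by
      rw [← Complex.coe_smul, Finset.smul_sum]
      refine Finset.sum_congr rfl fun S _ => ?_
      rw [map_smul, Finsupp.smul_apply, smul_eq_mul, mul_left_comm, Complex.re_ofReal_mul,
        smul_eq_mul])

lemma positiveForm_coordForm : PositiveForm (coordForm m) := by
  refine ⟨fun a ha => ?_, fun c a b => ?_⟩
  · have h1 : ∀ S, ((starRingEnd ℂ) ((clBasis m).repr a S) * (clBasis m).repr a S).re =
        Complex.normSq ((clBasis m).repr a S) := fun S => by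
      rw [← Complex.normSq_eq_conj_mul_self, Complex.ofReal_re]
    obtain ⟨S, hS⟩ : ∃ S, (clBasis m).repr a S ≠ 0 := by
      by_contra! h
      exact ha ((clBasis m).repr.map_eq_zero_iff.1 (Finsupp.ext h))
    refine Finset.sum_pos' (fun S _ => ?_) ⟨S, Finset.mem_univ S, ?_⟩
    · rw [h1]; exact Complex.normSq_nonneg _
    · rw [h1]; exact Complex.normSq_pos.2 hS
  · change ∑ S, ((starRingEnd ℂ) ((clBasis m).repr (c • a) S) * (clBasis m).repr b S).re =
      ∑ S, ((starRingEnd ℂ) ((clBasis m).repr a S) * (clBasis m).repr (star c • b) S).re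
    refine Finset.sum_congr rfl fun S _ => ?_
    rw [map_smul, map_smul, Finsupp.smul_apply, Finsupp.smul_apply, smul_eq_mul, smul_eq_mul,
      map_mul, starRingEnd_apply, mul_assoc, mul_left_comm]

/-- Averaging yields a positive form that is invariant under the basis vectors. -/
lemma exists_positiveForm_invariant (s : Finset (Fin m)) :
    ∃ β : LinearMap.BilinForm ℝ (Cl m), PositiveForm β ∧
      ∀ i ∈ s, ∀ a b, β (vec (stdVec i) * a) (vec (stdVec i) * b) = β a b := by
  induction s using Finset.induction_on with
  | empty => exact ⟨coordForm m, positiveForm_coordForm, by simp⟩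
  | insert i s _ ih =>
    obtain ⟨β, hβ, h⟩ := ih
    let L : Cl m →ₗ[ℝ] Cl m := LinearMap.mulLeft ℝ (vec (stdVec i))
    have hL : ∀ a b, (β + β.compl₁₂ L L) a b =
        β a b + β (vec (stdVec i) * a) (vec (stdVec i) * b) := fun _ _ => rfl
    refine ⟨β + β.compl₁₂ L L, ⟨fun a ha => ?_, fun c a b => ?_⟩, fun j hj a b => ?_⟩
    · rw [hL]
      exact add_pos_of_pos_of_nonneg (hβ.pos a ha) (hβ.nonneg _)
    · rw [hL, hL, mul_smul_comm, mul_smul_comm, hβ.smul, hβ.smul]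
    · rw [hL, hL]
      by_cases hij : j = i
      -- Since `e_i² = -1`, applying `e_i` exchanges the two summands of the new form.
      · subst hij
        rw [stdVec_mul_stdVec, stdVec_mul_stdVec, map_neg, map_neg, LinearMap.neg_apply, neg_neg,
          add_comm]
      · have hjs := (Finset.mem_insert.1 hj).resolve_left hij
        -- Anticommutation costs a sign in each argument, and the two signs cancel, so the earlier
        -- invariances persist.
        have h1 : ∀ a, vec (stdVec i) * (vec (stdVec j) * a) =
            -(vec (stdVec j) * (vec (stdVec i) * a)) := fun a => by
          rw [vec_mul_vec_mul, inner_stdVec, stdVec_apply, if_neg fun h => hij h.symm]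
          simp
        rw [h j hjs, h1, h1, map_neg, map_neg, LinearMap.neg_apply, neg_neg, h j hjs]

/-- A positive form on the Clifford algebra for which the adjoint of left multiplication by `x` is
left multiplication by `x̄`. -/
lemma exists_positiveForm_star (m : ℕ) :
    ∃ β : LinearMap.BilinForm ℝ (Cl m), PositiveForm β ∧
      ∀ x a b, β (x * a) b = β a (star x * b) := by
  obtain ⟨β, hβ, h⟩ := exists_positiveForm_invariant (Finset.univ : Finset (Fin m))
  refine ⟨β, hβ, fun x => ?_⟩
  have hvec : ∀ (v : Vec m) a b, β (vec v * a) b = β a (star (vec v) * b) := by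
    intro v a b
    -- An isometry with square `-1` is skew-adjoint, and `ē_i = -e_i`.
    have h1 : ∀ i, β (vec (stdVec i) * a) b = -β a (vec (stdVec i) * b) := fun i => by
      rw [← h i (Finset.mem_univ i) a, stdVec_mul_stdVec, map_neg, neg_neg]
    rw [star_vec, neg_mul, map_neg, vec_eq_sum v]
    simp only [Finset.sum_mul, map_sum, LinearMap.sum_apply, smul_mul_assoc, map_smul,
      LinearMap.smul_apply, h1, ← Finset.sum_neg_distrib, smul_neg]
  induction x using cl_induction with
  | one => intro a b; rw [star_one, one_mul, one_mul]
  | vec v => exact hvec v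
  | mul x y hx hy => intro a b; rw [mul_assoc, hx, hy, star_mul, mul_assoc]
  | add x y hx hy =>
    intro a b
    rw [add_mul, map_add, LinearMap.add_apply, hx, hy, star_add, add_mul, map_add]
  | smul z x hx => intro a b; rw [star_smul, smul_mul_assoc, hβ.smul, hx, smul_mul_assoc, mul_smul_comm]

/-! ### The reproducing kernel -/

/-- Clifford conjugation as a continuous linear map. -/
def starCLM (m : ℕ) : Cl m →L[ℝ] Cl m :=
  LinearMap.toContinuousLinearMap
    { toFun := star, map_add' := star_add, map_smul' := fun r a => by simp }

@[simp] lemma starCLM_apply (a : Cl m) : starCLM m a = star a := rfl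

/-- `𝓜_k` as a subspace. -/
def monogenicSubmodule (m k : ℕ) : Submodule ℂ (Vec m → Cl m) where
  carrier := Monogenic m k
  add_mem' {p q} hp hq := ⟨add_mem hp.1 hq.1, fun u => by
    have h1 : p ∈ polys m k := hp.1
    have h2 : q ∈ polys m k := hq.1
    have h3 := hp.2 u
    have h4 := hq.2 u
    simp only [diracU] at h3 h4 ⊢
    simp only [fderiv_add (polys_differentiable h1 u) (polys_differentiable h2 u), add_apply,
      mul_add, Finset.sum_add_distrib, h3, h4, add_zero]⟩
  zero_mem' := ⟨zero_mem _, fun u => by simp [diracU]⟩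
  smul_mem' c p hp := ⟨Submodule.smul_mem _ c hp.1, fun u => by
    have h1 : p ∈ polys m k := hp.1
    have h3 := hp.2 u
    simp only [diracU] at h3 ⊢
    simp only [fderiv_const_smul (polys_differentiable h1 u), smul_apply, mul_smul_comm,
      ← Finset.smul_sum, h3, smul_zero]⟩

lemma mul_const_mem_monogenic {k : ℕ} {p : Vec m → Cl m} (hp : p ∈ Monogenic m k) (b : Cl m) :
    (fun u => p u * b) ∈ Monogenic m k := by
  have h1 : p ∈ polys m k := hp.1
  refine ⟨mul_const_mem b h1, fun u => ?_⟩
  have h2 : HasFDerivAt (fun u => p u * b) (((mulCLM m).flip b).comp (fderiv ℝ p u)) u :=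
    ((mulCLM m).flip b).hasFDerivAt.comp u (polys_differentiable h1 u).hasFDerivAt
  have h3 := hp.2 u
  simp only [diracU] at h3 ⊢
  simp only [h2.fderiv, ContinuousLinearMap.comp_apply, ContinuousLinearMap.flip_apply,
    mulCLM_apply, ← mul_assoc, ← Finset.sum_mul, h3, zero_mul]

lemma continuous_of_mem_monogenic {k : ℕ} {p : Vec m → Cl m} (hp : p ∈ Monogenic m k) :
    Continuous p :=
  have h1 : p ∈ polys m k := hp.1
  (polys_smooth h1).continuous

lemma integrable_sphere {E : Type*} [NormedAddCommGroup E] {F : Vec m → E} (hF : Continuous F) :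
    Integrable (fun u : Metric.sphere (0 : Vec m) 1 => F u)
      (volume : Measure (Vec m)).toSphere :=
  (hF.comp continuous_subtype_val).integrable_of_hasCompactSupport
    (HasCompactSupport.of_compactSpace _)

lemma continuous_star_mul {f g : Vec m → Cl m} (hf : Continuous f) (hg : Continuous g) :
    Continuous fun u => star (g u) * f u :=
  (((mulCLM m).comp (starCLM m)).continuous.comp hg).clm_apply hf

lemma continuous_form {f g : Vec m → Cl m} (hf : Continuous f) (hg : Continuous g)
    (β : LinearMap.BilinForm ℝ (Cl m)) : Continuous fun u => β (g u) (f u) := by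
  let B : Cl m →L[ℝ] Cl m →L[ℝ] ℝ := LinearMap.toContinuousLinearMap
    (LinearMap.toContinuousLinearMap.toLinearMap ∘ₗ β)
  exact (B.continuous.comp hg).clm_apply hf

/-- The pairing `∫ β(g, f) dS` on `𝓜_k`. -/
def spherePairing (k : ℕ) (β : LinearMap.BilinForm ℝ (Cl m)) :
    LinearMap.BilinForm ℝ (monogenicSubmodule m k) :=
  LinearMap.mk₂ ℝ (fun g f => ∫ u : Metric.sphere (0 : Vec m) 1, β (g.1 u) (f.1 u) ∂(volume : Measure (Vec m)).toSphere)
    (fun g g' f => by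
      simp only [Submodule.coe_add, Pi.add_apply, map_add, LinearMap.add_apply]
      exact integral_add
        (integrable_sphere (continuous_form (continuous_of_mem_monogenic f.2) (continuous_of_mem_monogenic g.2) β))
        (integrable_sphere (continuous_form (continuous_of_mem_monogenic f.2) (continuous_of_mem_monogenic g'.2) β)))
    (fun r g f => by
      rw [smul_eq_mul, ← integral_const_mul]
      refine integral_congr_ae (Eventually.of_forall fun u => ?_)
      change β (r • g.1 u) (f.1 u) = _
      rw [map_smul]
      rfl)
    (fun g f f' => by
      simp only [Submodule.coe_add, Pi.add_apply, map_add]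
      exact integral_add
        (integrable_sphere (continuous_form (continuous_of_mem_monogenic f.2) (continuous_of_mem_monogenic g.2) β))
        (integrable_sphere (continuous_form (continuous_of_mem_monogenic f'.2) (continuous_of_mem_monogenic g.2) β)))
    (fun r g f => by
      rw [smul_eq_mul, ← integral_const_mul]
      refine integral_congr_ae (Eventually.of_forall fun u => ?_)
      change β (g.1 u) (r • f.1 u) = _
      rw [map_smul]
      rfl)

lemma eq_zero_of_sphere [NeZero m] {k : ℕ} {f : Vec m → Cl m} (hf : f ∈ polys m k)
    (h : ∀ u : Metric.sphere (0 : Vec m) 1, f u = 0) : f = 0 := by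
  funext u
  by_cases hu : u = 0
  · have h1 := polys_smul hf 0 (stdVec (0 : Fin m))
    rw [h ⟨stdVec 0, by simp [norm_stdVec]⟩, zero_smul, smul_zero] at h1
    rw [hu, h1]
    rfl
  · have hu' : ‖u‖ ≠ 0 := norm_ne_zero_iff.2 hu
    have h1 := polys_smul hf ‖u‖ (‖u‖⁻¹ • u)
    rw [h ⟨‖u‖⁻¹ • u, by simp [norm_smul, hu']⟩, smul_smul, mul_inv_cancel₀ hu', one_smul,
      smul_zero] at h1
    exact h1

/-- The sphere pairing is positive definite on the finite-dimensional space `𝓜_k`, so the functional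
`f ↦ β(1, f(v))` is represented by some `g_v`. Stability of `𝓜_k` under right multiplication
upgrades this scalar identity to the Clifford-valued one. -/
lemma exists_isReproducingKernel [NeZero m] (k : ℕ) :
    ∃ Z : Vec m → Vec m → Cl m, IsReproducingKernel m k Z := by
  obtain ⟨β, hβ, hstar⟩ := exists_positiveForm_star m
  have hfin : FiniteDimensional ℂ (monogenicSubmodule m k) := by
    have h1 : FiniteDimensional ℂ (polys m k) := inferInstance
    exact Submodule.finiteDimensional_of_le (S₂ := polys m k) fun p hp => hp.1
  have hfinR : FiniteDimensional ℝ (monogenicSubmodule m k) := FiniteDimensional.complexToReal _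
  have hinj : Function.Injective (spherePairing k β) := by
    rw [← LinearMap.ker_eq_bot, LinearMap.ker_eq_bot']
    intro f hf
    have hc : Continuous fun u : Metric.sphere (0 : Vec m) 1 => β (f.1 u) (f.1 u) :=
      (continuous_form (continuous_of_mem_monogenic f.2) (continuous_of_mem_monogenic f.2) β).comp continuous_subtype_val
    have h1 : ∫ u : Metric.sphere (0 : Vec m) 1, β (f.1 u) (f.1 u) ∂(volume : Measure (Vec m)).toSphere = 0 :=
      congrArg (fun L : Module.Dual ℝ (monogenicSubmodule m k) => L f) hf
    rw [integral_eq_zero_iff_of_nonneg (fun u => hβ.nonneg _)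
      (integrable_sphere (continuous_form (continuous_of_mem_monogenic f.2) (continuous_of_mem_monogenic f.2) β))] at h1
    have h2 := Continuous.ae_eq_iff_eq _ hc continuous_const |>.1 h1
    have h3 : f.1 ∈ polys m k := f.2.1
    refine Subtype.ext (eq_zero_of_sphere h3 fun u => ?_)
    by_contra h0
    exact (hβ.pos _ h0).ne' (congrFun h2 u)
  have hsurj : Function.Surjective (spherePairing k β) :=
    (LinearMap.injective_iff_surjective_of_finrank_eq_finrank
      (Subspace.dual_finrank_eq (K := ℝ)).symm).1 hinj
  have hZ : ∀ v : Vec m, ∃ g : monogenicSubmodule m k, ∀ f : monogenicSubmodule m k,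
      ∫ u : Metric.sphere (0 : Vec m) 1, β (g.1 u) (f.1 u) ∂(volume : Measure (Vec m)).toSphere = β 1 (f.1 v) := by
    intro v
    let ev : Module.Dual ℝ (monogenicSubmodule m k) :=
      { toFun := fun f => β 1 (f.1 v)
        map_add' := fun f g => map_add (β 1) _ _
        map_smul' := fun r f => map_smul (β 1) _ _ }
    obtain ⟨g, hg⟩ := hsurj ev
    exact ⟨g, fun f => congrArg (fun L : Module.Dual ℝ (monogenicSubmodule m k) => L f) hg⟩
  choose g hg using hZ
  refine ⟨fun u v => (g v).1 u, fun v => (g v).2, fun f hf v => ?_⟩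
  have hint := integrable_sphere (m := m)
    (continuous_star_mul (continuous_of_mem_monogenic hf) (continuous_of_mem_monogenic (g v).2))
  set w := ∫ u : Metric.sphere (0 : Vec m) 1, star ((g v).1 u) * f u ∂(volume : Measure (Vec m)).toSphere with hw
  -- Test `g_v` against `f b`, using `β(g, fb) = β(1, ḡ f b)`. The choice `b = conj(w - f(v))` then
  -- gives `β(b, b) = 0`, hence `w = f(v)`.
  have h1 : ∀ b, β 1 (w * b) = β 1 (f v * b) := by
    intro b
    have h2 := hg v ⟨fun u => f u * b, mul_const_mem_monogenic hf b⟩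
    rw [← h2]
    let L : Cl m →L[ℝ] ℝ := (LinearMap.toContinuousLinearMap (β 1)).comp ((mulCLM m).flip b)
    change L w = _
    rw [hw, ← L.integral_comp_comm hint]
    refine integral_congr_ae (Eventually.of_forall fun u => ?_)
    change β 1 (star ((g v).1 u) * f u * b) = β ((g v).1 u) (f u * b)
    conv_rhs => rw [← mul_one ((g v).1 u)]
    rw [hstar, mul_assoc]
  by_contra h0
  have h3 : star (w - f v) ≠ 0 := fun h => h0 (sub_eq_zero.1 (star_eq_zero.1 h))
  have h4 := hβ.pos _ h3
  have h5 := hstar (star (w - f v)) 1 (star (w - f v))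
  rw [mul_one, star_star, sub_mul, map_sub, h1, sub_self] at h5
  exact h4.ne' h5

/-- Each kernel reproduces the other, and the two integrals obtained are Clifford conjugates. -/
lemma IsReproducingKernel.symm {k : ℕ} {Z Z' : Vec m → Vec m → Cl m}
    (h : IsReproducingKernel m k Z) (h' : IsReproducingKernel m k Z') (u v : Vec m) :
    Z u v = star (Z' v u) := by
  have hint := integrable_sphere (m := m)
    (continuous_star_mul (continuous_of_mem_monogenic (h'.1 u)) (continuous_of_mem_monogenic (h.1 v)))
  rw [← h'.2 _ (h.1 v) u, ← h.2 _ (h'.1 u) v, ← starCLM_apply, ← (starCLM m).integral_comp_comm hint]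
  simp

lemma IsReproducingKernel.unique {k : ℕ} {Z Z' : Vec m → Vec m → Cl m}
    (h : IsReproducingKernel m k Z) (h' : IsReproducingKernel m k Z') : Z' = Z := by
  funext u v
  rw [h'.symm h u v, ← h.symm h u v]

end HigherSpin

end

/-! ### The theorem -/

theorem mainTheorem6 (m k : ℕ) (hm : 3 ≤ m) (hmk : m = 4 → k = 0) :
    ∃ Z : HigherSpin.Vec m → HigherSpin.Vec m → HigherSpin.Cl m,
      HigherSpin.IsReproducingKernel m k Z ∧
      (∀ Z', HigherSpin.IsReproducingKernel m k Z' → Z' = Z) ∧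
      ∃ c₁ : ℝ, c₁ ≠ 0 ∧
        HigherSpin.IsFundamentalSolution k Z
          (fun x u v => c₁ • ((‖x‖ ^ (2 - (m : ℤ))) •
            (HigherSpin.vec x * Z (HigherSpin.conj x u) v))) := by
  have : NeZero m := ⟨by omega⟩
  obtain ⟨Z, hZ⟩ := HigherSpin.exists_isReproducingKernel (m := m) k
  have hc := HigherSpin.diracConst_ne_zero hm hmk
  -- The normalizing constant is the inverse of the mass at the origin.
  refine ⟨Z, hZ, fun Z' => hZ.unique, (HigherSpin.diracConst m k)⁻¹, inv_ne_zero hc, fun v => ?_⟩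
  set c := HigherSpin.diracConst m k
  set f : HigherSpin.Vec m → HigherSpin.Cl m := fun u => Z u v
  have hf : f ∈ HigherSpin.polys m k := (hZ.1 v).1
  have hD : ∀ u, HigherSpin.diracU f u = 0 := (hZ.1 v).2
  have hcf : (fun u => c⁻¹ • f u) ∈ HigherSpin.polys m k := HigherSpin.real_smul_mem _ hf
  have hcD : ∀ u, HigherSpin.diracU (fun u => c⁻¹ • f u) u = 0 := fun u => by
    rw [HigherSpin.diracU_smul hf, hD, smul_zero]
  -- The constant is absorbed into the monogenic polynomial, so the candidate is exactly `xA` for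
  -- `c⁻¹ f`.
  have hE : ∀ x u, c⁻¹ • (‖x‖ ^ (2 - (m : ℤ)) • (HigherSpin.vec x * Z (HigherSpin.conj x u) v)) =
      HigherSpin.vec x * HigherSpin.fieldA (fun u => c⁻¹ • f u) x u := fun x u => by
    simp only [HigherSpin.fieldA, f, mul_smul_comm]
    rw [smul_comm]
  have hH := (HigherSpin.homogField_fieldA hcf).vec_mul
  simp only [hE]
  refine ⟨fun u => (hH.homog u).locallyIntegrable (by omega), fun x hx =>
    ⟨hH.poly x hx, HigherSpin.diracU_vec_mul_fieldA hcf hcD hx⟩, fun φ u => ?_⟩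
  rw [HigherSpin.D3_toDistribution_vec_mul_fieldA hm hcf hcD, smul_inv_smul₀ hc]
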